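/- Let $\mathbf{k}$ be $\mathbb{R}$ or $\mathbb{C}$, let $N\ge 0$, $R=\mathbf{k}[\lambda_1,\dots,\lambda_N]$ and $q_N=\sum_i\lambda_i^2$. Let $\mathfrak{t}=\langle Q_1,\dots,Q_N\rangle\oplus\langle H\rangle$ be the 1d super-translation algebra: $Q_i$ odd of degree $1$, $H$ even of degree $2$, $\{Q_i,Q_j\}=2\delta_{ij}H$, $[H,Q_i]=0$. **Adinkras.** An Adinkra $A$ is a finite simple graph with vertex set $V$, a parity $|\cdot|:V\to\mathbb{Z}/2$, a height $h:V\to\mathbb{Z}$, an edge coloring $c$ with values in $\{1,\dots,N\}$ and a dashing $p$ of the edges with values in $\mathbb{Z}/2$, such that: adjacent vertices have different parities and heights that differ by $1$ (the endpoint of an edge $e$ of larger height is its source $s(e)$, the other one its target $t(e)$); every vertex has exactly one incident edge of each color; and for $i\neq j$ the edges of colors $i,j$ form a disjoint union of 4-cycles, each with $\sum_e p(e)=1\in\mathbb{Z}/2$. **The complex.** $C^\bullet(A)$ is the complex of free $R$-modules with basis $V$, the vertex $u$ in degree $-h(u)$, and $$d(u)=\sum_{s(e)=u}(-1)^{p(e)}\lambda_{c(e)}\,t(e),\qquad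 d^\dagger(u)=\sum_{t(e)=u}(-1)^{p(e)}\lambda_{c(e)}\,s(e),$$ so that $d^2=(d^\dagger)^2=0$ and $dd^\dagger+d^\dagger d=q_N$. **The multiplet.** $\mathcal{V}(A)$ is the $\mathfrak{t}$-module of fields $\varphi=(\varphi_v)_{v\in V}$, $\varphi_v\in\mathbf{k}[t]$, on which $H=\partial_t$ and, for each edge $e$ of color $i$ with source $w$ and target $v$, $$(Q_i\varphi)_v=(-1)^{p(e)}\varphi_w,\qquad (Q_i\varphi)_w=(-1)^{p(e)}H\varphi_v .$$ The field whose only non-zero component is $\varphi_v=t^k$ has degree $-h(v)-2k$ and parity $|v|$. **The Chevalley–Eilenberg complex.** $\mathrm{CE}^\bullet(\mathfrak{t})=(R[\mathsf{v}],\,q_N\partial_{\mathsf v})$, where $\mathsf v$ has degree $-1$, $\mathsf v^2=0$, and $R$ is in degree $0$. For a graded $\mathfrak{t}$-module $\mathcal{V}$, $\mathrm{CE}^\bullet(\mathfrak{t},\mathcal{V})=R[\mathsf v]\otimes_{\mathbf{k}}\mathcal{V}$ with total degree and differential $q_N\partial_{\mathsf v}+\sum_i\lambda_iQ_i-\mathsf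 vH$, in which $\mathsf v$ anticommutes with $\sum_i\lambda_iQ_i$. It is a dg $\mathrm{CE}^\bullet(\mathfrak{t})$-module. The complex $C^\bullet(A)$ is a dg $\mathrm{CE}^\bullet(\mathfrak{t})$-module, with $\mathsf v$ acting as $d^\dagger$. **The pure spinor functor.** It sends a dg $\mathrm{CE}^\bullet(\mathfrak{t})$-module $M$ to $\mathcal{A}^\bullet(M)=\mathbf{k}[t,\theta_1,\dots,\theta_N]\otimes_{\mathbf{k}}M$ ($\theta_i$ anticommuting, $\deg\theta_i=-1$, $\deg t=-2$), with differential $\sum_i D_i\otimes\lambda_i+1\otimes d_M+\partial_t\otimes \mathsf v$ (Koszul signs in the last two terms), $D_i=\partial_{\theta_i}-\theta_i\partial_t$, and with $Q_i$ and $H$ acting by $\partial_{\theta_i}+\theta_i\partial_t$ and $\partial_t$. **Proposition.** For every Adinkra $A$: 1. $C^\bullet(A)$ and $\mathrm{CE}^\bullet(\mathfrak{t},\mathcal{V}(A))$ have bounded cohomology and are isomorphic in $D^b(R\text{-}\mathrm{Mod})$. In fact there is a morphism of dg $\mathrm{CE}^\bullet(\mathfrak{t})$-modules $\mathrm{CE}^\bullet(\mathfrak{t},\mathcal{V}(A))\to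 C^\bullet(A)$ that is a quasi-isomorphism. 2. Applying the pure spinor functor to $C^\bullet(A)$ gives back the multiplet: $\mathcal{A}^\bullet(C^\bullet(A))\simeq\mathcal{V}(A)$ as $\mathfrak{t}$-modules; that is, there is an even, degree $0$, $\mathfrak{t}$-equivariant quasi-isomorphism $\mathcal{V}(A)\to\mathcal{A}^\bullet(C^\bullet(A))$, where $\mathcal{V}(A)$ has zero differential. -/

import Mathlib

open CategoryTheory TensorProduct

universe u v w

namespace SusyQM

noncomputable section

/-! ### Auxiliary facts on gradings -/

theorem exists_degreeOperator {K E ι : Type*} [Field K] [AddCommGroup E] [Module K E]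
    [DecidableEq ι] (𝒢 : ι → Submodule K E) (h : DirectSum.IsInternal 𝒢) (c : ι → K) :
    ∃ T : E →ₗ[K] E, ∀ n, ∀ x ∈ 𝒢 n, T x = c n • x := by
  let e := LinearEquiv.ofBijective (DirectSum.coeLinearMap 𝒢) h
  refine ⟨(DirectSum.toModule K ι E (fun n => c n • (𝒢 n).subtype)) ∘ₗ e.symm.toLinearMap, ?_⟩
  intro n x hx
  have : e.symm x = DirectSum.lof K ι (fun n => 𝒢 n) n ⟨x, hx⟩ := by
    rw [LinearEquiv.symm_apply_eq]
    exact (DirectSum.coeLinearMap_lof 𝒢 n ⟨x, hx⟩).symm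
  simp [this]

theorem isInternal_of_degreeOperator {K E : Type*} [Field K] [CharZero K] [AddCommGroup E]
    [Module K E] (𝒢 : ℤ → Submodule K E) (T : E →ₗ[K] E)
    (hT : ∀ n, ∀ x ∈ 𝒢 n, T x = (n : K) • x) (htop : ∀ x, x ∈ ⨆ n, 𝒢 n) :
    DirectSum.IsInternal 𝒢 := by
  refine DirectSum.isInternal_submodule_of_iSupIndep_of_iSup_eq_top ?_
    (eq_top_iff.2 fun x _ => htop x)
  have h1 := (Module.End.eigenspaces_iSupIndep (R := K) (M := E) T).comp
    (f := fun n : ℤ => (n : K)) Int.cast_injective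
  refine h1.mono fun n x hx => ?_
  simpa [Module.End.mem_eigenspace_iff] using hT n x hx

/-! ### Modules over the super-translation algebra

`𝔱 = ⟨Q₁, …, Q_N⟩ ⊕ ⟨H⟩`, with `Q_i` odd of degree `1`, `H` even of degree `2`, and
`{Q_i, Q_j} = 2 δ_ij H`, `[H, Q_i] = 0`. -/

/-- A `ℤ`-graded super vector space with an action of the super-translation algebra `𝔱`.
The super structure (the `ℤ/2`-grading) is recorded by the parity involution `par`. -/
structure TModule (𝕜 : Type u) [RCLike 𝕜] (N : ℕ) where
  carrier : Type v
  [addCommGroup : AddCommGroup carrier]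
  [module : Module 𝕜 carrier]
  grade : ℤ → Submodule 𝕜 carrier
  internal : DirectSum.IsInternal grade
  par : carrier →ₗ[𝕜] carrier
  par_par : ∀ x, par (par x) = x
  par_grade : ∀ n, ∀ x ∈ grade n, par x ∈ grade n
  Q : Fin N → carrier →ₗ[𝕜] carrier
  H : carrier →ₗ[𝕜] carrier
  Q_grade : ∀ i n, ∀ x ∈ grade n, Q i x ∈ grade (n + 1)
  H_grade : ∀ n, ∀ x ∈ grade n, H x ∈ grade (n + 2)
  par_Q : ∀ i x, par (Q i x) = -Q i (par x)
  par_H : ∀ x, par (H x) = H (par x)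
  Q_Q : ∀ i j x, Q i (Q j x) + Q j (Q i x) = if i = j then (2 : 𝕜) • H x else 0
  H_Q : ∀ i x, H (Q i x) = Q i (H x)

attribute [instance] TModule.addCommGroup TModule.module

/-- A differential graded module over `𝔱` (regarded as a graded Lie superalgebra with zero
differential). -/
structure DGTModule (𝕜 : Type u) [RCLike 𝕜] (N : ℕ) extends TModule.{u, v} 𝕜 N where
  d : carrier →ₗ[𝕜] carrier
  d_grade : ∀ n, ∀ x ∈ grade n, d x ∈ grade (n + 1)
  d_d : ∀ x, d (d x) = 0
  par_d : ∀ x, par (d x) = d (par x)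
  d_Q : ∀ i x, d (Q i x) = -Q i (d x)
  d_H : ∀ x, d (H x) = H (d x)

/-- A `𝔱`-module viewed as a differential graded `𝔱`-module with zero differential. -/
def TModule.toDG {𝕜 : Type u} [RCLike 𝕜] {N : ℕ} (V : TModule.{u, v} 𝕜 N) :
    DGTModule.{u, v} 𝕜 N where
  toTModule := V
  d := 0
  d_grade _ _ _ := by simp
  d_d _ := by simp
  par_d _ := by simp
  d_Q _ _ := by simp
  d_H _ := by simp

/-- The cochain complex of vector spaces underlying a differential graded `𝔱`-module. -/
def DGTModule.complex {𝕜 : Type u} [RCLike 𝕜] {N : ℕ} (V : DGTModule.{u, v} 𝕜 N) :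
    CochainComplex (ModuleCat.{v} 𝕜) ℤ :=
  CochainComplex.of (fun n => ModuleCat.of 𝕜 (V.grade n))
    (fun n => ModuleCat.ofHom (V.d.restrict (V.d_grade n)))
    (fun n => by
      exact ModuleCat.hom_ext (LinearMap.ext fun x => Subtype.ext (V.d_d x)))

/-- Morphisms of differential graded `𝔱`-modules: even linear maps of degree `0` that commute
with the differentials and with the action of `𝔱`. -/
structure DGTModule.Hom {𝕜 : Type u} [RCLike 𝕜] {N : ℕ} (V W : DGTModule.{u, v} 𝕜 N) where
  toFun : V.carrier →ₗ[𝕜] W.carrier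
  map_grade : ∀ n, ∀ x ∈ V.grade n, toFun x ∈ W.grade n
  map_par : ∀ x, toFun (V.par x) = W.par (toFun x)
  map_d : ∀ x, toFun (V.d x) = W.d (toFun x)
  map_Q : ∀ i x, toFun (V.Q i x) = W.Q i (toFun x)
  map_H : ∀ x, toFun (V.H x) = W.H (toFun x)

/-- The morphism of cochain complexes underlying a morphism of differential graded
`𝔱`-modules. -/
def DGTModule.Hom.complexMap {𝕜 : Type u} [RCLike 𝕜] {N : ℕ} {V W : DGTModule.{u, v} 𝕜 N}
    (f : V.Hom W) : V.complex ⟶ W.complex where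
  f n := ModuleCat.ofHom (f.toFun.restrict (f.map_grade n))
  comm' i j hij := by
    obtain rfl : i + 1 = j := hij
    simp only [DGTModule.complex, CochainComplex.of_d]
    exact ModuleCat.hom_ext (LinearMap.ext fun x => Subtype.ext (f.map_d x).symm)

/-! ### The Chevalley–Eilenberg algebra and its differential graded modules -/

/-- `q_N = λ₁² + ⋯ + λ_N²` in `R = 𝕜[λ₁, …, λ_N]`. -/
def qForm (𝕜 : Type u) [RCLike 𝕜] (N : ℕ) : MvPolynomial (Fin N) 𝕜 :=
  ∑ i, MvPolynomial.X i ^ 2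

/-- The parity involution of `R`, for which the coordinates `λ_i` are odd. -/
def lambdaPar (𝕜 : Type u) [RCLike 𝕜] (N : ℕ) :
    MvPolynomial (Fin N) 𝕜 →ₐ[𝕜] MvPolynomial (Fin N) 𝕜 :=
  MvPolynomial.aeval fun i => -MvPolynomial.X i

/-- A differential graded (super)module over the Chevalley–Eilenberg algebra
`CE(𝔱) = (R[v], q_N ∂/∂v)`, `R = 𝕜[λ₁, …, λ_N]`, where the `λ_i` have degree `0` and `v` is an
exterior generator of degree `-1`: a complex of `R`-modules with an `R`-linear operator `v` of
degree `-1` with `v² = 0` and, by the Leibniz rule, `d (v x) = q_N x - v (d x)`. -/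
structure CEModule (𝕜 : Type u) [RCLike 𝕜] (N : ℕ) where
  carrier : Type v
  [addCommGroup : AddCommGroup carrier]
  [module : Module 𝕜 carrier]
  [moduleR : Module (MvPolynomial (Fin N) 𝕜) carrier]
  [tower : IsScalarTower 𝕜 (MvPolynomial (Fin N) 𝕜) carrier]
  grade : ℤ → Submodule (MvPolynomial (Fin N) 𝕜) carrier
  internal : DirectSum.IsInternal grade
  par : carrier →ₗ[𝕜] carrier
  par_par : ∀ x, par (par x) = x
  par_grade : ∀ n, ∀ x ∈ grade n, par x ∈ grade n
  par_smul : ∀ (r : MvPolynomial (Fin N) 𝕜) x, par (r • x) = lambdaPar 𝕜 N r • par x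
  d : carrier →ₗ[MvPolynomial (Fin N) 𝕜] carrier
  d_grade : ∀ n, ∀ x ∈ grade n, d x ∈ grade (n + 1)
  d_d : ∀ x, d (d x) = 0
  par_d : ∀ x, par (d x) = d (par x)
  v : carrier →ₗ[MvPolynomial (Fin N) 𝕜] carrier
  v_grade : ∀ n, ∀ x ∈ grade n, v x ∈ grade (n - 1)
  v_v : ∀ x, v (v x) = 0
  par_v : ∀ x, par (v x) = v (par x)
  d_v : ∀ x, d (v x) = qForm 𝕜 N • x - v (d x)

attribute [instance] CEModule.addCommGroup CEModule.module CEModule.moduleR CEModule.tower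

/-- The cochain complex of `R`-modules underlying a differential graded `CE(𝔱)`-module. -/
def CEModule.complex {𝕜 : Type u} [RCLike 𝕜] {N : ℕ} (M : CEModule.{u, v} 𝕜 N) :
    CochainComplex (ModuleCat.{v} (MvPolynomial (Fin N) 𝕜)) ℤ :=
  CochainComplex.of (fun n => ModuleCat.of (MvPolynomial (Fin N) 𝕜) (M.grade n))
    (fun n => ModuleCat.ofHom (M.d.restrict (M.d_grade n)))
    (fun n => by
      exact ModuleCat.hom_ext (LinearMap.ext fun x => Subtype.ext (M.d_d x)))

/-- Morphisms of differential graded `CE(𝔱)`-modules. -/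
structure CEModule.Hom {𝕜 : Type u} [RCLike 𝕜] {N : ℕ} (M M' : CEModule.{u, v} 𝕜 N) where
  toFun : M.carrier →ₗ[MvPolynomial (Fin N) 𝕜] M'.carrier
  map_grade : ∀ n, ∀ x ∈ M.grade n, toFun x ∈ M'.grade n
  map_par : ∀ x, toFun (M.par x) = M'.par (toFun x)
  map_d : ∀ x, toFun (M.d x) = M'.d (toFun x)
  map_v : ∀ x, toFun (M.v x) = M'.v (toFun x)

/-- The morphism of complexes of `R`-modules underlying a morphism of differential graded
`CE(𝔱)`-modules. -/
def CEModule.Hom.complexMap {𝕜 : Type u} [RCLike 𝕜] {N : ℕ} {M M' : CEModule.{u, v} 𝕜 N}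
    (f : M.Hom M') : M.complex ⟶ M'.complex where
  f n := ModuleCat.ofHom (f.toFun.restrict (f.map_grade n))
  comm' i j hij := by
    obtain rfl : i + 1 = j := hij
    simp only [CEModule.complex, CochainComplex.of_d]
    exact ModuleCat.hom_ext (LinearMap.ext fun x => Subtype.ext (f.map_d x).symm)

/-! ### The Chevalley–Eilenberg complex of a `𝔱`-module -/

section CE

variable {𝕜 : Type u} [RCLike 𝕜] {N : ℕ}

/-- `∑ λ_i ⊗ Q_i` on `R ⊗ V`. -/
def lambdaQ (V : TModule.{u, v} 𝕜 N) :
    MvPolynomial (Fin N) 𝕜 ⊗[𝕜] V.carrier →ₗ[MvPolynomial (Fin N) 𝕜]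
      MvPolynomial (Fin N) 𝕜 ⊗[𝕜] V.carrier :=
  ∑ i, (MvPolynomial.X i : MvPolynomial (Fin N) 𝕜) • (V.Q i).baseChange (MvPolynomial (Fin N) 𝕜)

theorem lambdaQ_tmul (V : TModule.{u, v} 𝕜 N) (r : MvPolynomial (Fin N) 𝕜) (x : V.carrier) :
    lambdaQ V (r ⊗ₜ x) = ∑ i, (MvPolynomial.X i * r) ⊗ₜ V.Q i x := by
  simp [lambdaQ, LinearMap.sum_apply, TensorProduct.smul_tmul']

theorem lambdaQ_lambdaQ (V : TModule.{u, v} 𝕜 N)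
    (a : MvPolynomial (Fin N) 𝕜 ⊗[𝕜] V.carrier) :
    lambdaQ V (lambdaQ V a) =
      qForm 𝕜 N • V.H.baseChange (MvPolynomial (Fin N) 𝕜) a := by
  induction a with
  | zero => simp
  | add a b ha hb => simp only [map_add, smul_add, ha, hb]
  | tmul r x =>
    have h2 : (2 : 𝕜) • lambdaQ V (lambdaQ V (r ⊗ₜ[𝕜] x)) =
        (2 : 𝕜) • (qForm 𝕜 N • V.H.baseChange (MvPolynomial (Fin N) 𝕜) (r ⊗ₜ[𝕜] x)) := by
      have e : lambdaQ V (lambdaQ V (r ⊗ₜ[𝕜] x)) =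
          ∑ i, ∑ j, (MvPolynomial.X i * (MvPolynomial.X j * r)) ⊗ₜ[𝕜] V.Q i (V.Q j x) := by
        simp only [lambdaQ_tmul, map_sum]
        exact Finset.sum_comm
      have e' : lambdaQ V (lambdaQ V (r ⊗ₜ[𝕜] x)) =
          ∑ i, ∑ j, (MvPolynomial.X i * (MvPolynomial.X j * r)) ⊗ₜ[𝕜] V.Q j (V.Q i x) := by
        rw [e, Finset.sum_comm]
        refine Finset.sum_congr rfl fun i _ => Finset.sum_congr rfl fun j _ => ?_
        rw [mul_left_comm]
      rw [two_smul]
      nth_rw 1 [e]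
      rw [e', ← Finset.sum_add_distrib]
      simp only [← Finset.sum_add_distrib, ← TensorProduct.tmul_add, V.Q_Q]
      simp only [LinearMap.baseChange_tmul, qForm, Finset.sum_smul, Finset.smul_sum]
      refine Finset.sum_congr rfl fun i _ => ?_
      rw [Finset.sum_eq_single i (fun j _ hj => by simp [hj.symm]) (by simp)]
      simp [TensorProduct.smul_tmul', pow_two, mul_assoc]
    exact smul_right_injective _ (two_ne_zero (α := 𝕜)) h2

theorem lambdaQ_H (V : TModule.{u, v} 𝕜 N) (a : MvPolynomial (Fin N) 𝕜 ⊗[𝕜] V.carrier) :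
    lambdaQ V (V.H.baseChange (MvPolynomial (Fin N) 𝕜) a) =
      V.H.baseChange (MvPolynomial (Fin N) 𝕜) (lambdaQ V a) := by
  induction a with
  | zero => simp
  | add a b ha hb => simp only [map_add, ha, hb]
  | tmul r x => simp [lambdaQ_tmul, V.H_Q]

/-- The parity involution of `R ⊗ V`. -/
def tensorPar (V : TModule.{u, v} 𝕜 N) :
    MvPolynomial (Fin N) 𝕜 ⊗[𝕜] V.carrier →ₗ[𝕜] MvPolynomial (Fin N) 𝕜 ⊗[𝕜] V.carrier :=
  TensorProduct.map (lambdaPar 𝕜 N).toLinearMap V.par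

theorem tensorPar_smul (V : TModule.{u, v} 𝕜 N) (r : MvPolynomial (Fin N) 𝕜)
    (a : MvPolynomial (Fin N) 𝕜 ⊗[𝕜] V.carrier) :
    tensorPar V (r • a) = lambdaPar 𝕜 N r • tensorPar V a := by
  induction a with
  | zero => simp
  | add a b ha hb => simp only [map_add, smul_add, ha, hb]
  | tmul s x => simp [tensorPar, TensorProduct.smul_tmul']

theorem lambdaPar_lambdaPar (r : MvPolynomial (Fin N) 𝕜) :
    lambdaPar 𝕜 N (lambdaPar 𝕜 N r) = r := by
  have : (lambdaPar 𝕜 N).comp (lambdaPar 𝕜 N) = AlgHom.id 𝕜 _ := by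
    ext i
    simp [lambdaPar]
  exact DFunLike.congr_fun this r

theorem lambdaPar_qForm : lambdaPar 𝕜 N (qForm 𝕜 N) = qForm 𝕜 N := by
  simp [lambdaPar, qForm]

theorem tensorPar_tensorPar (V : TModule.{u, v} 𝕜 N)
    (a : MvPolynomial (Fin N) 𝕜 ⊗[𝕜] V.carrier) : tensorPar V (tensorPar V a) = a := by
  induction a with
  | zero => simp
  | add a b ha hb => simp only [map_add, ha, hb]
  | tmul s x => simp [tensorPar, lambdaPar_lambdaPar, V.par_par]

theorem tensorPar_lambdaQ (V : TModule.{u, v} 𝕜 N)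
    (a : MvPolynomial (Fin N) 𝕜 ⊗[𝕜] V.carrier) :
    tensorPar V (lambdaQ V a) = lambdaQ V (tensorPar V a) := by
  induction a with
  | zero => simp
  | add a b ha hb => simp only [map_add, ha, hb]
  | tmul s x =>
    have h (i : Fin N) : lambdaPar 𝕜 N (MvPolynomial.X i) = -MvPolynomial.X i := by
      simp [lambdaPar]
    simp [tensorPar, lambdaQ_tmul, h, V.par_Q, TensorProduct.neg_tmul, TensorProduct.tmul_neg]

theorem tensorPar_H (V : TModule.{u, v} 𝕜 N) (a : MvPolynomial (Fin N) 𝕜 ⊗[𝕜] V.carrier) :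
    tensorPar V (V.H.baseChange (MvPolynomial (Fin N) 𝕜) a) =
      V.H.baseChange (MvPolynomial (Fin N) 𝕜) (tensorPar V a) := by
  induction a with
  | zero => simp
  | add a b ha hb => simp only [map_add, ha, hb]
  | tmul s x => simp [tensorPar, V.par_H]

theorem baseChange_mem {V : TModule.{u, v} 𝕜 N} {m n : ℤ} (f : V.carrier →ₗ[𝕜] V.carrier)
    (hf : ∀ x ∈ V.grade m, f x ∈ V.grade n) (a : MvPolynomial (Fin N) 𝕜 ⊗[𝕜] V.carrier)
    (ha : a ∈ (V.grade m).baseChange (MvPolynomial (Fin N) 𝕜)) :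
    f.baseChange (MvPolynomial (Fin N) 𝕜) a ∈
      (V.grade n).baseChange (MvPolynomial (Fin N) 𝕜) := by
  rw [Submodule.baseChange_eq_span] at ha
  induction ha using Submodule.span_induction with
  | mem y hy =>
    obtain ⟨x, hx, rfl⟩ := hy
    exact Submodule.tmul_mem_baseChange_of_mem _ (hf x hx)
  | zero => simp
  | add x y _ _ hx hy => rw [map_add]; exact add_mem hx hy
  | smul r x _ hx => rw [map_smul]; exact Submodule.smul_mem _ _ hx

theorem lambdaQ_mem {V : TModule.{u, v} 𝕜 N} {n : ℤ}
    (a : MvPolynomial (Fin N) 𝕜 ⊗[𝕜] V.carrier)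
    (ha : a ∈ (V.grade n).baseChange (MvPolynomial (Fin N) 𝕜)) :
    lambdaQ V a ∈ (V.grade (n + 1)).baseChange (MvPolynomial (Fin N) 𝕜) := by
  rw [lambdaQ, LinearMap.sum_apply]
  exact Submodule.sum_mem _ fun i _ =>
    Submodule.smul_mem _ _ (baseChange_mem _ (V.Q_grade i n) a ha)

theorem tensorPar_mem {V : TModule.{u, v} 𝕜 N} {n : ℤ}
    (a : MvPolynomial (Fin N) 𝕜 ⊗[𝕜] V.carrier)
    (ha : a ∈ (V.grade n).baseChange (MvPolynomial (Fin N) 𝕜)) :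
    tensorPar V a ∈ (V.grade n).baseChange (MvPolynomial (Fin N) 𝕜) := by
  rw [Submodule.baseChange_eq_span] at ha
  induction ha using Submodule.span_induction with
  | mem y hy =>
    obtain ⟨x, hx, rfl⟩ := hy
    simp only [tensorPar, TensorProduct.mk_apply, TensorProduct.map_tmul, AlgHom.toLinearMap_apply,
      map_one]
    exact Submodule.tmul_mem_baseChange_of_mem _ (V.par_grade n x hx)
  | zero => simp
  | add x y _ _ hx hy => rw [map_add]; exact add_mem hx hy
  | smul r x _ hx => rw [tensorPar_smul]; exact Submodule.smul_mem _ _ hx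

/-- The degree `n` part of `R[v] ⊗ V = (R ⊗ V) ⊕ v (R ⊗ V)`. -/
def ceGrade (V : TModule.{u, v} 𝕜 N) (n : ℤ) :
    Submodule (MvPolynomial (Fin N) 𝕜)
      ((MvPolynomial (Fin N) 𝕜 ⊗[𝕜] V.carrier) × (MvPolynomial (Fin N) 𝕜 ⊗[𝕜] V.carrier)) :=
  ((V.grade n).baseChange (MvPolynomial (Fin N) 𝕜)).prod
    ((V.grade (n + 1)).baseChange (MvPolynomial (Fin N) 𝕜))

theorem ceGrade_internal (V : TModule.{u, v} 𝕜 N) : DirectSum.IsInternal (ceGrade V) := by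
  obtain ⟨T, hT⟩ := exists_degreeOperator V.grade V.internal (fun n => (n : 𝕜))
  have hT' (n : ℤ) (a) (ha : a ∈ (V.grade n).baseChange (MvPolynomial (Fin N) 𝕜)) :
      T.baseChange (MvPolynomial (Fin N) 𝕜) a = (n : 𝕜) • a := by
    rw [Submodule.baseChange_eq_span] at ha
    induction ha using Submodule.span_induction with
    | mem y hy =>
      obtain ⟨x, hx, rfl⟩ := hy
      simp [hT n x hx]
    | zero => simp
    | add x y _ _ hx hy => rw [map_add, hx, hy, smul_add]
    | smul r x _ hx => rw [map_smul, hx, smul_comm]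
  let S := (T.baseChange (MvPolynomial (Fin N) 𝕜)).restrictScalars 𝕜
  have key : DirectSum.IsInternal fun n => (ceGrade V n).restrictScalars 𝕜 := by
    refine isInternal_of_degreeOperator _ (S.prodMap (S - LinearMap.id)) ?_ ?_
    · rintro n ⟨a, b⟩ ⟨ha, hb⟩
      refine Prod.ext ?_ ?_
      · exact hT' n a ha
      · have := hT' (n + 1) b hb
        simp only [S, LinearMap.prodMap_apply, LinearMap.sub_apply, LinearMap.restrictScalars_apply,
          this, LinearMap.id_apply]
        push_cast
        simp [add_smul]
    · have top (x : V.carrier) : x ∈ ⨆ n, V.grade n := by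
        rw [V.internal.submodule_iSup_eq_top]; trivial
      have h1 (a : MvPolynomial (Fin N) 𝕜 ⊗[𝕜] V.carrier) :
          (a, 0) ∈ ⨆ n, (ceGrade V n).restrictScalars 𝕜 := by
        induction a with
        | zero => exact zero_mem _
        | add a b ha hb => simpa using add_mem ha hb
        | tmul r x =>
          induction top x using Submodule.iSup_induction' with
          | mem n x hx =>
            refine Submodule.mem_iSup_of_mem n ⟨?_, zero_mem _⟩
            exact Submodule.tmul_mem_baseChange_of_mem _ hx
          | zero => rw [TensorProduct.tmul_zero]; exact zero_mem _
          | add x y _ _ hx hy => simpa [TensorProduct.tmul_add] using add_mem hx hy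
      have h2 (a : MvPolynomial (Fin N) 𝕜 ⊗[𝕜] V.carrier) :
          (0, a) ∈ ⨆ n, (ceGrade V n).restrictScalars 𝕜 := by
        induction a with
        | zero => exact zero_mem _
        | add a b ha hb => simpa using add_mem ha hb
        | tmul r x =>
          induction top x using Submodule.iSup_induction' with
          | mem n x hx =>
            refine Submodule.mem_iSup_of_mem (n - 1) ⟨zero_mem _, ?_⟩
            rw [sub_add_cancel]
            exact Submodule.tmul_mem_baseChange_of_mem _ hx
          | zero => rw [TensorProduct.tmul_zero]; exact zero_mem _
          | add x y _ _ hx hy => simpa [TensorProduct.tmul_add] using add_mem hx hy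
      rintro ⟨a, b⟩
      simpa using add_mem (h1 a) (h2 b)
  exact key

/-- The Chevalley–Eilenberg complex `CE(𝔱, V) = CE(𝔱) ⊗ V`, as a differential graded
`CE(𝔱)`-module. The pair `(a, b)` stands for `a + v b`, with `a, b ∈ R ⊗ V`, and the differential
is `q_N ∂/∂v + ∑ λ_i Q_i - v H`, where the odd operator `∑ λ_i Q_i` anticommutes with `v`. (The
sign of the last term relative to the first one is forced by `d² = 0`.) -/
def CE (V : TModule.{u, v} 𝕜 N) : CEModule.{u, max u v} 𝕜 N where
  carrier := (MvPolynomial (Fin N) 𝕜 ⊗[𝕜] V.carrier) × (MvPolynomial (Fin N) 𝕜 ⊗[𝕜] V.carrier)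
  grade := ceGrade V
  internal := ceGrade_internal V
  par := (tensorPar V).prodMap (tensorPar V)
  par_par x := by simp [tensorPar_tensorPar]
  par_grade n x hx := ⟨tensorPar_mem _ hx.1, tensorPar_mem _ hx.2⟩
  par_smul r x := by simp [tensorPar_smul]
  d := LinearMap.prod
    (lambdaQ V ∘ₗ LinearMap.fst _ _ _ + qForm 𝕜 N • LinearMap.snd _ _ _)
    (-(V.H.baseChange (MvPolynomial (Fin N) 𝕜) ∘ₗ LinearMap.fst _ _ _) -
      lambdaQ V ∘ₗ LinearMap.snd _ _ _)
  d_grade n x hx := by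
    refine ⟨add_mem (lambdaQ_mem _ hx.1) (Submodule.smul_mem _ _ hx.2),
      sub_mem (neg_mem ?_) (lambdaQ_mem _ hx.2)⟩
    have := baseChange_mem V.H (V.H_grade n) x.1 hx.1
    rwa [show n + 2 = n + 1 + 1 by ring] at this
  d_d x := by
    refine Prod.ext ?_ ?_
    · simp [lambdaQ_lambdaQ, smul_sub]
    · simp [lambdaQ_lambdaQ, lambdaQ_H]
      abel
  par_d x := by
    refine Prod.ext ?_ ?_
    · simp [tensorPar_lambdaQ, tensorPar_smul, lambdaPar_qForm]
    · simp [tensorPar_lambdaQ, tensorPar_H]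
  v := LinearMap.prod 0 (LinearMap.fst _ _ _)
  v_grade n x hx := by
    refine ⟨zero_mem _, ?_⟩
    rw [sub_add_cancel]
    exact hx.1
  v_v x := by simp
  par_v x := by simp
  d_v x := by
    refine Prod.ext ?_ ?_ <;> simp

end CE

/-! ### Tensor products of gradings -/

section TensorGrade

variable {K : Type*} [Field K] {E F : Type*} [AddCommGroup E] [Module K E] [AddCommGroup F]
  [Module K F]

/-- The total grading on a tensor product of graded vector spaces. -/
def tensorGrade (𝒢 : ℤ → Submodule K E) (ℋ : ℤ → Submodule K F) (n : ℤ) :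
    Submodule K (E ⊗[K] F) :=
  Submodule.span K {z | ∃ a b : ℤ, a + b = n ∧ ∃ x ∈ 𝒢 a, ∃ y ∈ ℋ b, z = x ⊗ₜ[K] y}

theorem tensorGrade_internal [CharZero K] {𝒢 : ℤ → Submodule K E} {ℋ : ℤ → Submodule K F}
    (h𝒢 : DirectSum.IsInternal 𝒢) (hℋ : DirectSum.IsInternal ℋ) :
    DirectSum.IsInternal (tensorGrade 𝒢 ℋ) := by
  obtain ⟨S, hS⟩ := exists_degreeOperator 𝒢 h𝒢 (fun n => (n : K))
  obtain ⟨T, hT⟩ := exists_degreeOperator ℋ hℋ (fun n => (n : K))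
  refine isInternal_of_degreeOperator _ (S.rTensor F + T.lTensor E) ?_ ?_
  · intro n z hz
    induction hz using Submodule.span_induction with
    | mem z hz =>
      obtain ⟨a, b, rfl, x, hx, y, hy, rfl⟩ := hz
      simp [hS a x hx, hT b y hy, add_smul, TensorProduct.smul_tmul']
    | zero => simp
    | add x y _ _ hx hy => rw [map_add, hx, hy, smul_add]
    | smul r x _ hx => rw [map_smul, hx, smul_comm]
  · intro z
    have h1 (x : E) : x ∈ ⨆ n, 𝒢 n := by rw [h𝒢.submodule_iSup_eq_top]; trivial
    have h2 (x : F) : x ∈ ⨆ n, ℋ n := by rw [hℋ.submodule_iSup_eq_top]; trivial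
    induction z with
    | zero => exact zero_mem _
    | add a b ha hb => exact add_mem ha hb
    | tmul x y =>
      induction h1 x using Submodule.iSup_induction' with
      | zero => rw [TensorProduct.zero_tmul]; exact zero_mem _
      | add x x' _ _ hx hx' => rw [TensorProduct.add_tmul]; exact add_mem hx hx'
      | mem a x hx =>
        induction h2 y using Submodule.iSup_induction' with
        | zero => rw [TensorProduct.tmul_zero]; exact zero_mem _
        | add y y' _ _ hy hy' => rw [TensorProduct.tmul_add]; exact add_mem hy hy'
        | mem b y hy =>
          exact Submodule.mem_iSup_of_mem (a + b)
            (Submodule.subset_span ⟨a, b, rfl, x, hx, y, hy, rfl⟩)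

theorem map_mem_tensorGrade {𝒢 : ℤ → Submodule K E} {ℋ : ℤ → Submodule K F} {f : E →ₗ[K] E}
    {g : F →ₗ[K] F} (p q : ℤ) (hf : ∀ n, ∀ x ∈ 𝒢 n, f x ∈ 𝒢 (n + p))
    (hg : ∀ n, ∀ x ∈ ℋ n, g x ∈ ℋ (n + q)) (n m : ℤ) (hm : n + (p + q) = m) (z : E ⊗[K] F)
    (hz : z ∈ tensorGrade 𝒢 ℋ n) : TensorProduct.map f g z ∈ tensorGrade 𝒢 ℋ m := by
  induction hz using Submodule.span_induction with
  | mem z hz =>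
    obtain ⟨a, b, rfl, x, hx, y, hy, rfl⟩ := hz
    exact Submodule.subset_span
      ⟨a + p, b + q, by rw [← hm]; ring, f x, hf a x hx, g y, hg b y hy, rfl⟩
  | zero => simp
  | add x y _ _ hx hy => rw [map_add]; exact add_mem hx hy
  | smul r x _ hx => rw [map_smul]; exact Submodule.smul_mem _ _ hx

end TensorGrade

/-! ### Superfields -/

section Superfields

variable (𝕜 : Type u) [RCLike 𝕜] (N : ℕ)

/-- The free superfields `𝕜[t, θ₁, …, θ_N] = 𝕜[t] ⊗ Λ(θ₁, …, θ_N)`: functions on `ℝ^{1|N}`,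
polynomial in the time variable `t`. -/
abbrev Superfield : Type u :=
  Polynomial 𝕜 ⊗[𝕜] ExteriorAlgebra 𝕜 (Fin N → 𝕜)

variable {N}

/-- `∂/∂θ_i`. -/
def dTheta (i : Fin N) : Superfield 𝕜 N →ₗ[𝕜] Superfield 𝕜 N :=
  (CliffordAlgebra.contractLeft (Q := (0 : QuadraticForm 𝕜 (Fin N → 𝕜)))
    (LinearMap.proj i)).lTensor (Polynomial 𝕜)

/-- Multiplication by `θ_i`. -/
def mulTheta (i : Fin N) : Superfield 𝕜 N →ₗ[𝕜] Superfield 𝕜 N :=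
  (LinearMap.mulLeft 𝕜 (ExteriorAlgebra.ι 𝕜 (Pi.single i (1 : 𝕜)))).lTensor (Polynomial 𝕜)

variable (N)

/-- `∂/∂t`. -/
def dTime : Superfield 𝕜 N →ₗ[𝕜] Superfield 𝕜 N :=
  (Polynomial.derivative (R := 𝕜)).rTensor (ExteriorAlgebra 𝕜 (Fin N → 𝕜))

/-- The parity involution of superfields: `t` is even and the `θ_i` are odd. -/
def superPar : Superfield 𝕜 N →ₗ[𝕜] Superfield 𝕜 N :=
  (CliffordAlgebra.involute (Q := (0 : QuadraticForm 𝕜 (Fin N → 𝕜)))).toLinearMap.lTensor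
    (Polynomial 𝕜)

variable {N}

/-- The generators `∂/∂θ_i + θ_i ∂/∂t` of the left translations. -/
def leftQ (i : Fin N) : Superfield 𝕜 N →ₗ[𝕜] Superfield 𝕜 N :=
  dTheta 𝕜 i + mulTheta 𝕜 i ∘ₗ dTime 𝕜 N

/-- The generators `D_i = ∂/∂θ_i - θ_i ∂/∂t` of the right translations. -/
def covD (i : Fin N) : Superfield 𝕜 N →ₗ[𝕜] Superfield 𝕜 N :=
  dTheta 𝕜 i - mulTheta 𝕜 i ∘ₗ dTime 𝕜 N

variable (N)

/-- The variable `t` has degree `-2`. -/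
def timeGrade (n : ℤ) : Submodule 𝕜 (Polynomial 𝕜) :=
  Submodule.span 𝕜 {f | ∃ k : ℕ, -2 * (k : ℤ) = n ∧ f = Polynomial.X ^ k}

/-- The variables `θ_i` have degree `-1`. -/
def thetaGrade (n : ℤ) : Submodule 𝕜 (ExteriorAlgebra 𝕜 (Fin N → 𝕜)) :=
  Submodule.span 𝕜 {x | ∃ p : ℕ, -(p : ℤ) = n ∧ x ∈ ⋀[𝕜]^p (Fin N → 𝕜)}

/-- The grading of superfields, with `deg t = -2` and `deg θ_i = -1`. -/
def superGrade (n : ℤ) : Submodule 𝕜 (Superfield 𝕜 N) :=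
  tensorGrade (timeGrade 𝕜) (thetaGrade 𝕜 N) n

theorem timeGrade_internal : DirectSum.IsInternal (timeGrade 𝕜) := by
  refine isInternal_of_degreeOperator _
    ((-2 : 𝕜) • (LinearMap.mulLeft 𝕜 Polynomial.X ∘ₗ Polynomial.derivative)) ?_ ?_
  · intro n z hz
    induction hz using Submodule.span_induction with
    | mem z hz =>
      obtain ⟨k, rfl, rfl⟩ := hz
      cases k with
      | zero => simp
      | succ k =>
        simp only [LinearMap.smul_apply, LinearMap.comp_apply, LinearMap.mulLeft_apply,
          Polynomial.derivative_X_pow, Polynomial.smul_eq_C_mul]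
        push_cast
        simp only [map_neg, map_mul, map_ofNat, map_add, map_natCast, map_one]
        ring
    | zero => simp
    | add x y _ _ hx hy => rw [map_add, hx, hy, smul_add]
    | smul r x _ hx => rw [map_smul, hx, smul_comm]
  · intro f
    induction f using Polynomial.induction_on' with
    | add p q hp hq => exact add_mem hp hq
    | monomial k a =>
      rw [← Polynomial.C_mul_X_pow_eq_monomial, ← Polynomial.smul_eq_C_mul]
      exact Submodule.smul_mem _ _ (Submodule.mem_iSup_of_mem (-2 * (k : ℤ))
        (Submodule.subset_span ⟨k, rfl, rfl⟩))

theorem thetaGrade_internal : DirectSum.IsInternal (thetaGrade 𝕜 N) := by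
  have hi : DirectSum.IsInternal fun p : ℕ => ⋀[𝕜]^p (Fin N → 𝕜) :=
    DirectSum.Decomposition.isInternal _
  obtain ⟨T, hT⟩ := exists_degreeOperator _ hi (fun p => -(p : 𝕜))
  refine isInternal_of_degreeOperator _ T ?_ ?_
  · intro n z hz
    induction hz using Submodule.span_induction with
    | mem z hz =>
      obtain ⟨k, rfl, hz⟩ := hz
      simpa using hT k z hz
    | zero => simp
    | add x y _ _ hx hy => rw [map_add, hx, hy, smul_add]
    | smul r x _ hx => rw [map_smul, hx, smul_comm]
  · intro x
    have h1 : x ∈ ⨆ p : ℕ, ⋀[𝕜]^p (Fin N → 𝕜) := by rw [hi.submodule_iSup_eq_top]; trivial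
    induction h1 using Submodule.iSup_induction' with
    | mem p x hx =>
      exact Submodule.mem_iSup_of_mem (-(p : ℤ)) (Submodule.subset_span ⟨p, rfl, hx⟩)
    | zero => exact zero_mem _
    | add x y _ _ hx hy => exact add_mem hx hy

theorem superGrade_internal : DirectSum.IsInternal (superGrade 𝕜 N) :=
  tensorGrade_internal (timeGrade_internal 𝕜) (thetaGrade_internal 𝕜 N)

theorem derivative_mem (n : ℤ) (f : Polynomial 𝕜) (hf : f ∈ timeGrade 𝕜 n) :
    Polynomial.derivative f ∈ timeGrade 𝕜 (n + 2) := by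
  induction hf using Submodule.span_induction with
  | mem z hz =>
    obtain ⟨k, rfl, rfl⟩ := hz
    cases k with
    | zero => simp
    | succ k =>
      rw [Polynomial.derivative_X_pow, ← Polynomial.smul_eq_C_mul]
      exact Submodule.smul_mem _ _ (Submodule.subset_span ⟨k, by push_cast; ring, rfl⟩)
  | zero => simp
  | add x y _ _ hx hy => rw [map_add]; exact add_mem hx hy
  | smul r x _ hx => rw [map_smul]; exact Submodule.smul_mem _ _ hx

theorem iota_mul_mem (a : Fin N → 𝕜) (n : ℤ) (x) (hx : x ∈ thetaGrade 𝕜 N n) :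
    ExteriorAlgebra.ι 𝕜 a * x ∈ thetaGrade 𝕜 N (n - 1) := by
  induction hx using Submodule.span_induction with
  | mem z hz =>
    obtain ⟨k, rfl, hz⟩ := hz
    refine Submodule.subset_span ⟨k + 1, by push_cast; ring, ?_⟩
    rw [ExteriorAlgebra.exteriorPower, pow_succ']
    exact Submodule.mul_mem_mul ⟨a, rfl⟩ hz
  | zero => simp
  | add x y _ _ hx hy => rw [mul_add]; exact add_mem hx hy
  | smul r x _ hx => rw [mul_smul_comm]; exact Submodule.smul_mem _ _ hx

theorem contractLeft_mem (f : Module.Dual 𝕜 (Fin N → 𝕜)) (n : ℤ) (x)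
    (hx : x ∈ thetaGrade 𝕜 N n) :
    CliffordAlgebra.contractLeft (Q := (0 : QuadraticForm 𝕜 (Fin N → 𝕜))) f x ∈
      thetaGrade 𝕜 N (n + 1) := by
  induction hx using Submodule.span_induction with
  | mem z hz =>
    obtain ⟨k, rfl, hz⟩ := hz
    induction hz using Submodule.pow_induction_on_left' with
    | algebraMap r => rw [CliffordAlgebra.contractLeft_algebraMap]; exact zero_mem _
    | add x y i _ _ hx hy => rw [map_add]; exact add_mem hx hy
    | mem_mul m hm i x hx hx' =>
      obtain ⟨a, rfl⟩ := hm
      have e := CliffordAlgebra.contractLeft_ι_mul (Q := (0 : QuadraticForm 𝕜 (Fin N → 𝕜)))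
        (d := f) a x
      refine e.symm ▸ sub_mem (Submodule.smul_mem _ _ ?_) ?_
      · exact Submodule.subset_span ⟨i, by push_cast; ring, hx⟩
      · have := iota_mul_mem 𝕜 N a _ _ hx'
        rwa [show -(i : ℤ) + 1 - 1 = -((i + 1 : ℕ) : ℤ) + 1 by push_cast; ring] at this
  | zero => simp
  | add x y _ _ hx hy => rw [map_add]; exact add_mem hx hy
  | smul r x _ hx => rw [map_smul]; exact Submodule.smul_mem _ _ hx

theorem involute_mem (n : ℤ) (x) (hx : x ∈ thetaGrade 𝕜 N n) :
    CliffordAlgebra.involute (Q := (0 : QuadraticForm 𝕜 (Fin N → 𝕜))) x ∈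
      thetaGrade 𝕜 N n := by
  induction hx using Submodule.span_induction with
  | mem z hz =>
    obtain ⟨k, rfl, hz⟩ := hz
    induction hz using Submodule.pow_induction_on_left' with
    | algebraMap r =>
      rw [AlgHom.commutes]
      exact Submodule.subset_span ⟨0, by simp, by simp⟩
    | add x y i _ _ hx hy => rw [map_add]; exact add_mem hx hy
    | mem_mul m hm i x hx hx' =>
      obtain ⟨a, rfl⟩ := hm
      have e := CliffordAlgebra.involute_ι (Q := (0 : QuadraticForm 𝕜 (Fin N → 𝕜))) a
      rw [map_mul]
      refine e.symm ▸ ?_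
      rw [neg_mul]
      have := iota_mul_mem 𝕜 N a _ _ hx'
      rw [show -(i : ℤ) - 1 = -((i + 1 : ℕ) : ℤ) by push_cast; ring] at this
      exact neg_mem this
  | zero => simp
  | add x y _ _ hx hy => rw [map_add]; exact add_mem hx hy
  | smul r x _ hx => rw [map_smul]; exact Submodule.smul_mem _ _ hx

theorem dTime_mem (n : ℤ) (x) (hx : x ∈ superGrade 𝕜 N n) :
    dTime 𝕜 N x ∈ superGrade 𝕜 N (n + 2) :=
  map_mem_tensorGrade 2 0 (derivative_mem 𝕜) (fun n x hx => by simpa using hx) n _ (by ring) x hx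

theorem superPar_mem (n : ℤ) (x) (hx : x ∈ superGrade 𝕜 N n) :
    superPar 𝕜 N x ∈ superGrade 𝕜 N n :=
  map_mem_tensorGrade 0 0 (fun n x hx => by simpa using hx)
    (fun n x hx => by simpa using involute_mem 𝕜 N n x hx) n _ (by ring) x hx

variable {N}

theorem dTheta_mem (i : Fin N) (n : ℤ) (x) (hx : x ∈ superGrade 𝕜 N n) :
    dTheta 𝕜 i x ∈ superGrade 𝕜 N (n + 1) :=
  map_mem_tensorGrade 0 1 (fun n x hx => by simpa using hx)
    (contractLeft_mem 𝕜 N (LinearMap.proj i)) n _ (by ring) x hx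

theorem mulTheta_mem (i : Fin N) (n : ℤ) (x) (hx : x ∈ superGrade 𝕜 N n) :
    mulTheta 𝕜 i x ∈ superGrade 𝕜 N (n - 1) :=
  map_mem_tensorGrade 0 (-1) (fun n x hx => by simpa using hx)
    (fun n x hx => iota_mul_mem 𝕜 N (Pi.single i 1) n x hx) n _ (by ring) x hx

theorem leftQ_mem (i : Fin N) (n : ℤ) (x) (hx : x ∈ superGrade 𝕜 N n) :
    leftQ 𝕜 i x ∈ superGrade 𝕜 N (n + 1) := by
  have := mulTheta_mem 𝕜 i _ _ (dTime_mem 𝕜 N n x hx)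
  rw [show n + 2 - 1 = n + 1 by ring] at this
  exact add_mem (dTheta_mem 𝕜 i n x hx) this

theorem covD_mem (i : Fin N) (n : ℤ) (x) (hx : x ∈ superGrade 𝕜 N n) :
    covD 𝕜 i x ∈ superGrade 𝕜 N (n + 1) := by
  have := mulTheta_mem 𝕜 i _ _ (dTime_mem 𝕜 N n x hx)
  rw [show n + 2 - 1 = n + 1 by ring] at this
  exact sub_mem (dTheta_mem 𝕜 i n x hx) this

theorem dTheta_dTheta (i j : Fin N) (x : Superfield 𝕜 N) :
    dTheta 𝕜 i (dTheta 𝕜 j x) = -dTheta 𝕜 j (dTheta 𝕜 i x) := by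
  induction x using TensorProduct.induction_on with
  | zero => simp
  | add a b ha hb => simp only [map_add, ha, hb, neg_add]
  | tmul f x =>
    simp only [dTheta, LinearMap.lTensor_tmul, ← TensorProduct.tmul_neg]
    rw [CliffordAlgebra.contractLeft_comm]

theorem mulTheta_mulTheta (i j : Fin N) (x : Superfield 𝕜 N) :
    mulTheta 𝕜 i (mulTheta 𝕜 j x) = -mulTheta 𝕜 j (mulTheta 𝕜 i x) := by
  induction x using TensorProduct.induction_on with
  | zero => simp
  | add a b ha hb => simp only [map_add, ha, hb, neg_add]
  | tmul f x =>
    simp only [mulTheta, LinearMap.lTensor_tmul, ← TensorProduct.tmul_neg, LinearMap.mulLeft_apply,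
      ← mul_assoc]
    have e := eq_neg_of_add_eq_zero_left (ExteriorAlgebra.ι_add_mul_swap (R := 𝕜)
      (Pi.single i 1 : Fin N → 𝕜) (Pi.single j 1 : Fin N → 𝕜))
    rw [e]
    simp only [neg_mul]

theorem dTheta_mulTheta (i j : Fin N) (x : Superfield 𝕜 N) :
    dTheta 𝕜 i (mulTheta 𝕜 j x) = (if i = j then x else 0) - mulTheta 𝕜 j (dTheta 𝕜 i x) := by
  induction x using TensorProduct.induction_on with
  | zero => simp
  | add a b ha hb =>
    simp only [map_add, ha, hb]
    split_ifs
    · abel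
    · abel
  | tmul f x =>
    simp only [dTheta, mulTheta, LinearMap.lTensor_tmul, LinearMap.mulLeft_apply]
    have e := CliffordAlgebra.contractLeft_ι_mul (Q := (0 : QuadraticForm 𝕜 (Fin N → 𝕜)))
      (d := LinearMap.proj i) (Pi.single j 1) x
    refine (congrArg (fun z => f ⊗ₜ[𝕜] z) e).trans ?_
    rw [TensorProduct.tmul_sub]
    congr 1
    by_cases h : i = j
    · subst h; simp
    · simp [h]

theorem dTheta_dTime (i : Fin N) (x : Superfield 𝕜 N) :
    dTheta 𝕜 i (dTime 𝕜 N x) = dTime 𝕜 N (dTheta 𝕜 i x) := by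
  induction x using TensorProduct.induction_on with
  | zero => simp
  | add a b ha hb => simp only [map_add, ha, hb]
  | tmul f x => simp [dTheta, dTime]

theorem mulTheta_dTime (i : Fin N) (x : Superfield 𝕜 N) :
    mulTheta 𝕜 i (dTime 𝕜 N x) = dTime 𝕜 N (mulTheta 𝕜 i x) := by
  induction x using TensorProduct.induction_on with
  | zero => simp
  | add a b ha hb => simp only [map_add, ha, hb]
  | tmul f x => simp [mulTheta, dTime]

theorem superPar_superPar (x : Superfield 𝕜 N) : superPar 𝕜 N (superPar 𝕜 N x) = x := by
  induction x using TensorProduct.induction_on with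
  | zero => simp
  | add a b ha hb => simp only [map_add, ha, hb]
  | tmul f x => simp [superPar]

theorem superPar_dTime (x : Superfield 𝕜 N) :
    superPar 𝕜 N (dTime 𝕜 N x) = dTime 𝕜 N (superPar 𝕜 N x) := by
  induction x using TensorProduct.induction_on with
  | zero => simp
  | add a b ha hb => simp only [map_add, ha, hb]
  | tmul f x => simp [superPar, dTime]

theorem superPar_mulTheta (i : Fin N) (x : Superfield 𝕜 N) :
    superPar 𝕜 N (mulTheta 𝕜 i x) = -mulTheta 𝕜 i (superPar 𝕜 N x) := by
  induction x using TensorProduct.induction_on with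
  | zero => simp
  | add a b ha hb => simp only [map_add, ha, hb, neg_add]
  | tmul f x =>
    simp only [superPar, mulTheta, LinearMap.lTensor_tmul, LinearMap.mulLeft_apply,
      AlgHom.toLinearMap_apply, map_mul, ← TensorProduct.tmul_neg, ← neg_mul]
    congr 2
    exact CliffordAlgebra.involute_ι _

theorem involute_contractLeft (f : Module.Dual 𝕜 (Fin N → 𝕜))
    (x : CliffordAlgebra (0 : QuadraticForm 𝕜 (Fin N → 𝕜))) :
    CliffordAlgebra.involute (CliffordAlgebra.contractLeft f x) =
      -CliffordAlgebra.contractLeft f (CliffordAlgebra.involute x) := by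
  induction x using CliffordAlgebra.left_induction with
  | algebraMap r => simp [CliffordAlgebra.contractLeft_algebraMap]
  | add x y hx hy => simp only [map_add, hx, hy, neg_add]
  | ι_mul x m hx =>
    rw [CliffordAlgebra.contractLeft_ι_mul, map_sub, map_smul, map_mul, CliffordAlgebra.involute_ι,
      hx, map_mul, CliffordAlgebra.involute_ι, neg_mul (CliffordAlgebra.ι _ m) (CliffordAlgebra.involute x),
      map_neg, CliffordAlgebra.contractLeft_ι_mul]
    simp

theorem superPar_dTheta (i : Fin N) (x : Superfield 𝕜 N) :
    superPar 𝕜 N (dTheta 𝕜 i x) = -dTheta 𝕜 i (superPar 𝕜 N x) := by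
  induction x using TensorProduct.induction_on with
  | zero => simp
  | add a b ha hb => simp only [map_add, ha, hb, neg_add]
  | tmul f x =>
    simp only [superPar, dTheta, LinearMap.lTensor_tmul, AlgHom.toLinearMap_apply,
      ← TensorProduct.tmul_neg]
    rw [← involute_contractLeft]

theorem superPar_leftQ (i : Fin N) (x : Superfield 𝕜 N) :
    superPar 𝕜 N (leftQ 𝕜 i x) = -leftQ 𝕜 i (superPar 𝕜 N x) := by
  simp [leftQ, superPar_dTheta, superPar_mulTheta, superPar_dTime]
  abel

theorem superPar_covD (i : Fin N) (x : Superfield 𝕜 N) :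
    superPar 𝕜 N (covD 𝕜 i x) = -covD 𝕜 i (superPar 𝕜 N x) := by
  simp [covD, superPar_dTheta, superPar_mulTheta, superPar_dTime]
  abel

theorem leftQ_dTime (i : Fin N) (x : Superfield 𝕜 N) :
    dTime 𝕜 N (leftQ 𝕜 i x) = leftQ 𝕜 i (dTime 𝕜 N x) := by
  simp [leftQ, dTheta_dTime, mulTheta_dTime]

theorem covD_dTime (i : Fin N) (x : Superfield 𝕜 N) :
    dTime 𝕜 N (covD 𝕜 i x) = covD 𝕜 i (dTime 𝕜 N x) := by
  simp [covD, dTheta_dTime, mulTheta_dTime]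

theorem leftQ_leftQ (i j : Fin N) (x : Superfield 𝕜 N) :
    leftQ 𝕜 i (leftQ 𝕜 j x) + leftQ 𝕜 j (leftQ 𝕜 i x) =
      if i = j then (2 : 𝕜) • dTime 𝕜 N x else 0 := by
  simp only [leftQ, LinearMap.add_apply, LinearMap.comp_apply, map_add, mulTheta_dTime,
    dTheta_dTime, dTheta_mulTheta, dTheta_dTheta 𝕜 j i, mulTheta_mulTheta 𝕜 j i, eq_comm (a := j)]
  split_ifs
  · simp [two_smul]
    abel
  · simp
    abel

theorem covD_covD (i j : Fin N) (x : Superfield 𝕜 N) :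
    covD 𝕜 i (covD 𝕜 j x) + covD 𝕜 j (covD 𝕜 i x) =
      if i = j then -((2 : 𝕜) • dTime 𝕜 N x) else 0 := by
  simp only [covD, LinearMap.sub_apply, LinearMap.comp_apply, map_sub, mulTheta_dTime,
    dTheta_dTime, dTheta_mulTheta, dTheta_dTheta 𝕜 j i, mulTheta_mulTheta 𝕜 j i, eq_comm (a := j)]
  split_ifs
  · simp [two_smul]
    abel
  · simp
    abel

theorem leftQ_covD (i j : Fin N) (x : Superfield 𝕜 N) :
    leftQ 𝕜 i (covD 𝕜 j x) = -covD 𝕜 j (leftQ 𝕜 i x) := by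
  rw [← add_eq_zero_iff_eq_neg]
  simp only [covD, leftQ, LinearMap.sub_apply, LinearMap.add_apply, LinearMap.comp_apply, map_sub,
    map_add, mulTheta_dTime, dTheta_dTime, dTheta_mulTheta, dTheta_dTheta 𝕜 j i,
    mulTheta_mulTheta 𝕜 j i, eq_comm (a := j)]
  split_ifs
  · simp
    abel
  · simp
    abel

end Superfields

/-! ### The pure spinor functor -/

section PureSpinor

variable {𝕜 : Type u} [RCLike 𝕜] {N : ℕ}

variable (𝕜 N) in
/-- The free superfields as a `𝔱`-module, with `𝔱` acting by the left translations. -/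
def superfields : TModule.{u, u} 𝕜 N where
  carrier := Superfield 𝕜 N
  grade := superGrade 𝕜 N
  internal := superGrade_internal 𝕜 N
  par := superPar 𝕜 N
  par_par := superPar_superPar 𝕜
  par_grade := superPar_mem 𝕜 N
  Q := leftQ 𝕜
  H := dTime 𝕜 N
  Q_grade := leftQ_mem 𝕜
  H_grade := dTime_mem 𝕜 N
  par_Q := superPar_leftQ 𝕜
  par_H := superPar_dTime 𝕜
  Q_Q := leftQ_leftQ 𝕜
  H_Q := leftQ_dTime 𝕜

/-- The right translations `D_i` on the `𝔱`-module of free superfields. -/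
def rightD (i : Fin N) : (superfields 𝕜 N).carrier →ₗ[𝕜] (superfields 𝕜 N).carrier := covD 𝕜 i

theorem rightD_mem (i : Fin N) (n : ℤ) (x) (hx : x ∈ (superfields 𝕜 N).grade n) :
    rightD i x ∈ (superfields 𝕜 N).grade (n + 1) := covD_mem 𝕜 i n x hx

theorem rightD_rightD (i j : Fin N) (x : (superfields 𝕜 N).carrier) :
    rightD i (rightD j x) + rightD j (rightD i x) =
      if i = j then -((2 : 𝕜) • (superfields 𝕜 N).H x) else 0 := covD_covD 𝕜 i j x

theorem par_rightD (i : Fin N) (x : (superfields 𝕜 N).carrier) :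
    (superfields 𝕜 N).par (rightD i x) = -rightD i ((superfields 𝕜 N).par x) :=
  superPar_covD 𝕜 i x

theorem rightD_H (i : Fin N) (x : (superfields 𝕜 N).carrier) :
    rightD i ((superfields 𝕜 N).H x) = (superfields 𝕜 N).H (rightD i x) := (covD_dTime 𝕜 i x).symm

theorem rightD_Q (i j : Fin N) (x : (superfields 𝕜 N).carrier) :
    rightD j ((superfields 𝕜 N).Q i x) = -(superfields 𝕜 N).Q i (rightD j x) :=
  (neg_eq_iff_eq_neg.2 (leftQ_covD 𝕜 i j x)).symm

/-- Multiplication by `λ_i`. -/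
def lambdaMul (M : CEModule.{u, v} 𝕜 N) (i : Fin N) : M.carrier →ₗ[𝕜] M.carrier :=
  Algebra.lsmul 𝕜 𝕜 M.carrier (MvPolynomial.X i : MvPolynomial (Fin N) 𝕜)

/-- `D_A = ∑ D_i ⊗ λ_i + 1 ⊗ d + ∂/∂t ⊗ v` on `𝕜[t, θ] ⊗ M`; the last two terms carry the Koszul
sign of the superfield factor. -/
def pureSpinorD (M : CEModule.{u, v} 𝕜 N) :
    (superfields 𝕜 N).carrier ⊗[𝕜] M.carrier →ₗ[𝕜] (superfields 𝕜 N).carrier ⊗[𝕜] M.carrier :=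
  ∑ i, TensorProduct.map (rightD i) (lambdaMul M i) +
    TensorProduct.map ((superfields 𝕜 N).par) (M.d.restrictScalars 𝕜) +
    TensorProduct.map ((superfields 𝕜 N).par ∘ₗ (superfields 𝕜 N).H) (M.v.restrictScalars 𝕜)

theorem pureSpinorD_tmul (M : CEModule.{u, v} 𝕜 N) (f : (superfields 𝕜 N).carrier) (m : M.carrier) :
    pureSpinorD M (f ⊗ₜ m) =
      ∑ i, rightD i f ⊗ₜ[𝕜] ((MvPolynomial.X i : MvPolynomial (Fin N) 𝕜) • m) +
        (superfields 𝕜 N).par f ⊗ₜ[𝕜] M.d m + (superfields 𝕜 N).par ((superfields 𝕜 N).H f) ⊗ₜ[𝕜] M.v m := by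
  simp [pureSpinorD, LinearMap.sum_apply, lambdaMul]

theorem pureSpinorD_rightD (M : CEModule.{u, v} 𝕜 N) (f : (superfields 𝕜 N).carrier) (m : M.carrier) :
    ∑ i, ∑ j, rightD j (rightD i f) ⊗ₜ[𝕜] ((MvPolynomial.X j : MvPolynomial (Fin N) 𝕜) •
      (MvPolynomial.X i : MvPolynomial (Fin N) 𝕜) • m) =
      -((superfields 𝕜 N).H f ⊗ₜ[𝕜] (qForm 𝕜 N • m)) := by
  set L := ∑ i, ∑ j, rightD j (rightD i f) ⊗ₜ[𝕜]
    ((MvPolynomial.X j : MvPolynomial (Fin N) 𝕜) •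
      (MvPolynomial.X i : MvPolynomial (Fin N) 𝕜) • m) with hL
  have e' : L = ∑ i, ∑ j, rightD i (rightD j f) ⊗ₜ[𝕜]
      ((MvPolynomial.X j : MvPolynomial (Fin N) 𝕜) •
        (MvPolynomial.X i : MvPolynomial (Fin N) 𝕜) • m) := by
    rw [hL, Finset.sum_comm]
    refine Finset.sum_congr rfl fun i _ => Finset.sum_congr rfl fun j _ => ?_
    rw [smul_comm]
  have h2 : (2 : 𝕜) • L = (2 : 𝕜) • -((superfields 𝕜 N).H f ⊗ₜ[𝕜] (qForm 𝕜 N • m)) := by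
    rw [two_smul]
    nth_rw 1 [e']
    rw [hL, ← Finset.sum_add_distrib]
    simp only [← Finset.sum_add_distrib, ← TensorProduct.add_tmul, rightD_rightD]
    rw [qForm, Finset.sum_smul, TensorProduct.tmul_sum, ← Finset.sum_neg_distrib, Finset.smul_sum]
    refine Finset.sum_congr rfl fun i _ => ?_
    rw [Finset.sum_eq_single i (fun j _ hj => by simp [hj.symm]) (by simp)]
    simp [TensorProduct.smul_tmul', pow_two, mul_smul, TensorProduct.neg_tmul]
  exact smul_right_injective ((superfields 𝕜 N).carrier ⊗[𝕜] M.carrier) (two_ne_zero (α := 𝕜)) h2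

theorem pureSpinorD_pureSpinorD (M : CEModule.{u, v} 𝕜 N)
    (x : (superfields 𝕜 N).carrier ⊗[𝕜] M.carrier) : pureSpinorD M (pureSpinorD M x) = 0 := by
  induction x using TensorProduct.induction_on with
  | zero => simp
  | add a b ha hb => simp only [map_add, ha, hb, add_zero]
  | tmul f m =>
    rw [pureSpinorD_tmul]
    simp only [map_add, map_sum, pureSpinorD_tmul, (superfields 𝕜 N).par_par, (superfields 𝕜 N).par_H, par_rightD,
      rightD_H, M.d_d, M.v_v, M.d_v, Finset.sum_add_distrib, pureSpinorD_rightD, map_smul,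
      TensorProduct.tmul_zero, map_neg, TensorProduct.neg_tmul, TensorProduct.tmul_sub]
    simp only [Finset.sum_neg_distrib]
    abel

theorem internal_restrictScalars (M : CEModule.{u, v} 𝕜 N) :
    DirectSum.IsInternal fun n => (M.grade n).restrictScalars 𝕜 := M.internal

/-- The pure spinor functor: it sends a differential graded `CE(𝔱)`-module `M` to
`A(M) = 𝕜[t, θ₁, …, θ_N] ⊗ M` with differential
`∑ D_i ⊗ λ_i + 1 ⊗ d + ∂/∂t ⊗ v`, where `D_i = ∂/∂θ_i - θ_i ∂/∂t` are the right translations, and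
with `𝔱` acting by the left translations `Q_i = ∂/∂θ_i + θ_i ∂/∂t`, `H = ∂/∂t`.
If `v` acts by `0` (so that `M` is a complex of `R/(q_N)`-modules) the last term is absent. -/
def pureSpinor (M : CEModule.{u, v} 𝕜 N) : DGTModule.{u, max u v} 𝕜 N where
  carrier := (superfields 𝕜 N).carrier ⊗[𝕜] M.carrier
  grade := tensorGrade ((superfields 𝕜 N).grade) fun n => (M.grade n).restrictScalars 𝕜
  internal := tensorGrade_internal ((superfields 𝕜 N).internal) (internal_restrictScalars M)
  par := TensorProduct.map ((superfields 𝕜 N).par) M.par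
  par_par x := by
    induction x using TensorProduct.induction_on with
    | zero => simp
    | add a b ha hb => simp only [map_add, ha, hb]
    | tmul f m => simp [(superfields 𝕜 N).par_par, M.par_par]
  par_grade n x hx := map_mem_tensorGrade 0 0
    (fun n x hx => by simpa using (superfields 𝕜 N).par_grade n x hx)
    (fun n x hx => by simpa using M.par_grade n x hx) n n (by ring) x hx
  Q i := ((superfields 𝕜 N).Q i).rTensor M.carrier
  H := ((superfields 𝕜 N).H).rTensor M.carrier
  Q_grade i n x hx := map_mem_tensorGrade 1 0 ((superfields 𝕜 N).Q_grade i) (fun n x hx => by simpa using hx)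
    n _ (by ring) x hx
  H_grade n x hx := map_mem_tensorGrade 2 0 (superfields 𝕜 N).H_grade (fun n x hx => by simpa using hx)
    n _ (by ring) x hx
  par_Q i x := by
    induction x using TensorProduct.induction_on with
    | zero => simp
    | add a b ha hb => simp only [map_add, ha, hb, neg_add]
    | tmul f m => simp [(superfields 𝕜 N).par_Q, TensorProduct.neg_tmul]
  par_H x := by
    induction x using TensorProduct.induction_on with
    | zero => simp
    | add a b ha hb => simp only [map_add, ha, hb]
    | tmul f m => simp [(superfields 𝕜 N).par_H]
  Q_Q i j x := by
    induction x using TensorProduct.induction_on with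
    | zero => simp
    | add a b ha hb =>
      simp only [map_add]
      rw [add_add_add_comm, ha, hb]
      split_ifs <;> simp
    | tmul f m =>
      simp only [LinearMap.rTensor_tmul, ← TensorProduct.add_tmul, (superfields 𝕜 N).Q_Q]
      split_ifs <;> simp [TensorProduct.smul_tmul']
  H_Q i x := by
    induction x using TensorProduct.induction_on with
    | zero => simp
    | add a b ha hb => simp only [map_add, ha, hb]
    | tmul f m => simp [(superfields 𝕜 N).H_Q]
  d := pureSpinorD M
  d_grade n x hx := by
    refine add_mem (add_mem ?_ ?_) ?_
    · rw [LinearMap.sum_apply]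
      exact Submodule.sum_mem _ fun i _ => map_mem_tensorGrade 1 0 (rightD_mem i)
        (fun n x hx => by
          rw [add_zero]
          exact Submodule.smul_mem (M.grade n) (MvPolynomial.X i) hx) n _ (by ring) x hx
    · exact map_mem_tensorGrade 0 1 (fun n x hx => by simpa using (superfields 𝕜 N).par_grade n x hx)
        M.d_grade n _ (by ring) x hx
    · exact map_mem_tensorGrade (f := (superfields 𝕜 N).par ∘ₗ (superfields 𝕜 N).H)
        (g := M.v.restrictScalars 𝕜) 2 (-1) (fun n x hx => (superfields 𝕜 N).par_grade _ _ ((superfields 𝕜 N).H_grade n x hx)) M.v_grade n _ (by ring) x hx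
  d_d := pureSpinorD_pureSpinorD M
  par_d x := by
    induction x using TensorProduct.induction_on with
    | zero => simp
    | add a b ha hb => simp only [map_add, ha, hb]
    | tmul f m =>
      have h (i : Fin N) : lambdaPar 𝕜 N (MvPolynomial.X i) = -MvPolynomial.X i := by
        simp [lambdaPar]
      simp [pureSpinorD_tmul, par_rightD, (superfields 𝕜 N).par_par, (superfields 𝕜 N).par_H, M.par_smul, h,
        M.par_d, M.par_v, TensorProduct.neg_tmul, TensorProduct.tmul_neg]
  d_Q i x := by
    induction x using TensorProduct.induction_on with
    | zero => simp
    | add a b ha hb => simp only [map_add, ha, hb, neg_add]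
    | tmul f m =>
      have h (j : Fin N) : rightD j ((superfields 𝕜 N).Q i f) = -(superfields 𝕜 N).Q i (rightD j f) := by
        exact rightD_Q i j f
      simp [pureSpinorD_tmul, h, (superfields 𝕜 N).par_Q, (superfields 𝕜 N).H_Q, TensorProduct.neg_tmul]
      abel
  d_H x := by
    induction x using TensorProduct.induction_on with
    | zero => simp
    | add a b ha hb => simp only [map_add, ha, hb]
    | tmul f m => simp [pureSpinorD_tmul, rightD_H, (superfields 𝕜 N).par_H]

end PureSpinor

end

end SusyQM

/-! ### Adinkras -/

/-- An Adinkra with `N` colors on the vertex set `V` (which is finite in all uses below). -/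
structure Adinkra (N : ℕ) (V : Type w) where
  graph : SimpleGraph V
  /-- parity or statistics `|v|` -/
  parity : V → ZMod 2
  /-- degree or dimension `h(v)` -/
  height : V → ℤ
  color : graph.edgeSet → Fin N
  dash : graph.edgeSet → ZMod 2
  /-- edges are odd -/
  parity_ne : ∀ v w, graph.Adj v w → parity v ≠ parity w
  /-- edges are unimodular with respect to the degree -/
  abs_height_sub : ∀ v w, graph.Adj v w → |height w - height v| = 1
  /-- every vertex has exactly one incident edge of each color -/
  existsUnique_edge : ∀ v i, ∃! w, ∃ h : graph.Adj v w, color ⟨s(v, w), h⟩ = i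
  /-- for `i ≠ j` the edges of colors `i` and `j` form disjoint `4`-cycles, each with an odd number
  of dashed edges: every path with colors `i, j, i` closes up by an edge of color `j`. -/
  four_cycle : ∀ i j, i ≠ j → ∀ (v₀ v₁ v₂ v₃ : V) (h₀ : graph.Adj v₀ v₁) (h₁ : graph.Adj v₁ v₂)
    (h₂ : graph.Adj v₂ v₃), color ⟨s(v₀, v₁), h₀⟩ = i → color ⟨s(v₁, v₂), h₁⟩ = j →
    color ⟨s(v₂, v₃), h₂⟩ = i → ∃ h₃ : graph.Adj v₃ v₀, color ⟨s(v₃, v₀), h₃⟩ = j ∧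
      dash ⟨s(v₀, v₁), h₀⟩ + dash ⟨s(v₁, v₂), h₁⟩ + dash ⟨s(v₂, v₃), h₂⟩ +
        dash ⟨s(v₃, v₀), h₃⟩ = 1

namespace Adinkra

noncomputable section

variable {N : ℕ} {V : Type w} (A : Adinkra N V)

/-- The other endpoint of the edge of color `i` at `v`. -/
def nbr (v : V) (i : Fin N) : V := (A.existsUnique_edge v i).choose

theorem adj_nbr (v : V) (i : Fin N) : A.graph.Adj v (A.nbr v i) :=
  (A.existsUnique_edge v i).choose_spec.1.choose

theorem color_nbr (v : V) (i : Fin N) : A.color ⟨s(v, A.nbr v i), A.adj_nbr v i⟩ = i :=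
  (A.existsUnique_edge v i).choose_spec.1.choose_spec

theorem eq_nbr {v w : V} {i : Fin N} (h : A.graph.Adj v w) (hc : A.color ⟨s(v, w), h⟩ = i) :
    w = A.nbr v i :=
  (A.existsUnique_edge v i).choose_spec.2 w ⟨h, hc⟩

/-- The sign `(-1)^{p(e)}` of the edge `e` of color `i` at `v`. -/
def sign (v : V) (i : Fin N) : ℤ := (-1) ^ (A.dash ⟨s(v, A.nbr v i), A.adj_nbr v i⟩).val

theorem sign_eq {v w : V} {i : Fin N} (h : A.graph.Adj v w) (hc : A.color ⟨s(v, w), h⟩ = i) :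
    A.sign v i = (-1) ^ (A.dash ⟨s(v, w), h⟩).val := by
  obtain rfl := A.eq_nbr h hc
  rfl

theorem color_nbr' (v : V) (i : Fin N) :
    A.color ⟨s(A.nbr v i, v), (A.adj_nbr v i).symm⟩ = i := by
  refine Eq.trans (congrArg A.color (Subtype.ext ?_)) (A.color_nbr v i)
  exact Sym2.eq_swap

theorem nbr_nbr (v : V) (i : Fin N) : A.nbr (A.nbr v i) i = v :=
  (A.eq_nbr _ (A.color_nbr' v i)).symm

theorem sign_nbr (v : V) (i : Fin N) : A.sign (A.nbr v i) i = A.sign v i := by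
  rw [A.sign_eq _ (A.color_nbr' v i), sign]
  congr 4
  exact Sym2.eq_swap

theorem sign_mul_self (v : V) (i : Fin N) : A.sign v i * A.sign v i = 1 := by
  rw [sign, ← mul_pow]
  simp

theorem nbr_comm {i j : Fin N} (hij : i ≠ j) (v : V) :
    A.nbr (A.nbr v j) i = A.nbr (A.nbr v i) j ∧
      A.sign v i * A.sign (A.nbr v i) j = -(A.sign v j * A.sign (A.nbr v j) i) := by
  obtain ⟨h₃, hc, hd⟩ := A.four_cycle i j hij v (A.nbr v i) (A.nbr (A.nbr v i) j)
    (A.nbr (A.nbr (A.nbr v i) j) i) (A.adj_nbr _ _) (A.adj_nbr _ _) (A.adj_nbr _ _)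
    (A.color_nbr _ _) (A.color_nbr _ _) (A.color_nbr _ _)
  have e1 := A.eq_nbr h₃ hc
  have e2 : A.nbr v j = A.nbr (A.nbr (A.nbr v i) j) i := by
    conv_lhs => rw [e1]
    rw [A.nbr_nbr]
  refine ⟨by rw [e2, A.nbr_nbr], ?_⟩
  have e3 : A.sign v j = (-1) ^ (A.dash ⟨s(A.nbr (A.nbr (A.nbr v i) j) i, v), h₃⟩).val := by
    rw [← A.sign_eq h₃ hc, ← e2, A.sign_nbr]
  rw [e3, e2, A.sign_nbr, sign, sign, sign]
  have key : ∀ a b c e : ZMod 2, a + b + c + e = 1 →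
      (-1 : ℤ) ^ a.val * (-1) ^ b.val = -((-1) ^ e.val * (-1) ^ c.val) := by decide
  exact key _ _ _ _ hd

theorem height_nbr (v : V) (i : Fin N) :
    A.height (A.nbr v i) = A.height v + 1 ∨ A.height (A.nbr v i) = A.height v - 1 := by
  rcases (abs_eq zero_le_one).1 (A.abs_height_sub v _ (A.adj_nbr v i)) with h | h
  · left; linarith
  · right; linarith

/-- On families `φ = (φ_v)` indexed by the vertices, the signed shift along the edges of color `i`:
for an edge with source `w`, target `v` (`h(w) = h(v) + 1`) and sign `ε`, the component at `v`
is `ε a(φ_w)` and the component at `w` is `ε b(φ_v)`. -/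
def edgeOp {S : Type*} [CommRing S] {E : Type*} [AddCommGroup E] [Module S E] (a b : E →ₗ[S] E)
    (i : Fin N) : (V → E) →ₗ[S] (V → E) :=
  LinearMap.pi fun v => A.sign v i •
    ((if A.height (A.nbr v i) = A.height v + 1 then a else b) ∘ₗ LinearMap.proj (A.nbr v i))

theorem edgeOp_apply {S : Type*} [CommRing S] {E : Type*} [AddCommGroup E] [Module S E]
    (a b : E →ₗ[S] E) (i : Fin N) (φ : V → E) (v : V) :
    A.edgeOp a b i φ v = A.sign v i •
      (if A.height (A.nbr v i) = A.height v + 1 then a else b) (φ (A.nbr v i)) := rfl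

theorem edgeOp_edgeOp {S : Type*} [CommRing S] {E : Type*} [AddCommGroup E] [Module S E]
    (a b : E →ₗ[S] E) (hab : ∀ x, a (b x) = b (a x)) (i j : Fin N) (φ : V → E) (v : V) :
    A.edgeOp a b i (A.edgeOp a b j φ) v + A.edgeOp a b j (A.edgeOp a b i φ) v =
      if i = j then (2 : S) • a (b (φ v)) else 0 := by
  by_cases hij : i = j
  · subst hij
    simp only [edgeOp_apply, A.nbr_nbr, A.sign_nbr, map_zsmul, if_true, smul_smul,
      A.sign_mul_self, one_smul, two_smul]
    rcases A.height_nbr v i with h | h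
    · have h1 : ¬ (A.height v = A.height v + 1 + 1) := by omega
      simp [h, h1]
    · have h1 : ¬ (A.height v - 1 = A.height v + 1) := by omega
      simp [h, h1, hab]
  · obtain ⟨e1, e2⟩ := A.nbr_comm hij v
    simp only [edgeOp_apply, map_zsmul, smul_smul, if_neg hij, e1, e2, neg_smul]
    rw [neg_add_eq_zero]
    congr 1
    have k1 := A.height_nbr (A.nbr v j) i
    have k2 := A.height_nbr (A.nbr v i) j
    rw [e1] at k1
    rcases A.height_nbr v i with h | h <;> rcases A.height_nbr v j with h' | h' <;>
      rw [h'] at k1 <;> rw [h] at k2 <;> rw [h, h'] <;> rcases k1 with k1 | k1 <;>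
      rcases k2 with k2 | k2 <;> rw [k1] at k2 ⊢ <;>
      first
        | (exfalso; omega)
        | (have h1 : ¬ (A.height v - 1 = A.height v + 1) := by omega
           have h0 : ¬ (A.height v = A.height v + 1 + 1) := by omega
           have h4 : A.height v + 1 - 1 = A.height v - 1 + 1 := by omega
           simp [h0, h1, h4, hab])

/-- `(-1)^{|v|}`. -/
def parSign (v : V) : ℤ := (-1) ^ (A.parity v).val

theorem parSign_mul_self (v : V) : A.parSign v * A.parSign v = 1 := by
  rw [parSign, ← mul_pow]
  simp

theorem parSign_nbr (v : V) (i : Fin N) : A.parSign (A.nbr v i) = -A.parSign v := by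
  have key : ∀ a b : ZMod 2, a ≠ b → (-1 : ℤ) ^ b.val = -(-1) ^ a.val := by decide
  exact key _ _ (A.parity_ne _ _ (A.adj_nbr v i))

/-! ### The multiplet of an Adinkra -/

variable (𝕜 : Type u) [RCLike 𝕜]

/-- The degree `n` part of the space of fields: the field `φ` with `φ_v = t^k` and all other
components zero has degree `-h(v) - 2k`. -/
def multipletGrade (n : ℤ) : Submodule 𝕜 (V → Polynomial 𝕜) :=
  Submodule.pi Set.univ fun v => SusyQM.timeGrade 𝕜 (n + A.height v)

theorem multipletGrade_internal [Finite V] : DirectSum.IsInternal (A.multipletGrade 𝕜) := by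
  classical
  have := Fintype.ofFinite V
  obtain ⟨T, hT⟩ := SusyQM.exists_degreeOperator _ (SusyQM.timeGrade_internal 𝕜)
    (fun n => (n : 𝕜))
  refine SusyQM.isInternal_of_degreeOperator _
    (LinearMap.pi fun v => T ∘ₗ LinearMap.proj v - (A.height v : 𝕜) • LinearMap.proj v) ?_ ?_
  · intro n φ hφ
    funext v
    have := hT _ _ (hφ v trivial)
    simp only [LinearMap.pi_apply, LinearMap.sub_apply, LinearMap.comp_apply, LinearMap.proj_apply,
      LinearMap.smul_apply, this, Pi.smul_apply]
    push_cast
    rw [add_smul, add_sub_cancel_right]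
  · intro φ
    rw [← Finset.univ_sum_single φ]
    refine Submodule.sum_mem _ fun v _ => ?_
    have h1 (f : Polynomial 𝕜) : f ∈ ⨆ n, SusyQM.timeGrade 𝕜 n := by
      rw [(SusyQM.timeGrade_internal 𝕜).submodule_iSup_eq_top]; trivial
    generalize φ v = f
    induction h1 f using Submodule.iSup_induction' with
    | mem n f hf =>
      refine Submodule.mem_iSup_of_mem (n - A.height v) fun u _ => ?_
      by_cases h : u = v
      · subst h
        simpa using hf
      · simp [h]
    | zero => simp
    | add f g _ _ hf hg => rw [Pi.single_add]; exact add_mem hf hg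

/-- The parity involution of the space of fields: `φ_v` has parity `|v|`. -/
def fieldPar : (V → Polynomial 𝕜) →ₗ[𝕜] (V → Polynomial 𝕜) :=
  LinearMap.pi fun v => A.parSign v • LinearMap.proj v

theorem fieldPar_apply (φ : V → Polynomial 𝕜) (v : V) :
    A.fieldPar 𝕜 φ v = A.parSign v • φ v := rfl

/-- The multiplet `𝒱(A)` of an Adinkra `A`: the `𝔱`-module of fields `φ = (φ_v(t))`, with one
component for each vertex `v`, polynomial in the time `t`. For every edge `e` of color `i` with
source `w` and target `v` (so that `h(w) = h(v) + 1`), the supersymmetry transformations are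
`(Q_i φ)_v = (-1)^{p(e)} φ_w` and `(Q_i φ)_w = (-1)^{p(e)} H φ_v`, where `H = ∂/∂t`. -/
def multiplet [Finite V] : SusyQM.TModule.{u, max u w} 𝕜 N where
  carrier := V → Polynomial 𝕜
  grade := A.multipletGrade 𝕜
  internal := A.multipletGrade_internal 𝕜
  par := A.fieldPar 𝕜
  par_par φ := by
    funext v
    rw [fieldPar_apply, fieldPar_apply, smul_smul, A.parSign_mul_self, one_smul]
  par_grade n φ hφ v _ :=
    (SusyQM.timeGrade 𝕜 _).toAddSubgroup.zsmul_mem (hφ v trivial) (A.parSign v)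
  Q i := A.edgeOp LinearMap.id Polynomial.derivative i
  H := LinearMap.pi fun v => Polynomial.derivative ∘ₗ LinearMap.proj v
  Q_grade i n φ hφ v _ := by
    rw [edgeOp_apply]
    refine (SusyQM.timeGrade 𝕜 _).toAddSubgroup.zsmul_mem ?_ _
    have h1 : φ (A.nbr v i) ∈ SusyQM.timeGrade 𝕜 (n + A.height (A.nbr v i)) := hφ _ trivial
    rcases A.height_nbr v i with h | h
    · rw [if_pos h, show n + 1 + A.height v = n + A.height (A.nbr v i) by
        rw [h]; ring]
      exact h1
    · rw [if_neg (by omega), show n + 1 + A.height v = n + A.height (A.nbr v i) + 2 by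
        rw [h]; ring]
      exact SusyQM.derivative_mem 𝕜 _ _ h1
  H_grade n φ hφ v _ := by
    have := SusyQM.derivative_mem 𝕜 _ _ (hφ v trivial)
    rwa [add_right_comm] at this
  par_Q i φ := by
    funext v
    simp only [edgeOp_apply, fieldPar_apply, Pi.neg_apply, A.parSign_nbr, neg_smul, map_neg,
      map_zsmul, smul_neg, neg_neg]
    rw [smul_comm]
  par_H φ := by
    funext v
    simp only [fieldPar_apply, LinearMap.pi_apply, LinearMap.comp_apply, LinearMap.proj_apply,
      map_zsmul]
  Q_Q i j φ := by
    funext v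
    have := A.edgeOp_edgeOp (LinearMap.id : Polynomial 𝕜 →ₗ[𝕜] Polynomial 𝕜)
      Polynomial.derivative (fun x => rfl) i j φ v
    simp only [Pi.add_apply, this]
    split_ifs <;> rfl
  H_Q i φ := by
    funext v
    simp only [LinearMap.pi_apply, LinearMap.comp_apply, LinearMap.proj_apply, edgeOp_apply,
      map_zsmul]
    split_ifs <;> rfl

/-! ### The complex of free `R`-modules of an Adinkra -/

/-- `∑ λ_i E_i(a, b)` on `R`-valued functions on the vertices. -/
def lambdaEdge (a b : MvPolynomial (Fin N) 𝕜 →ₗ[MvPolynomial (Fin N) 𝕜] MvPolynomial (Fin N) 𝕜) :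
    (V → MvPolynomial (Fin N) 𝕜) →ₗ[MvPolynomial (Fin N) 𝕜] (V → MvPolynomial (Fin N) 𝕜) :=
  ∑ i, (MvPolynomial.X i : MvPolynomial (Fin N) 𝕜) • A.edgeOp a b i

theorem lambdaEdge_apply
    (a b : MvPolynomial (Fin N) 𝕜 →ₗ[MvPolynomial (Fin N) 𝕜] MvPolynomial (Fin N) 𝕜)
    (x : V → MvPolynomial (Fin N) 𝕜) (u : V) :
    A.lambdaEdge 𝕜 a b x u = ∑ i, MvPolynomial.X i * (A.sign u i •
      (if A.height (A.nbr u i) = A.height u + 1 then a else b) (x (A.nbr u i))) := by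
  simp [lambdaEdge, LinearMap.sum_apply, edgeOp_apply]

theorem lambdaEdge_lambdaEdge
    (a b : MvPolynomial (Fin N) 𝕜 →ₗ[MvPolynomial (Fin N) 𝕜] MvPolynomial (Fin N) 𝕜)
    (hab : ∀ x, a (b x) = b (a x)) (x : V → MvPolynomial (Fin N) 𝕜) (u : V) :
    A.lambdaEdge 𝕜 a b (A.lambdaEdge 𝕜 a b x) u = SusyQM.qForm 𝕜 N * a (b (x u)) := by
  have e : A.lambdaEdge 𝕜 a b (A.lambdaEdge 𝕜 a b x) u =
      ∑ i, ∑ j, MvPolynomial.X i * (MvPolynomial.X j *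
        A.edgeOp a b i (A.edgeOp a b j x) u) := by
    simp only [lambdaEdge, LinearMap.sum_apply, LinearMap.smul_apply, map_sum, map_smul,
      Finset.sum_apply, Pi.smul_apply, smul_eq_mul, Finset.mul_sum]
    refine Eq.trans Finset.sum_comm ?_
    refine Finset.sum_congr rfl fun i _ => Finset.sum_congr rfl fun j _ => ?_
    ring
  have e' : A.lambdaEdge 𝕜 a b (A.lambdaEdge 𝕜 a b x) u =
      ∑ i, ∑ j, MvPolynomial.X i * (MvPolynomial.X j *
        A.edgeOp a b j (A.edgeOp a b i x) u) := by
    rw [e, Finset.sum_comm]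
    refine Finset.sum_congr rfl fun i _ => Finset.sum_congr rfl fun j _ => ?_
    ring
  have h2 : (2 : MvPolynomial (Fin N) 𝕜) * A.lambdaEdge 𝕜 a b (A.lambdaEdge 𝕜 a b x) u =
      2 * (SusyQM.qForm 𝕜 N * a (b (x u))) := by
    rw [two_mul]
    nth_rw 1 [e]
    rw [e', ← Finset.sum_add_distrib]
    simp only [← Finset.sum_add_distrib, ← mul_add, A.edgeOp_edgeOp a b hab]
    rw [SusyQM.qForm, Finset.sum_mul, Finset.mul_sum]
    refine Finset.sum_congr rfl fun i _ => ?_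
    rw [Finset.sum_eq_single i (fun j _ hj => by simp [hj.symm]) (by simp)]
    simp only [if_true, smul_eq_mul]
    ring
  exact mul_left_cancel₀ two_ne_zero h2

theorem lambdaEdge_id_id (x : V → MvPolynomial (Fin N) 𝕜) :
    A.lambdaEdge 𝕜 LinearMap.id LinearMap.id x =
      A.lambdaEdge 𝕜 LinearMap.id 0 x + A.lambdaEdge 𝕜 0 LinearMap.id x := by
  funext u
  simp only [Pi.add_apply, lambdaEdge_apply, ← Finset.sum_add_distrib]
  refine Finset.sum_congr rfl fun i _ => ?_
  split_ifs <;> simp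

/-- The parity involution of the free supermodule with basis the vertices, `λ_i` being odd. -/
def vertexPar : (V → MvPolynomial (Fin N) 𝕜) →ₗ[𝕜] (V → MvPolynomial (Fin N) 𝕜) :=
  LinearMap.pi fun u => A.parSign u •
    ((SusyQM.lambdaPar 𝕜 N).toLinearMap ∘ₗ LinearMap.proj u)

theorem vertexPar_apply (x : V → MvPolynomial (Fin N) 𝕜) (u : V) :
    A.vertexPar 𝕜 x u = A.parSign u • SusyQM.lambdaPar 𝕜 N (x u) := rfl

theorem vertexPar_lambdaEdge
    (a b : MvPolynomial (Fin N) 𝕜 →ₗ[MvPolynomial (Fin N) 𝕜] MvPolynomial (Fin N) 𝕜)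
    (ha : ∀ r, SusyQM.lambdaPar 𝕜 N (a r) = a (SusyQM.lambdaPar 𝕜 N r))
    (hb : ∀ r, SusyQM.lambdaPar 𝕜 N (b r) = b (SusyQM.lambdaPar 𝕜 N r))
    (x : V → MvPolynomial (Fin N) 𝕜) :
    A.vertexPar 𝕜 (A.lambdaEdge 𝕜 a b x) = A.lambdaEdge 𝕜 a b (A.vertexPar 𝕜 x) := by
  funext u
  have h (i : Fin N) : SusyQM.lambdaPar 𝕜 N (MvPolynomial.X i) = -MvPolynomial.X i := by
    simp [SusyQM.lambdaPar]
  simp only [vertexPar_apply, lambdaEdge_apply, map_sum, map_mul, h, map_zsmul, Finset.smul_sum,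
    A.parSign_nbr, neg_smul, map_neg, smul_neg, mul_neg, neg_mul]
  refine Finset.sum_congr rfl fun i _ => ?_
  have hc : SusyQM.lambdaPar 𝕜 N ((if A.height (A.nbr u i) = A.height u + 1 then a else b)
      (x (A.nbr u i))) = (if A.height (A.nbr u i) = A.height u + 1 then a else b)
      (SusyQM.lambdaPar 𝕜 N (x (A.nbr u i))) := by
    split_ifs
    · exact ha _
    · exact hb _
  rw [hc, ← mul_smul_comm, smul_comm]

/-- The degree `n` part is the free `R`-module on the vertices `u` with `h(u) = -n`. -/
def vertexGrade (n : ℤ) :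
    Submodule (MvPolynomial (Fin N) 𝕜) (V → MvPolynomial (Fin N) 𝕜) where
  carrier := {x | ∀ u, A.height u ≠ -n → x u = 0}
  add_mem' hx hy u hu := by simp [hx u hu, hy u hu]
  zero_mem' _ _ := rfl
  smul_mem' r x hx u hu := by simp [hx u hu]

theorem vertexGrade_internal [Finite V] : DirectSum.IsInternal (A.vertexGrade 𝕜) := by
  classical
  have := Fintype.ofFinite V
  have key : DirectSum.IsInternal fun n => (A.vertexGrade 𝕜 n).restrictScalars 𝕜 := by
    refine SusyQM.isInternal_of_degreeOperator _
      (LinearMap.pi fun u => -(A.height u : 𝕜) • LinearMap.proj u) ?_ ?_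
    · intro n x hx
      funext u
      by_cases h : A.height u = -n
      · simp [h]
      · simp [hx u h]
    · intro x
      rw [← Finset.univ_sum_single x]
      refine Submodule.sum_mem _ fun u _ =>
        Submodule.mem_iSup_of_mem (-A.height u) fun v hv => ?_
      have h : v ≠ u := by
        rintro rfl
        simp at hv
      simp [h]
  exact key

theorem lambdaEdge_id_zero_mem (n : ℤ) (x) (hx : x ∈ A.vertexGrade 𝕜 n) :
    A.lambdaEdge 𝕜 LinearMap.id 0 x ∈ A.vertexGrade 𝕜 (n + 1) := by
  intro u hu
  rw [lambdaEdge_apply]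
  refine Finset.sum_eq_zero fun i _ => ?_
  split_ifs with h
  · have := hx (A.nbr u i) (by omega)
    simp [this]
  · simp

theorem lambdaEdge_zero_id_mem (n : ℤ) (x) (hx : x ∈ A.vertexGrade 𝕜 n) :
    A.lambdaEdge 𝕜 0 LinearMap.id x ∈ A.vertexGrade 𝕜 (n - 1) := by
  intro u hu
  rw [lambdaEdge_apply]
  refine Finset.sum_eq_zero fun i _ => ?_
  split_ifs with h
  · simp
  · have h' := A.height_nbr u i
    have := hx (A.nbr u i) (by omega)
    simp [this]

/-- The complex `C(A)` of free `R`-modules of an Adinkra `A`: the basis is the set of vertices,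
the vertex `u` has degree `-h(u)`, and `d(u) = ∑_{s(e) = u} (-1)^{p(e)} λ_{c(e)} t(e)`. It is a
differential graded `CE(𝔱)`-module, in which `v` acts by the adjoint differential
`d†(u) = ∑_{t(e) = u} (-1)^{p(e)} λ_{c(e)} s(e)`. -/
def complexC [Finite V] : SusyQM.CEModule.{u, max u w} 𝕜 N where
  carrier := V → MvPolynomial (Fin N) 𝕜
  grade := A.vertexGrade 𝕜
  internal := A.vertexGrade_internal 𝕜
  par := A.vertexPar 𝕜
  par_par x := by
    funext u
    rw [vertexPar_apply, vertexPar_apply, map_zsmul, SusyQM.lambdaPar_lambdaPar, smul_smul,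
      A.parSign_mul_self, one_smul]
  par_grade n x hx u hu := by simp [vertexPar_apply, hx u hu]
  par_smul r x := by
    funext u
    simp only [vertexPar_apply, Pi.smul_apply, smul_eq_mul, map_mul]
    rw [mul_smul_comm]
  d := A.lambdaEdge 𝕜 LinearMap.id 0
  d_grade := A.lambdaEdge_id_zero_mem 𝕜
  d_d x := by
    funext u
    rw [A.lambdaEdge_lambdaEdge 𝕜 _ _ (by simp)]
    simp
  par_d := A.vertexPar_lambdaEdge 𝕜 _ _ (by simp) (by simp)
  v := A.lambdaEdge 𝕜 0 LinearMap.id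
  v_grade := A.lambdaEdge_zero_id_mem 𝕜
  v_v x := by
    funext u
    rw [A.lambdaEdge_lambdaEdge 𝕜 _ _ (by simp)]
    simp
  par_v := A.vertexPar_lambdaEdge 𝕜 _ _ (by simp) (by simp)
  d_v x := by
    funext u
    have h1 := A.lambdaEdge_lambdaEdge 𝕜 LinearMap.id LinearMap.id (fun _ => rfl) x u
    have h2 := A.lambdaEdge_lambdaEdge 𝕜 LinearMap.id 0 (by simp) x u
    have h3 := A.lambdaEdge_lambdaEdge 𝕜 0 LinearMap.id (by simp) x u
    simp only [lambdaEdge_id_id, map_add, Pi.add_apply, LinearMap.id_apply, LinearMap.zero_apply,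
      mul_zero, h2, h3] at h1 h2 h3
    simp only [Pi.sub_apply, Pi.smul_apply, smul_eq_mul, ← h1]
    simp

end

end Adinkra

/-! Cohomology of `CE(𝔱, 𝒱(A))`. On polynomial fields `H = ∂_t` is surjective and its kernel
consists of the constant fields, one scalar for each vertex. In `(R ⊗ 𝒱) ⊕ v (R ⊗ 𝒱)` the term `-v
H` therefore cancels everything except `R ⊗` constants, on which `∑ λ_i Q_i` restricts to the
differential `d` of `C(A)`: along an ascending edge `Q_i` differentiates and so vanishes, along a
descending one it is the signed identity. The inclusion of constants commutes with the differentials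
but not with `v`. The module map goes the other way, `φ + v ψ ↦ φ(0) + d† ψ(0)`; it is a chain map
because of `evalZero_lambdaQ` and `d d† + d† d = q_N`, and the constants are a section of it.
Injectivity on cohomology comes from integrating the `v`-component of the cocycle equation
(`fieldIntegral_lambdaQ`, `quasiIso_ceToComplexC`). Since `C(A)` lives in finitely many degrees,
boundedness and the isomorphism in the derived category follow.

The pure spinor functor. Write an element of `𝒜(C(A))` without explicit `λ` as a family `x = (x_v)`
of superfields. Its differential has coefficient `D_i x + q_i x` at `λ_i`, where `q_i` is the action
of `Q_i` on such families, made odd by the Koszul sign (`spinD_spinTotal`). The ordered product of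
the `1 + θ_i q_i`, an exponential of `∑ θ_i q_i`, satisfies on `θ`-independent families `φ` both
`D_i (exp φ) = q_i (exp φ)` and `(∂_{θ_i} + θ_i ∂_t) (exp φ) = exp (q_i φ)`. After multiplication by
`(-1)^{|v|}`, which reverses the sign of `q_i`, the first identity says that the image is closed and
the second that the map is equivariant.

That this map is a quasi-isomorphism is a perturbation argument. Split the differential as `D₀ + P`
with `D₀ = ∑ ∂_{θ_i} ⊗ λ_i` the Koszul differential. With `K = ∑ θ_i ⊗ ∂_{λ_i}`, the anticommutator
`D₀ K + K D₀` counts the `θ`s and the `λ`s (`koszulW_tmul`), hence is invertible off the part with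
`θ = λ = 0`. The rest `P` strictly lowers the quantity "twice the degree in `t` plus the height",
which is bounded below because `V` is finite. So the closed elements whose `θ = λ = 0` part vanishes
are exact (`exists_eq_of_filtration`, `exists_spinorD_eq`). That part kills every boundary and
recovers `φ` from its image up to sign, which gives injectivity and surjectivity on cohomology. -/

namespace SusyQM

noncomputable section

/-! ### Quasi-isomorphisms of graded complexes -/

/-- The projections onto the components of a grading. -/
theorem exists_gradeProj {S E : Type*} [Ring S] [AddCommGroup E] [Module S E]
    (𝒢 : ℤ → Submodule S E) (h : DirectSum.IsInternal 𝒢) (n : ℤ) :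
    ∃ p : E →ₗ[S] E, (∀ x, p x ∈ 𝒢 n) ∧ (∀ x ∈ 𝒢 n, p x = x) ∧
      ∀ m ≠ n, ∀ x ∈ 𝒢 m, p x = 0 := by
  classical
  let e := LinearEquiv.ofBijective (DirectSum.coeLinearMap 𝒢) h
  have key (m : ℤ) (x : E) (hx : x ∈ 𝒢 m) :
      e.symm x = DirectSum.lof S ℤ (fun n => 𝒢 n) m ⟨x, hx⟩ := by
    rw [LinearEquiv.symm_apply_eq]
    exact (DirectSum.coeLinearMap_lof 𝒢 m ⟨x, hx⟩).symm
  refine ⟨(𝒢 n).subtype ∘ₗ DirectSum.component S ℤ (fun n => 𝒢 n) n ∘ₗ e.symm.toLinearMap,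
    fun x => Submodule.coe_mem _, fun x hx => ?_, fun m hm x hx => ?_⟩
  · simp [key n x hx]
  · simp [key m x hx, DirectSum.component.of, hm]

/-- Homogeneous elements span, and on them both sides agree: in degree `n` the projections are
identities, in any other degree both sides vanish. Used for differentials (`c = 1`) and for chain
maps (`c = 0`). -/
theorem map_gradeProj {S E F : Type*} [Ring S] [AddCommGroup E] [Module S E] [AddCommGroup F]
    [Module S F] {𝒢 : ℤ → Submodule S E} {ℋ : ℤ → Submodule S F} (h : DirectSum.IsInternal 𝒢)
    {f : E →ₗ[S] F} {c : ℤ} (hf : ∀ n, ∀ x ∈ 𝒢 n, f x ∈ ℋ (n + c)) {n : ℤ} {p : E →ₗ[S] E}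
    {q : F →ₗ[S] F} (hp : ∀ x ∈ 𝒢 n, p x = x) (hp' : ∀ m ≠ n, ∀ x ∈ 𝒢 m, p x = 0)
    (hq : ∀ x ∈ ℋ (n + c), q x = x) (hq' : ∀ m ≠ n + c, ∀ x ∈ ℋ m, q x = 0) (x : E) :
    q (f x) = f (p x) := by
  have hx : x ∈ ⨆ n, 𝒢 n := by rw [h.submodule_iSup_eq_top]; trivial
  induction hx using Submodule.iSup_induction' with
  | mem m x hx =>
    by_cases hm : m = n
    · subst hm
      rw [hp x hx, hq _ (hf _ x hx)]
    · rw [hp' m hm x hx, hq' (m + c) (by omega) _ (hf _ x hx), map_zero]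
  | zero => simp
  | add x y _ _ hx hy => simp only [map_add, hx, hy]

section

variable {S : Type*} [Ring S]

/-- With homology realised as kernel modulo image, `hs` is surjectivity and `hi` is injectivity of
the induced map, both phrased on elements. -/
theorem shortComplex_quasiIso {X Y : ShortComplex (ModuleCat.{v} S)} (φ : X ⟶ Y)
    (hs : ∀ z : Y.X₂, Y.g z = 0 → ∃ (x : X.X₂) (y : Y.X₁), X.g x = 0 ∧ z = φ.τ₂ x + Y.f y)
    (hi : ∀ (x : X.X₂) (y : Y.X₁), X.g x = 0 → φ.τ₂ x = Y.f y → ∃ x', x = X.f x') :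
    ShortComplex.QuasiIso φ := by
  have hc (x : X.X₂) : Y.g (φ.τ₂ x) = φ.τ₃ (X.g x) := congr($(φ.comm₂₃) x)
  have hc' (x : X.X₁) : Y.f (φ.τ₁ x) = φ.τ₂ (X.f x) := congr($(φ.comm₁₂) x)
  let γ := ShortComplex.LeftHomologyMapData
    (φ := φ) (h₁ := X.moduleCatLeftHomologyData) (h₂ := Y.moduleCatLeftHomologyData)
  obtain ⟨γ⟩ : Nonempty γ := inferInstance
  have hK (x : LinearMap.ker X.g.hom) : Subtype.val (p := (· ∈ LinearMap.ker Y.g.hom)) (γ.φK x) = φ.τ₂ x.1 :=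
    congr($(γ.commi) x)
  have hH (x : LinearMap.ker X.g.hom) : γ.φH (X.moduleCatLeftHomologyData.π x) =
    Y.moduleCatLeftHomologyData.π (γ.φK x) := congr($(γ.commπ) x)
  rw [γ.quasiIso_iff, ConcreteCategory.isIso_iff_bijective]
  constructor
  · rw [injective_iff_map_eq_zero]
    intro a ha
    obtain ⟨x, rfl⟩ := Submodule.mkQ_surjective _ a
    have h2 := (hH x).symm.trans ha
    obtain ⟨y, hy⟩ := (Submodule.Quotient.mk_eq_zero _).1 h2
    obtain ⟨x', hx'⟩ := hi x.1 y x.2 (by rw [← hK, ← hy]; rfl)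
    exact (Submodule.Quotient.mk_eq_zero _).2 ⟨x', Subtype.ext hx'.symm⟩
  · intro a
    obtain ⟨z, rfl⟩ := Submodule.mkQ_surjective _ a
    obtain ⟨x, y, hx, hz⟩ := hs z.1 z.2
    refine ⟨X.moduleCatLeftHomologyData.π ⟨x, hx⟩, (hH _).trans ?_⟩
    refine ((Submodule.Quotient.eq _).2 ⟨-y, Subtype.ext ?_⟩)
    have := hK ⟨x, hx⟩
    change Y.f (-y) = Subtype.val (p := (· ∈ LinearMap.ker Y.g.hom)) (γ.φK ⟨x, hx⟩) - z.1
    rw [this, hz, map_neg]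
    simp

variable {E F : Type v} [AddCommGroup E] [Module S E] [AddCommGroup F] [Module S F]

/-- The cochain complex of a graded module with a differential. -/
def gradedComplex (𝒢 : ℤ → Submodule S E) (d : E →ₗ[S] E)
    (hd : ∀ n, ∀ x ∈ 𝒢 n, d x ∈ 𝒢 (n + 1)) (hdd : ∀ x, d (d x) = 0) :
    CochainComplex (ModuleCat.{v} S) ℤ :=
  CochainComplex.of (fun n => ModuleCat.of S (𝒢 n))
    (fun n => ModuleCat.ofHom (d.restrict (hd n)))
    (fun n => by
      exact ModuleCat.hom_ext (LinearMap.ext fun x => Subtype.ext (hdd x)))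

/-- A graded chain map that is bijective on the total cohomology is a quasi-isomorphism. -/
theorem gradedComplex_quasiIso {𝒢 : ℤ → Submodule S E} {ℋ : ℤ → Submodule S F}
    (h𝒢 : DirectSum.IsInternal 𝒢) (hℋ : DirectSum.IsInternal ℋ) {d : E →ₗ[S] E} {d' : F →ₗ[S] F}
    (hd : ∀ n, ∀ x ∈ 𝒢 n, d x ∈ 𝒢 (n + 1)) (hdd : ∀ x, d (d x) = 0)
    (hd' : ∀ n, ∀ x ∈ ℋ n, d' x ∈ ℋ (n + 1)) (hdd' : ∀ x, d' (d' x) = 0) (f : E →ₗ[S] F)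
    (hf : ∀ n, ∀ x ∈ 𝒢 n, f x ∈ ℋ n)
    (φ : gradedComplex 𝒢 d hd hdd ⟶ gradedComplex ℋ d' hd' hdd')
    (hφ : ∀ n, φ.f n = ModuleCat.ofHom (f.restrict (hf n)))
    (hs : ∀ z, d' z = 0 → ∃ x y, d x = 0 ∧ z = f x + d' y)
    (hi : ∀ x y, d x = 0 → f x = d' y → ∃ x', x = d x') : QuasiIso φ := by
  refine ⟨fun n => ?_⟩
  -- Shifting the index puts the three relevant degrees in the form `n`, `n + 1`, `n + 1 + 1`, as in
  -- the definition of the complex.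
  obtain ⟨n, rfl⟩ : ∃ m, n = m + 1 := ⟨n - 1, by ring⟩
  rw [quasiIsoAt_iff' φ n (n + 1) (n + 1 + 1) (by simp) (by simp)]
  have e (n : ℤ) : (gradedComplex 𝒢 d hd hdd).d n (n + 1) =
    ModuleCat.ofHom (d.restrict (hd n)) := by
    simp only [gradedComplex, CochainComplex.of_d]
  have e' (n : ℤ) : (gradedComplex ℋ d' hd' hdd').d n (n + 1) =
    ModuleCat.ofHom (d'.restrict (hd' n)) := by
    simp only [gradedComplex, CochainComplex.of_d]
  have e₁ (x : 𝒢 (n + 1)) :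
      Subtype.val (p := (· ∈ 𝒢 (n + 1 + 1))) ((gradedComplex 𝒢 d hd hdd).d (n + 1) (n + 1 + 1) x) = d x.1 := by
    rw [e]; rfl
  have e₂ (x : 𝒢 n) :
      Subtype.val (p := (· ∈ 𝒢 (n + 1))) ((gradedComplex 𝒢 d hd hdd).d n (n + 1) x) = d x.1 := by
    rw [e]; rfl
  have e₁' (x : ℋ (n + 1)) :
      Subtype.val (p := (· ∈ ℋ (n + 1 + 1))) ((gradedComplex ℋ d' hd' hdd').d (n + 1) (n + 1 + 1) x) = d' x.1 := by
    rw [e']; rfl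
  have e₂' (x : ℋ n) :
      Subtype.val (p := (· ∈ ℋ (n + 1))) ((gradedComplex ℋ d' hd' hdd').d n (n + 1) x) = d' x.1 := by
    rw [e']; rfl
  have e₃ (x : 𝒢 (n + 1)) : Subtype.val (p := (· ∈ ℋ (n + 1))) (φ.f (n + 1) x) = f x.1 := by
    rw [hφ]; rfl
  obtain ⟨p₀, hp₀, hp₀', hp₀''⟩ := exists_gradeProj 𝒢 h𝒢 n
  obtain ⟨p₁, hp₁, hp₁', hp₁''⟩ := exists_gradeProj 𝒢 h𝒢 (n + 1)
  obtain ⟨p₂, hp₂, hp₂', hp₂''⟩ := exists_gradeProj 𝒢 h𝒢 (n + 1 + 1)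
  obtain ⟨q₀, hq₀, hq₀', hq₀''⟩ := exists_gradeProj ℋ hℋ n
  obtain ⟨q₁, hq₁, hq₁', hq₁''⟩ := exists_gradeProj ℋ hℋ (n + 1)
  have c₁ := map_gradeProj h𝒢 hd hp₁' hp₁'' hp₂' hp₂''
  have c₂ := map_gradeProj h𝒢 hd hp₀' hp₀'' hp₁' hp₁''
  have c₃ := map_gradeProj hℋ hd' hq₀' hq₀'' hq₁' hq₁''
  have c₄ := map_gradeProj h𝒢 (c := 0) (fun n x hx => by simpa using hf n x hx) hp₁' hp₁''
    (by simpa using hq₁') (by simpa using hq₁'')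
  refine shortComplex_quasiIso _ ?_ ?_
  · intro (z : ℋ (n + 1)) hz
    obtain ⟨x, y, hx, hxy⟩ := hs z.1 ((e₁' z).symm.trans congr(Subtype.val (p := (· ∈ ℋ (n + 1 + 1))) $hz))
    -- The elements `x`, `y` from `hs` need not be homogeneous. Their components of degrees `n + 1`
    -- and `n` satisfy the same relations, since the projections intertwine `d`, `d'` and `f`.
    refine ⟨(⟨p₁ x, hp₁ x⟩ : 𝒢 (n + 1)), (⟨q₀ y, hq₀ y⟩ : ℋ n), ?_, ?_⟩
    · refine Subtype.ext ((e₁ _).trans ?_)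
      change d (p₁ x) = 0
      rw [← c₁, hx, map_zero]
    · refine Subtype.ext (Eq.trans ?_ (congrArg₂ (· + ·) (e₃ _) (e₂' _)).symm)
      change z.1 = f (p₁ x) + d' (q₀ y)
      rw [← c₃, ← c₄, ← map_add, ← hxy, hq₁' _ z.2]
  · intro (x : 𝒢 (n + 1)) (y : ℋ n) hx hxy
    obtain ⟨x', hx'⟩ := hi x.1 y.1 ((e₁ x).symm.trans congr(Subtype.val (p := (· ∈ 𝒢 (n + 1 + 1))) $hx))
      (((e₃ x).symm.trans congr(Subtype.val (p := (· ∈ ℋ (n + 1))) $hxy)).trans (e₂' y))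
    refine ⟨(⟨p₀ x', hp₀ x'⟩ : 𝒢 n), Subtype.ext (Eq.trans ?_ (e₂ _).symm)⟩
    change x.1 = d (p₀ x')
    rw [← c₂, ← hx', hp₁' _ x.2]

end

theorem CEModule.Hom.quasiIso_complexMap {𝕜 : Type u} [RCLike 𝕜] {N : ℕ}
    {M M' : CEModule.{u, v} 𝕜 N} (f : M.Hom M')
    (hs : ∀ z, M'.d z = 0 → ∃ x y, M.d x = 0 ∧ z = f.toFun x + M'.d y)
    (hi : ∀ x y, M.d x = 0 → f.toFun x = M'.d y → ∃ x', x = M.d x') : QuasiIso f.complexMap :=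
  gradedComplex_quasiIso M.internal M'.internal M.d_grade M.d_d M'.d_grade M'.d_d f.toFun
    f.map_grade f.complexMap (fun _ => rfl) hs hi

theorem DGTModule.Hom.quasiIso_complexMap {𝕜 : Type u} [RCLike 𝕜] {N : ℕ}
    {M M' : DGTModule.{u, v} 𝕜 N} (f : M.Hom M')
    (hs : ∀ z, M'.d z = 0 → ∃ x y, M.d x = 0 ∧ z = f.toFun x + M'.d y)
    (hi : ∀ x y, M.d x = 0 → f.toFun x = M'.d y → ∃ x', x = M.d x') : QuasiIso f.complexMap :=
  gradedComplex_quasiIso M.internal M'.internal M.d_grade M.d_d M'.d_grade M'.d_d f.toFun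
    f.map_grade f.complexMap (fun _ => rfl) hs hi

end

end SusyQM

namespace SusyQM

noncomputable section

/-! ### Polynomials in the time variable -/

theorem coeff_zero_of_mem_timeGrade {𝕜 : Type u} [RCLike 𝕜] {n : ℤ} (hn : n ≠ 0)
    {f : Polynomial 𝕜} (hf : f ∈ timeGrade 𝕜 n) : f.coeff 0 = 0 := by
  induction hf using Submodule.span_induction with
  | mem f hf =>
    obtain ⟨k, rfl, rfl⟩ := hf
    rw [Polynomial.coeff_X_pow, if_neg]
    rintro rfl
    simp at hn
  | zero => simp
  | add f g _ _ hf hg => rw [Polynomial.coeff_add, hf, hg, add_zero]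
  | smul c f _ hf => rw [Polynomial.coeff_smul, hf, smul_zero]

/-- `I` is integration from `0` to `t`, that is `X^n ↦ X^(n+1) / (n+1)`, which exists in
characteristic zero. It inverts the derivative on the right, and on the left up to the value at `0`.
-/
theorem exists_antiderivative (𝕜 : Type u) [RCLike 𝕜] :
    ∃ I : Polynomial 𝕜 →ₗ[𝕜] Polynomial 𝕜, (∀ f, (I f).derivative = f) ∧
      ∀ f, I f.derivative = f - Polynomial.C (f.coeff 0) := by
  let I : Polynomial 𝕜 →ₗ[𝕜] Polynomial 𝕜 := (Polynomial.basisMonomials 𝕜).constr 𝕜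
    fun n => Polynomial.monomial (n + 1) ((n + 1 : 𝕜)⁻¹)
  have hI (n : ℕ) (a : 𝕜) :
      I (Polynomial.monomial n a) = Polynomial.monomial (n + 1) (a * (n + 1 : 𝕜)⁻¹) := by
    have h1 : I (Polynomial.monomial n 1) = Polynomial.monomial (n + 1) ((n + 1 : 𝕜)⁻¹) := by
      have := (Polynomial.basisMonomials 𝕜).constr_basis 𝕜
        (fun n => Polynomial.monomial (n + 1) ((n + 1 : 𝕜)⁻¹)) n
      rwa [Polynomial.coe_basisMonomials] at this
    have h2 : Polynomial.monomial n a = a • Polynomial.monomial n (1 : 𝕜) := by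
      rw [Polynomial.smul_monomial, smul_eq_mul, mul_one]
    rw [h2, map_smul, h1, Polynomial.smul_monomial, smul_eq_mul]
  refine ⟨I, fun f => ?_, fun f => ?_⟩
  · induction f using Polynomial.induction_on' with
    | add p q hp hq => rw [map_add, Polynomial.derivative_add, hp, hq]
    | monomial n a =>
      rw [hI, Polynomial.derivative_monomial]
      have : (n + 1 : 𝕜) ≠ 0 := by exact_mod_cast n.succ_ne_zero
      simp [this]
  · induction f using Polynomial.induction_on' with
    | add p q hp hq =>
      rw [Polynomial.derivative_add, map_add, hp, hq, Polynomial.coeff_add, map_add]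
      abel
    | monomial n a =>
      cases n with
      | zero => simp
      | succ n =>
        rw [Polynomial.derivative_monomial, Nat.add_sub_cancel, hI]
        have : (n + 1 : 𝕜) ≠ 0 := by exact_mod_cast n.succ_ne_zero
        simp [this, Polynomial.coeff_monomial]

end

end SusyQM

namespace Adinkra

noncomputable section

variable {N : ℕ} {V : Type v} (A : Adinkra N V) (𝕜 : Type u) [RCLike 𝕜]

/-! ### The Chevalley–Eilenberg complex of the multiplet -/

section

variable [Finite V]

/-- The component of a field at a vertex. -/
def component (v : V) : (A.multiplet 𝕜).carrier →ₗ[𝕜] Polynomial 𝕜 :=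
  (LinearMap.proj v : (V → Polynomial 𝕜) →ₗ[𝕜] Polynomial 𝕜)

/-- The field with given components, depending linearly on a parameter. -/
def ofComponents {E : Type*} [AddCommGroup E] [Module 𝕜 E] (f : V → E →ₗ[𝕜] Polynomial 𝕜) :
    E →ₗ[𝕜] (A.multiplet 𝕜).carrier :=
  (LinearMap.pi f : E →ₗ[𝕜] (V → Polynomial 𝕜))

theorem component_ofComponents {E : Type*} [AddCommGroup E] [Module 𝕜 E]
    (f : V → E →ₗ[𝕜] Polynomial 𝕜) (v : V) (x : E) :
    A.component 𝕜 v (A.ofComponents 𝕜 f x) = f v x := rfl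

variable {𝕜} in
theorem field_ext {φ ψ : (A.multiplet 𝕜).carrier}
    (h : ∀ v, A.component 𝕜 v φ = A.component 𝕜 v ψ) : φ = ψ := funext h

theorem component_Q (v : V) (i : Fin N) (φ : (A.multiplet 𝕜).carrier) :
    A.component 𝕜 v ((A.multiplet 𝕜).Q i φ) = A.sign v i •
      if A.height (A.nbr v i) = A.height v + 1 then A.component 𝕜 (A.nbr v i) φ
      else (A.component 𝕜 (A.nbr v i) φ).derivative := by
  refine (A.edgeOp_apply LinearMap.id Polynomial.derivative i φ v).trans ?_
  split_ifs <;> rfl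

theorem component_H (v : V) (φ : (A.multiplet 𝕜).carrier) :
    A.component 𝕜 v ((A.multiplet 𝕜).H φ) = (A.component 𝕜 v φ).derivative := rfl

theorem component_par (v : V) (φ : (A.multiplet 𝕜).carrier) :
    A.component 𝕜 v ((A.multiplet 𝕜).par φ) = A.parSign v • A.component 𝕜 v φ := rfl

theorem mem_multiplet_grade {n : ℤ} {φ : (A.multiplet 𝕜).carrier} :
    φ ∈ (A.multiplet 𝕜).grade n ↔
      ∀ v, A.component 𝕜 v φ ∈ SusyQM.timeGrade 𝕜 (n + A.height v) :=
  ⟨fun h v => h v trivial, fun h v _ => h v⟩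

/-- The evaluation of fields at `t = 0`, with coefficients in `R`. -/
def evalZero : MvPolynomial (Fin N) 𝕜 ⊗[𝕜] (A.multiplet 𝕜).carrier →ₗ[MvPolynomial (Fin N) 𝕜]
    (V → MvPolynomial (Fin N) 𝕜) :=
  LinearMap.pi fun v => (TensorProduct.AlgebraTensorModule.rid 𝕜 (MvPolynomial (Fin N) 𝕜)
    (MvPolynomial (Fin N) 𝕜)).toLinearMap ∘ₗ
      LinearMap.baseChange (MvPolynomial (Fin N) 𝕜) (Polynomial.lcoeff 𝕜 0 ∘ₗ A.component 𝕜 v)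

theorem evalZero_tmul (r : MvPolynomial (Fin N) 𝕜) (φ : (A.multiplet 𝕜).carrier) (v : V) :
    A.evalZero 𝕜 (r ⊗ₜ φ) v = (A.component 𝕜 v φ).coeff 0 • r := by
  simp [evalZero]

/-- At a vertex `v`, an edge whose other end is higher contributes the undifferentiated field there,
which is a term of `d`; an edge whose other end is lower contributes a derivative, which is a term
of `d†` applied to `H`. -/
theorem evalZero_lambdaQ (a : MvPolynomial (Fin N) 𝕜 ⊗[𝕜] (A.multiplet 𝕜).carrier) :
    A.evalZero 𝕜 (SusyQM.lambdaQ (A.multiplet 𝕜) a) =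
      A.lambdaEdge 𝕜 LinearMap.id 0 (A.evalZero 𝕜 a) + A.lambdaEdge 𝕜 0 LinearMap.id
        (A.evalZero 𝕜 ((A.multiplet 𝕜).H.baseChange (MvPolynomial (Fin N) 𝕜) a)) := by
  induction a with
  | zero => simp
  | add a b ha hb => simp only [map_add, ha, hb]; abel
  | tmul r φ =>
    funext v
    rw [SusyQM.lambdaQ_tmul, LinearMap.baseChange_tmul, map_sum, Finset.sum_apply, Pi.add_apply,
      lambdaEdge_apply, lambdaEdge_apply, ← Finset.sum_add_distrib]
    refine Finset.sum_congr rfl fun i _ => ?_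
    rw [evalZero_tmul, component_Q, ← Int.cast_smul_eq_zsmul 𝕜, Polynomial.coeff_smul,
      ← Int.cast_smul_eq_zsmul 𝕜 (A.sign v i), ← Int.cast_smul_eq_zsmul 𝕜 (A.sign v i)]
    split_ifs <;> simp [evalZero_tmul, component_H, mul_smul]

/-- The constant components of fields. -/
def constantPart : (A.multiplet 𝕜).carrier →ₗ[𝕜] (A.multiplet 𝕜).carrier :=
  A.ofComponents 𝕜 fun v => Polynomial.monomial 0 ∘ₗ Polynomial.lcoeff 𝕜 0 ∘ₗ A.component 𝕜 v

theorem component_constantPart (v : V) (φ : (A.multiplet 𝕜).carrier) :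
    A.component 𝕜 v (A.constantPart 𝕜 φ) = Polynomial.C ((A.component 𝕜 v φ).coeff 0) := by
  rw [constantPart, component_ofComponents]
  rfl

theorem H_constantPart (φ : (A.multiplet 𝕜).carrier) :
    (A.multiplet 𝕜).H (A.constantPart 𝕜 φ) = 0 :=
  A.field_ext fun v => by simp [component_H, component_constantPart]

/-- The constant fields, with coefficients in `R`. -/
def constantField [Fintype V] [DecidableEq V] : (V → MvPolynomial (Fin N) 𝕜) →ₗ[MvPolynomial (Fin N) 𝕜]
    MvPolynomial (Fin N) 𝕜 ⊗[𝕜] (A.multiplet 𝕜).carrier :=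
  ∑ v, (LinearMap.proj v : (V → MvPolynomial (Fin N) 𝕜) →ₗ[MvPolynomial (Fin N) 𝕜] _).smulRight
    (1 ⊗ₜ A.ofComponents 𝕜 (fun u => if u = v then Polynomial.monomial 0 else 0) (1 : 𝕜))

theorem constantField_apply [Fintype V] [DecidableEq V] (x : V → MvPolynomial (Fin N) 𝕜) :
    A.constantField 𝕜 x = ∑ v, x v ⊗ₜ
      A.ofComponents 𝕜 (fun u => if u = v then Polynomial.monomial 0 else 0) (1 : 𝕜) := by
  simp [constantField, LinearMap.sum_apply, TensorProduct.smul_tmul']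

theorem constantField_evalZero [Fintype V] [DecidableEq V]
    (a : MvPolynomial (Fin N) 𝕜 ⊗[𝕜] (A.multiplet 𝕜).carrier) :
    A.constantField 𝕜 (A.evalZero 𝕜 a) =
      (A.constantPart 𝕜).baseChange (MvPolynomial (Fin N) 𝕜) a := by
  induction a with
  | zero => simp
  | add a b ha hb => simp only [map_add, ha, hb]
  | tmul r φ =>
    simp only [constantField_apply, evalZero_tmul, LinearMap.baseChange_tmul,
      TensorProduct.smul_tmul, ← TensorProduct.tmul_sum]
    congr 1
    refine A.field_ext fun v => ?_
    rw [map_sum, component_constantPart, Finset.sum_eq_single v]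
    · rw [map_smul, component_ofComponents, if_pos rfl, ← map_smul]
      simp
    · intro u _ hu
      rw [map_smul, component_ofComponents, if_neg hu.symm]
      simp
    · simp

theorem evalZero_constantField [Fintype V] [DecidableEq V] (x : V → MvPolynomial (Fin N) 𝕜) :
    A.evalZero 𝕜 (A.constantField 𝕜 x) = x := by
  funext v
  rw [constantField_apply, map_sum, Finset.sum_apply, Finset.sum_eq_single v]
  · rw [evalZero_tmul, component_ofComponents]
    simp
  · intro u _ hu
    rw [evalZero_tmul, component_ofComponents]
    simp [hu.symm]
  · simp

theorem H_constantField [Fintype V] [DecidableEq V] (x : V → MvPolynomial (Fin N) 𝕜) :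
    (A.multiplet 𝕜).H.baseChange (MvPolynomial (Fin N) 𝕜) (A.constantField 𝕜 x) = 0 := by
  -- A constant field is its own constant part, which reduces the claim to `H_constantPart` on pure
  -- tensors.
  rw [← A.evalZero_constantField 𝕜 x, constantField_evalZero]
  generalize A.constantField 𝕜 x = a
  induction a with
  | zero => simp
  | add a b ha hb => rw [map_add, map_add, ha, hb, add_zero]
  | tmul r φ => simp [H_constantPart]

/-- The constant fields form a copy of `C(A)` inside `(R ⊗ 𝒱(A), ∑ λ_i Q_i)`. Evaluation at `0`
already gives the right values, so what remains is that `∑ λ_i Q_i` sends constant fields to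
constant fields. -/
theorem lambdaQ_constantField [Fintype V] [DecidableEq V] (x : V → MvPolynomial (Fin N) 𝕜) :
    SusyQM.lambdaQ (A.multiplet 𝕜) (A.constantField 𝕜 x) =
      A.constantField 𝕜 (A.lambdaEdge 𝕜 LinearMap.id 0 x) := by
  have h1 := A.evalZero_lambdaQ 𝕜 (A.constantField 𝕜 x)
  rw [H_constantField, map_zero, map_zero, add_zero, evalZero_constantField] at h1
  rw [← h1, constantField_evalZero]
  -- Replacing the constant field by the constant part of an arbitrary element permits an induction
  -- over pure tensors.
  have h2 : A.constantField 𝕜 x =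
      (A.constantPart 𝕜).baseChange (MvPolynomial (Fin N) 𝕜) (A.constantField 𝕜 x) := by
    rw [← constantField_evalZero, evalZero_constantField]
  rw [h2]
  generalize A.constantField 𝕜 x = a
  induction a with
  | zero => simp
  | add a b ha hb => simp only [map_add, ← ha, ← hb]
  | tmul r φ =>
    simp only [LinearMap.baseChange_tmul, SusyQM.lambdaQ_tmul, map_sum]
    refine Finset.sum_congr rfl fun i _ => congrArg _ (A.field_ext fun v => ?_)
    rw [component_constantPart, component_Q, component_constantPart, ← Int.cast_smul_eq_zsmul 𝕜]
    split_ifs <;> simp [Polynomial.smul_C]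

/-- The antiderivatives of the fields, for a given antiderivative of polynomials. -/
def fieldIntegral (I : Polynomial 𝕜 →ₗ[𝕜] Polynomial 𝕜) :
    (A.multiplet 𝕜).carrier →ₗ[𝕜] (A.multiplet 𝕜).carrier :=
  A.ofComponents 𝕜 fun v => I ∘ₗ A.component 𝕜 v

theorem component_fieldIntegral (I : Polynomial 𝕜 →ₗ[𝕜] Polynomial 𝕜) (v : V)
    (φ : (A.multiplet 𝕜).carrier) :
    A.component 𝕜 v (A.fieldIntegral 𝕜 I φ) = I (A.component 𝕜 v φ) := rfl

theorem H_fieldIntegral {I : Polynomial 𝕜 →ₗ[𝕜] Polynomial 𝕜} (hI : ∀ f, (I f).derivative = f)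
    (a : MvPolynomial (Fin N) 𝕜 ⊗[𝕜] (A.multiplet 𝕜).carrier) :
    (A.multiplet 𝕜).H.baseChange (MvPolynomial (Fin N) 𝕜)
      ((A.fieldIntegral 𝕜 I).baseChange (MvPolynomial (Fin N) 𝕜) a) = a := by
  induction a with
  | zero => simp
  | add a b ha hb => rw [map_add, map_add, ha, hb]
  | tmul r φ =>
    simp only [LinearMap.baseChange_tmul]
    exact congrArg _ (A.field_ext fun v => hI _)

theorem fieldIntegral_H [Fintype V] [DecidableEq V] {I : Polynomial 𝕜 →ₗ[𝕜] Polynomial 𝕜}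
    (hI : ∀ f, I f.derivative = f - Polynomial.C (f.coeff 0))
    (a : MvPolynomial (Fin N) 𝕜 ⊗[𝕜] (A.multiplet 𝕜).carrier) :
    (A.fieldIntegral 𝕜 I).baseChange (MvPolynomial (Fin N) 𝕜)
      ((A.multiplet 𝕜).H.baseChange (MvPolynomial (Fin N) 𝕜) a) =
        a - A.constantField 𝕜 (A.evalZero 𝕜 a) := by
  rw [constantField_evalZero]
  induction a with
  | zero => simp
  | add a b ha hb => simp only [map_add, ha, hb]; abel
  | tmul r φ =>
    simp only [LinearMap.baseChange_tmul, ← TensorProduct.tmul_sub]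
    refine congrArg _ (A.field_ext fun v => ?_)
    rw [component_fieldIntegral, component_H, hI, map_sub, component_constantPart]

/-- Integration commutes with the undifferentiated half of `Q_i`. On the differentiated half, `I
(f')` and `(I f)'` differ by the value `f(0)`, and these defects add up to the constant field of
`d†` of the values at `0`. -/
theorem fieldIntegral_lambdaQ [Fintype V] [DecidableEq V] {I : Polynomial 𝕜 →ₗ[𝕜] Polynomial 𝕜}
    (hI : ∀ f, (I f).derivative = f) (hI' : ∀ f, I f.derivative = f - Polynomial.C (f.coeff 0))
    (a : MvPolynomial (Fin N) 𝕜 ⊗[𝕜] (A.multiplet 𝕜).carrier) :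
    (A.fieldIntegral 𝕜 I).baseChange (MvPolynomial (Fin N) 𝕜)
      (SusyQM.lambdaQ (A.multiplet 𝕜) a) =
        SusyQM.lambdaQ (A.multiplet 𝕜)
          ((A.fieldIntegral 𝕜 I).baseChange (MvPolynomial (Fin N) 𝕜) a) -
        A.constantField 𝕜 (A.lambdaEdge 𝕜 0 LinearMap.id (A.evalZero 𝕜 a)) := by
  -- The defect is rewritten as the value at `0` of explicit fields, one for each color, so that
  -- `constantField_evalZero` turns it into a constant part that can be compared vertex by vertex.
  have h1 (r : MvPolynomial (Fin N) 𝕜) (φ : (A.multiplet 𝕜).carrier) :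
      A.lambdaEdge 𝕜 0 LinearMap.id (A.evalZero 𝕜 (r ⊗ₜ φ)) =
        A.evalZero 𝕜 (∑ i, (MvPolynomial.X i * r) ⊗ₜ[𝕜] A.ofComponents 𝕜 (fun v => A.sign v i •
          (if A.height (A.nbr v i) = A.height v + 1 then 0
            else A.component 𝕜 (A.nbr v i))) φ) := by
    funext v
    rw [lambdaEdge_apply, map_sum, Finset.sum_apply]
    refine Finset.sum_congr rfl fun i _ => ?_
    have h2 (f : (A.multiplet 𝕜).carrier →ₗ[𝕜] Polynomial 𝕜) :
        (A.sign v i • f) φ = (A.sign v i : 𝕜) • f φ := by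
      rw [LinearMap.smul_apply, Int.cast_smul_eq_zsmul]
    rw [evalZero_tmul, evalZero_tmul, component_ofComponents, h2, ← Int.cast_smul_eq_zsmul 𝕜]
    split_ifs <;> simp [mul_smul]
  induction a with
  | zero => simp
  | add a b ha hb => simp only [map_add, ha, hb]; abel
  | tmul r φ =>
    rw [h1, constantField_evalZero]
    simp only [SusyQM.lambdaQ_tmul, map_sum, LinearMap.baseChange_tmul]
    rw [← Finset.sum_sub_distrib]
    refine Finset.sum_congr rfl fun i _ => ?_
    rw [← TensorProduct.tmul_sub]
    refine congrArg _ (A.field_ext fun v => ?_)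
    rw [map_sub, component_constantPart, component_ofComponents, component_fieldIntegral,
      component_Q, component_Q, component_fieldIntegral]
    split_ifs
    · rw [map_zsmul, LinearMap.smul_apply]
      simp
    · rw [map_zsmul, hI, hI', LinearMap.smul_apply, smul_sub, Polynomial.coeff_smul,
        Polynomial.smul_C]

theorem evalZero_mem {n : ℤ} {a : MvPolynomial (Fin N) 𝕜 ⊗[𝕜] (A.multiplet 𝕜).carrier}
    (ha : a ∈ ((A.multiplet 𝕜).grade n).baseChange (MvPolynomial (Fin N) 𝕜)) :
    A.evalZero 𝕜 a ∈ A.vertexGrade 𝕜 n := by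
  rw [Submodule.baseChange_eq_span] at ha
  induction ha using Submodule.span_induction with
  | mem y hy =>
    obtain ⟨φ, hφ, rfl⟩ := hy
    intro v hv
    rw [TensorProduct.mk_apply, evalZero_tmul, SusyQM.coeff_zero_of_mem_timeGrade _
      ((A.mem_multiplet_grade 𝕜).1 hφ v), zero_smul]
    omega
  | zero => simp
  | add x y _ _ hx hy => rw [map_add]; exact add_mem hx hy
  | smul r x _ hx => rw [map_smul]; exact Submodule.smul_mem _ _ hx

theorem evalZero_tensorPar (a : MvPolynomial (Fin N) 𝕜 ⊗[𝕜] (A.multiplet 𝕜).carrier) :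
    A.evalZero 𝕜 (SusyQM.tensorPar (A.multiplet 𝕜) a) = A.vertexPar 𝕜 (A.evalZero 𝕜 a) := by
  induction a with
  | zero => simp
  | add a b ha hb => simp only [map_add, ha, hb]
  | tmul r φ =>
    funext v
    rw [SusyQM.tensorPar, TensorProduct.map_tmul, vertexPar_apply, evalZero_tmul, evalZero_tmul,
      component_par, Polynomial.coeff_smul, map_smul, AlgHom.toLinearMap_apply, smul_assoc]

/-- The morphism `CE(𝔱, 𝒱(A)) → C(A)` that sends `φ + v ψ` to `φ(0) + d† ψ(0)`. -/
def ceToComplexC : (SusyQM.CE (A.multiplet 𝕜)).Hom (A.complexC 𝕜) where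
  toFun := A.evalZero 𝕜 ∘ₗ LinearMap.fst _ _ _ +
    A.lambdaEdge 𝕜 0 LinearMap.id ∘ₗ A.evalZero 𝕜 ∘ₗ LinearMap.snd _ _ _
  map_grade n x hx := by
    have h2 := A.lambdaEdge_zero_id_mem 𝕜 _ _ (A.evalZero_mem 𝕜 hx.2)
    rw [add_sub_cancel_right] at h2
    exact add_mem (A.evalZero_mem 𝕜 hx.1) h2
  map_par x := by
    change A.evalZero 𝕜 (SusyQM.tensorPar _ x.1) + A.lambdaEdge 𝕜 0 LinearMap.id
        (A.evalZero 𝕜 (SusyQM.tensorPar _ x.2)) = A.vertexPar 𝕜 (A.evalZero 𝕜 x.1 +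
          A.lambdaEdge 𝕜 0 LinearMap.id (A.evalZero 𝕜 x.2))
    rw [map_add, A.vertexPar_lambdaEdge 𝕜 _ _ (by simp) (by simp), evalZero_tensorPar,
      evalZero_tensorPar]
  map_d x := by
    -- For `φ + v ψ`, the two contributions `d† (H φ)(0)` cancel. The terms in `ψ` match by `d d† =
    -- q_N - d† d` and `(d†)² = 0`.
    have h : A.lambdaEdge 𝕜 LinearMap.id 0 (A.lambdaEdge 𝕜 0 LinearMap.id (A.evalZero 𝕜 x.2)) =
        SusyQM.qForm 𝕜 N • A.evalZero 𝕜 x.2 -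
          A.lambdaEdge 𝕜 0 LinearMap.id (A.lambdaEdge 𝕜 LinearMap.id 0 (A.evalZero 𝕜 x.2)) :=
      (A.complexC 𝕜).d_v (A.evalZero 𝕜 x.2)
    have h' : A.lambdaEdge 𝕜 0 LinearMap.id (A.lambdaEdge 𝕜 0 LinearMap.id
        (A.evalZero 𝕜 ((A.multiplet 𝕜).H.baseChange _ x.2))) = 0 := (A.complexC 𝕜).v_v _
    change A.evalZero 𝕜 (SusyQM.lambdaQ _ x.1 + SusyQM.qForm 𝕜 N • x.2) +
        A.lambdaEdge 𝕜 0 LinearMap.id (A.evalZero 𝕜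
          (-((A.multiplet 𝕜).H.baseChange _ x.1) - SusyQM.lambdaQ _ x.2)) =
      A.lambdaEdge 𝕜 LinearMap.id 0 (A.evalZero 𝕜 x.1 +
        A.lambdaEdge 𝕜 0 LinearMap.id (A.evalZero 𝕜 x.2))
    simp only [map_add, map_sub, map_neg, map_smul, evalZero_lambdaQ, h, h']
    abel
  map_v x := by
    have h' : A.lambdaEdge 𝕜 0 LinearMap.id (A.lambdaEdge 𝕜 0 LinearMap.id
        (A.evalZero 𝕜 x.2)) = 0 := (A.complexC 𝕜).v_v _
    change A.evalZero 𝕜 0 + A.lambdaEdge 𝕜 0 LinearMap.id (A.evalZero 𝕜 x.1) =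
      A.lambdaEdge 𝕜 0 LinearMap.id (A.evalZero 𝕜 x.1 +
        A.lambdaEdge 𝕜 0 LinearMap.id (A.evalZero 𝕜 x.2))
    rw [map_add, h', map_zero, zero_add, add_zero]

/-- A cocycle of `C(A)` lifts to the constant field with the same values. Conversely, the
`v`-component of a cocycle equation can be integrated, which determines the other component up to
its value at `0`. -/
theorem quasiIso_ceToComplexC : QuasiIso (A.ceToComplexC 𝕜).complexMap := by
  classical
  have := Fintype.ofFinite V
  obtain ⟨I, hI, hI'⟩ := SusyQM.exists_antiderivative 𝕜
  refine (A.ceToComplexC 𝕜).quasiIso_complexMap ?_ ?_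
  · intro (x : V → MvPolynomial (Fin N) 𝕜) (hx : A.lambdaEdge 𝕜 LinearMap.id 0 x = 0)
    refine ⟨(A.constantField 𝕜 x, 0), 0, Prod.ext ?_ ?_, ?_⟩
    · change SusyQM.lambdaQ _ (A.constantField 𝕜 x) + SusyQM.qForm 𝕜 N • 0 = 0
      rw [smul_zero, add_zero, lambdaQ_constantField, hx, map_zero]
    · change -(A.multiplet 𝕜).H.baseChange _ (A.constantField 𝕜 x) - SusyQM.lambdaQ _ 0 = 0
      rw [H_constantField, map_zero, neg_zero, sub_zero]
    · change x = A.evalZero 𝕜 (A.constantField 𝕜 x) +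
        A.lambdaEdge 𝕜 0 LinearMap.id (A.evalZero 𝕜 0) + A.lambdaEdge 𝕜 LinearMap.id 0 0
      rw [evalZero_constantField, map_zero, map_zero, map_zero, add_zero, add_zero]
  · rintro ⟨a, b⟩ (y : V → MvPolynomial (Fin N) 𝕜) hx hy
    have h2 : -(A.multiplet 𝕜).H.baseChange _ a - SusyQM.lambdaQ _ b = 0 := congrArg Prod.snd hx
    have h3 : A.evalZero 𝕜 a + A.lambdaEdge 𝕜 0 LinearMap.id (A.evalZero 𝕜 b) =
      A.lambdaEdge 𝕜 LinearMap.id 0 y := hy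
    set J := (A.fieldIntegral 𝕜 I).baseChange (MvPolynomial (Fin N) 𝕜) with hJ
    -- Integrating `H a + ∑ λ_i Q_i b = 0` gives `a + ∑ λ_i Q_i (J b)` as the constant field with
    -- value `a(0) + d† b(0)`, which is `d y` by assumption.
    have h4 := congrArg J h2
    rw [map_sub, map_neg, map_zero, A.fieldIntegral_H 𝕜 hI',
      A.fieldIntegral_lambdaQ 𝕜 hI hI'] at h4
    -- A primitive `c` without `v`-component must satisfy `b = -H c`, so it is `-J b` plus a
    -- constant field; the first component of the equation is met by the constant field of `y`.
    refine ⟨(A.constantField 𝕜 y - J b, 0), Prod.ext ?_ ?_⟩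
    · change a = SusyQM.lambdaQ _ (A.constantField 𝕜 y - J b) + SusyQM.qForm 𝕜 N • 0
      rw [map_sub, lambdaQ_constantField, ← h3, map_add, smul_zero, add_zero, ← sub_eq_zero,
        ← neg_eq_zero, ← h4]
      abel
    · change b = -(A.multiplet 𝕜).H.baseChange _ (A.constantField 𝕜 y - J b) - SusyQM.lambdaQ _ 0
      rw [map_sub, H_constantField, A.H_fieldIntegral 𝕜 hI, map_zero, sub_zero, zero_sub, neg_neg]

/-! ### Boundedness -/

theorem exists_abs_height_le : ∃ C : ℤ, ∀ v, |A.height v| ≤ C := by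
  have := Fintype.ofFinite V
  exact ⟨∑ v, |A.height v|, fun v =>
    Finset.single_le_sum (f := fun v => |A.height v|) (fun _ _ => abs_nonneg _)
      (Finset.mem_univ v)⟩

theorem isZero_complexC {C n : ℤ} (hC : ∀ v, |A.height v| ≤ C) (hn : C < |n|) :
    Limits.IsZero ((A.complexC 𝕜).complex.X n) := by
  have : Subsingleton (A.vertexGrade 𝕜 n) := by
    refine ⟨fun x y => Subtype.ext (funext fun v => ?_)⟩
    have : A.height v ≠ -n := by
      intro h
      have := hC v
      rw [h, abs_neg] at this
      omega
    rw [x.2 v this, y.2 v this]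
  exact ModuleCat.isZero_of_subsingleton (ModuleCat.of _ (A.vertexGrade 𝕜 n))

theorem bounded_complexC [HasDerivedCategory.{w} (ModuleCat.{max u v} (MvPolynomial (Fin N) 𝕜))] :
    DerivedCategory.TStructure.t.bounded
      (DerivedCategory.Q.obj (A.complexC 𝕜).complex) := by
  obtain ⟨C, hC⟩ := A.exists_abs_height_le
  constructor
  · refine ⟨-C, ?_⟩
    have : (A.complexC 𝕜).complex.IsGE (-C) := by
      rw [CochainComplex.isGE_iff]
      intro i hi
      rw [HomologicalComplex.exactAt_iff]
      exact ShortComplex.exact_of_isZero_X₂ _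
        (A.isZero_complexC 𝕜 hC (lt_abs.2 (Or.inr (by omega))))
    exact (DerivedCategory.isGE_Q_obj_iff _ _).2 this
  · refine ⟨C, ?_⟩
    have : (A.complexC 𝕜).complex.IsLE C := by
      rw [CochainComplex.isLE_iff]
      intro i hi
      rw [HomologicalComplex.exactAt_iff]
      exact ShortComplex.exact_of_isZero_X₂ _
        (A.isZero_complexC 𝕜 hC (lt_abs.2 (Or.inl (by omega))))
    exact (DerivedCategory.isLE_Q_obj_iff _ _).2 this

/-- The Chevalley–Eilenberg complex in general has non-zero terms in arbitrarily negative degrees,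
coming from the powers of `t`. Boundedness of its cohomology is transported from `C(A)` along the
quasi-isomorphism. -/
theorem bounded_iso_CE
    [HasDerivedCategory.{w} (ModuleCat.{max u v} (MvPolynomial (Fin N) 𝕜))] :
    ∃ (h₁ : DerivedCategory.TStructure.t.bounded
          (DerivedCategory.Q.obj (A.complexC 𝕜).complex))
        (h₂ : DerivedCategory.TStructure.t.bounded
          (DerivedCategory.Q.obj (SusyQM.CE (A.multiplet 𝕜)).complex)),
        Nonempty ((⟨_, h₁⟩ : DerivedCategory.TStructure.t.bounded.FullSubcategory) ≅ ⟨_, h₂⟩) := by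
  have := A.quasiIso_ceToComplexC 𝕜
  let e := (asIso (DerivedCategory.Q.map (A.ceToComplexC 𝕜).complexMap)).symm
  exact ⟨A.bounded_complexC 𝕜, ObjectProperty.prop_of_iso _ e (A.bounded_complexC 𝕜),
    ⟨ObjectProperty.isoMk _ e⟩⟩

end

end

end Adinkra

namespace SusyQM

noncomputable section

theorem zsmul_tmul' {K E F : Type*} [Field K] [AddCommGroup E] [Module K E] [AddCommGroup F]
    [Module K F] (n : ℤ) (x : E) (y : F) : (n • x) ⊗ₜ[K] y = (n : K) • (x ⊗ₜ[K] y) := by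
  rw [← Int.cast_smul_eq_zsmul K, TensorProduct.smul_tmul']

theorem tmul_zsmul' {K E F : Type*} [Field K] [AddCommGroup E] [Module K E] [AddCommGroup F]
    [Module K F] (n : ℤ) (x : E) (y : F) : x ⊗ₜ[K] (n • y) = (n : K) • (x ⊗ₜ[K] y) := by
  rw [← Int.cast_smul_eq_zsmul K, TensorProduct.tmul_smul]

/-! ### The exponential of `∑ θ_i q_i` -/

/-- Odd elements `θ_i`, `δ_i`, `q_i` and a central element `H` of a ring, with
`{δ_i, θ_j} = δ_ij`, `{q_i, q_j} = 2 δ_ij H` and all other supercommutators equal to zero. -/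
structure SuperRelations {ι 𝒜 : Type*} [Ring 𝒜] (θ δ q : ι → 𝒜) (H : 𝒜) : Prop where
  θ_θ : ∀ i j, θ i * θ j = -(θ j * θ i)
  θ_sq : ∀ i, θ i * θ i = 0
  δ_θ_self : ∀ i, δ i * θ i = 1 - θ i * δ i
  δ_θ : ∀ i j, i ≠ j → δ i * θ j = -(θ j * δ i)
  q_θ : ∀ i j, q i * θ j = -(θ j * q i)
  δ_q : ∀ i j, δ i * q j = -(q j * δ i)
  q_q : ∀ i j, i ≠ j → q i * q j = -(q j * q i)
  q_sq : ∀ i, q i * q i = H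
  H_θ : ∀ i, H * θ i = θ i * H
  H_q : ∀ i, H * q i = q i * H

/-- The product of the `1 + θ_i q_i`, that is, the exponential of `∑ θ_i q_i`. -/
def susyExp {ι 𝒜 : Type*} [Ring 𝒜] (θ q : ι → 𝒜) (l : List ι) : 𝒜 :=
  (l.map fun i => 1 + θ i * q i).prod

/-- An operator that anticommutes with both `θ_i` and `q_i` commutes with the product `θ_i q_i`.
This is applied to the total parity. -/
theorem mul_susyExp_comm {ι 𝒜 : Type*} [Ring 𝒜] {θ q : ι → 𝒜} {T : 𝒜}
    (hθ : ∀ i, T * θ i = -(θ i * T)) (hq : ∀ i, T * q i = -(q i * T))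
    (l : List ι) : T * susyExp θ q l = susyExp θ q l * T := by
  induction l with
  | nil => simp [susyExp]
  | cons j l ih =>
    have e : T * (1 + θ j * q j) = (1 + θ j * q j) * T := by
      rw [mul_add, add_mul, ← mul_assoc, hθ, neg_mul, mul_assoc, hq]
      noncomm_ring
    simp only [susyExp, List.map_cons, List.prod_cons] at ih ⊢
    rw [← mul_assoc, e, mul_assoc, ih, mul_assoc]

namespace SuperRelations

variable {ι 𝒜 : Type*} [Ring 𝒜] {θ δ q : ι → 𝒜} {H : 𝒜}

theorem θ_mul_susyExp (h : SuperRelations θ δ q H)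
    (i : ι) (l : List ι) : θ i * susyExp θ q l = susyExp θ q l * θ i := by
  induction l with
  | nil => simp [susyExp]
  | cons j l ih =>
    have e : θ i * (1 + θ j * q j) = (1 + θ j * q j) * θ i := by
      rw [mul_add, add_mul, ← mul_assoc, h.θ_θ, mul_assoc (θ j) (q j), h.q_θ]
      noncomm_ring
    simp only [susyExp, List.map_cons, List.prod_cons] at ih ⊢
    rw [← mul_assoc, e, mul_assoc, ih, mul_assoc]

theorem H_mul_susyExp (h : SuperRelations θ δ q H)
    (l : List ι) : H * susyExp θ q l = susyExp θ q l * H := by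
  induction l with
  | nil => simp [susyExp]
  | cons j l ih =>
    have e : H * (1 + θ j * q j) = (1 + θ j * q j) * H := by
      rw [mul_add, add_mul, ← mul_assoc, h.H_θ, mul_assoc (θ j) (q j), ← h.H_q]
      noncomm_ring
    simp only [susyExp, List.map_cons, List.prod_cons] at ih ⊢
    rw [← mul_assoc, e, mul_assoc, ih, mul_assoc]

theorem δ_comm (h : SuperRelations θ δ q H)
    {i j : ι} (hij : i ≠ j) : δ i * (1 + θ j * q j) = (1 + θ j * q j) * δ i := by
  rw [mul_add, add_mul, ← mul_assoc, h.δ_θ i j hij, neg_mul, mul_assoc, h.δ_q]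
  noncomm_ring

theorem q_comm (h : SuperRelations θ δ q H)
    {i j : ι} (hij : i ≠ j) : q i * (1 + θ j * q j) = (1 + θ j * q j) * q i := by
  rw [mul_add, add_mul, ← mul_assoc, h.q_θ i j, neg_mul, mul_assoc, h.q_q i j hij]
  noncomm_ring

/-- The term `-θ_i H` on the right compensates `θ_i q_i q_i = θ_i H`; the remaining product `θ_i q_i
θ_i H` vanishes since `θ_i² = 0`. -/
theorem δ_mul_self (h : SuperRelations θ δ q H) (i : ι) :
    δ i * (1 + θ i * q i) = (1 + θ i * q i) * (δ i + q i - θ i * H) := by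
  have e1 : δ i * (θ i * q i) = q i + θ i * q i * δ i := by
    rw [← mul_assoc, h.δ_θ_self, sub_mul, one_mul, mul_assoc, h.δ_q, mul_neg, sub_neg_eq_add,
      mul_assoc]
  have e2 : θ i * q i * q i = θ i * H := by rw [mul_assoc, h.q_sq]
  have e3 : θ i * q i * (θ i * H) = 0 := by
    rw [mul_assoc, ← mul_assoc (q i), h.q_θ, neg_mul, mul_neg, ← mul_assoc, ← mul_assoc, h.θ_sq]
    simp
  rw [mul_add, e1, add_mul, one_mul, mul_sub, mul_add, e2, e3]
  noncomm_ring

theorem q_mul_self (h : SuperRelations θ δ q H) (i : ι) :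
    q i * (1 + θ i * q i) = (1 + θ i * q i) * (q i - 2 * (θ i * H)) := by
  have e1 : q i * (θ i * q i) = -(θ i * H) := by
    rw [← mul_assoc, h.q_θ, neg_mul, mul_assoc, h.q_sq]
  have e2 : θ i * q i * q i = θ i * H := by rw [mul_assoc, h.q_sq]
  have e3 : θ i * q i * (θ i * H) = 0 := by
    rw [mul_assoc, ← mul_assoc (q i), h.q_θ, neg_mul, mul_neg, ← mul_assoc, ← mul_assoc, h.θ_sq]
    simp
  rw [mul_add, e1, add_mul, one_mul, mul_sub, e2, two_mul, mul_add, e3]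
  noncomm_ring

theorem δ_mul_susyExp_of_notMem (h : SuperRelations θ δ q H) {i : ι} {l : List ι} (hi : i ∉ l) :
    δ i * susyExp θ q l = susyExp θ q l * δ i := by
  induction l with
  | nil => simp [susyExp]
  | cons j l ih =>
    rw [List.mem_cons, not_or] at hi
    have ih := ih hi.2
    simp only [susyExp, List.map_cons, List.prod_cons] at ih ⊢
    rw [← mul_assoc, h.δ_comm hi.1, mul_assoc, ih, mul_assoc]

theorem q_mul_susyExp_of_notMem (h : SuperRelations θ δ q H) {i : ι} {l : List ι} (hi : i ∉ l) :
    q i * susyExp θ q l = susyExp θ q l * q i := by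
  induction l with
  | nil => simp [susyExp]
  | cons j l ih =>
    rw [List.mem_cons, not_or] at hi
    have ih := ih hi.2
    simp only [susyExp, List.map_cons, List.prod_cons] at ih ⊢
    rw [← mul_assoc, h.q_comm hi.1, mul_assoc, ih, mul_assoc]

theorem θH_mul_susyExp (h : SuperRelations θ δ q H) (i : ι) (l : List ι) :
    θ i * H * susyExp θ q l = susyExp θ q l * (θ i * H) := by
  rw [mul_assoc, h.H_mul_susyExp, ← mul_assoc, h.θ_mul_susyExp, mul_assoc]

/-- The factors with `j ≠ i` commute with `δ_i`, `q_i` and `θ_i H`. So only the factor of index `i`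
contributes, and `Nodup` ensures that there is just one. -/
theorem δ_mul_susyExp (h : SuperRelations θ δ q H)
    {i : ι} {l : List ι} (hl : l.Nodup) (hi : i ∈ l) :
    δ i * susyExp θ q l = susyExp θ q l * (δ i + q i - θ i * H) := by
  induction l with
  | nil => simp at hi
  | cons j l ih =>
    rw [List.nodup_cons] at hl
    by_cases hij : i = j
    · subst hij
      have h1 := h.δ_mul_susyExp_of_notMem hl.1
      have h2 := h.q_mul_susyExp_of_notMem hl.1
      have h3 := h.θH_mul_susyExp i l
      simp only [susyExp, List.map_cons, List.prod_cons] at h1 h2 h3 ⊢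
      rw [← mul_assoc, h.δ_mul_self, mul_assoc, sub_mul (δ i + q i), add_mul (δ i), h1, h2, h3]
      noncomm_ring
    · have ih := ih hl.2 ((List.mem_cons.1 hi).resolve_left hij)
      simp only [susyExp, List.map_cons, List.prod_cons] at ih ⊢
      rw [← mul_assoc, h.δ_comm hij, mul_assoc, ih, mul_assoc]

theorem q_mul_susyExp (h : SuperRelations θ δ q H)
    {i : ι} {l : List ι} (hl : l.Nodup) (hi : i ∈ l) :
    q i * susyExp θ q l = susyExp θ q l * (q i - 2 * (θ i * H)) := by
  induction l with
  | nil => simp at hi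
  | cons j l ih =>
    rw [List.nodup_cons] at hl
    by_cases hij : i = j
    · subst hij
      have h2 := h.q_mul_susyExp_of_notMem hl.1
      have h3 := h.θH_mul_susyExp i l
      simp only [susyExp, List.map_cons, List.prod_cons] at h2 h3 ⊢
      rw [← mul_assoc, h.q_mul_self, mul_assoc, sub_mul (q i), h2, mul_assoc 2, h3]
      noncomm_ring
    · have ih := ih hl.2 ((List.mem_cons.1 hi).resolve_left hij)
      simp only [susyExp, List.map_cons, List.prod_cons] at ih ⊢
      rw [← mul_assoc, h.q_comm hij, mul_assoc, ih, mul_assoc]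

/-- The left translation `δ_i + θ_i H` becomes `q_i` up to terms that annihilate constants. -/
theorem left_mul_susyExp (h : SuperRelations θ δ q H)
    {i : ι} {l : List ι} (hl : l.Nodup) (hi : i ∈ l) :
    (δ i + θ i * H) * susyExp θ q l = susyExp θ q l * (δ i + q i) := by
  rw [add_mul, h.δ_mul_susyExp hl hi, h.θH_mul_susyExp, ← mul_add, sub_add_cancel]

/-- The right translation `δ_i - θ_i H` becomes `q_i` up to terms that annihilate constants. -/
theorem right_mul_susyExp (h : SuperRelations θ δ q H)
    {i : ι} {l : List ι} (hl : l.Nodup) (hi : i ∈ l) :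
    (δ i - θ i * H) * susyExp θ q l = q i * susyExp θ q l + susyExp θ q l * δ i := by
  rw [sub_mul, h.δ_mul_susyExp hl hi, h.θH_mul_susyExp, h.q_mul_susyExp hl hi, ← mul_add,
    ← mul_sub]
  congr 1
  noncomm_ring

end SuperRelations

end

end SusyQM

/-! ### The morphism from the multiplet to its pure spinor complex -/

namespace Adinkra

noncomputable section

variable {N : ℕ} {V : Type v} (A : Adinkra N V) (𝕜 : Type u) [RCLike 𝕜]

/-- The differential of the pure spinor functor applied to `C(A)`. -/
def spinorD : SusyQM.Superfield 𝕜 N ⊗[𝕜] (V → MvPolynomial (Fin N) 𝕜) →ₗ[𝕜]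
    SusyQM.Superfield 𝕜 N ⊗[𝕜] (V → MvPolynomial (Fin N) 𝕜) :=
  ∑ i, TensorProduct.map (SusyQM.covD 𝕜 i) (Algebra.lsmul 𝕜 𝕜 (V → MvPolynomial (Fin N) 𝕜)
      (MvPolynomial.X i : MvPolynomial (Fin N) 𝕜)) +
    TensorProduct.map (SusyQM.superPar 𝕜 N) ((A.lambdaEdge 𝕜 LinearMap.id 0).restrictScalars 𝕜) +
    TensorProduct.map (SusyQM.superPar 𝕜 N ∘ₗ SusyQM.dTime 𝕜 N)
      ((A.lambdaEdge 𝕜 0 LinearMap.id).restrictScalars 𝕜)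

theorem spinorD_spinorD [Finite V]
    (z : SusyQM.Superfield 𝕜 N ⊗[𝕜] (V → MvPolynomial (Fin N) 𝕜)) :
    A.spinorD 𝕜 (A.spinorD 𝕜 z) = 0 :=
  (SusyQM.pureSpinor (A.complexC 𝕜)).d_d z

/-! ### Superfields on the vertices -/

/-- The operators `q_i` on superfields indexed by the vertices. -/
def spinQ (i : Fin N) : (V → SusyQM.Superfield 𝕜 N) →ₗ[𝕜] (V → SusyQM.Superfield 𝕜 N) :=
  A.edgeOp (SusyQM.superPar 𝕜 N) (SusyQM.superPar 𝕜 N ∘ₗ SusyQM.dTime 𝕜 N) i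

theorem compLeft_edgeOp {E : Type*} [AddCommGroup E] [Module 𝕜 E] {a b : E →ₗ[𝕜] E} (f : E →ₗ[𝕜] E)
    (ha : ∀ x, f (a x) = -a (f x)) (hb : ∀ x, f (b x) = -b (f x)) (i : Fin N) (x : V → E) :
    f.compLeft V (A.edgeOp a b i x) = -A.edgeOp a b i (f.compLeft V x) := by
  funext v
  simp only [LinearMap.compLeft_apply, Function.comp_apply, Pi.neg_apply, edgeOp_apply, map_zsmul]
  split_ifs <;> simp [ha, hb]

/-- The factor `superPar` in `q_i` makes it anticommute with `θ_j` and `∂_{θ_j}`; it disappears from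
`q_i²` because `superPar` is an involution commuting with `∂_t`. The relations among the `q_i` are
those of the Adinkra, from `edgeOp_edgeOp`. -/
theorem superRelations : SusyQM.SuperRelations (𝒜 := Module.End 𝕜 (V → SusyQM.Superfield 𝕜 N))
    (fun i => (SusyQM.mulTheta 𝕜 i).compLeft V) (fun i => (SusyQM.dTheta 𝕜 i).compLeft V)
    (A.spinQ 𝕜) ((SusyQM.dTime 𝕜 N).compLeft V) where
  θ_θ i j := LinearMap.ext fun x => funext fun v => SusyQM.mulTheta_mulTheta 𝕜 i j (x v)
  θ_sq i := LinearMap.ext fun x => funext fun v => by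
    have h : (2 : 𝕜) • SusyQM.mulTheta 𝕜 i (SusyQM.mulTheta 𝕜 i (x v)) = 0 := by
      rw [two_smul]
      nth_rw 1 [SusyQM.mulTheta_mulTheta]
      exact neg_add_cancel _
    exact (smul_eq_zero.1 h).resolve_left two_ne_zero
  δ_θ_self i := LinearMap.ext fun x => funext fun v => by
    simpa using SusyQM.dTheta_mulTheta 𝕜 i i (x v)
  δ_θ i j hij := LinearMap.ext fun x => funext fun v => by
    simpa [hij] using SusyQM.dTheta_mulTheta 𝕜 i j (x v)
  q_θ i j := by
    refine LinearMap.ext fun x => ?_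
    rw [eq_comm, LinearMap.neg_apply, neg_eq_iff_eq_neg]
    exact A.compLeft_edgeOp 𝕜 (SusyQM.mulTheta 𝕜 j)
      (fun x => by rw [SusyQM.superPar_mulTheta, neg_neg])
      (fun x => by simp only [LinearMap.comp_apply, ← SusyQM.mulTheta_dTime,
        SusyQM.superPar_mulTheta, neg_neg]) i x
  δ_q i j := by
    refine LinearMap.ext fun x => ?_
    exact A.compLeft_edgeOp 𝕜 (SusyQM.dTheta 𝕜 i)
      (fun x => by rw [SusyQM.superPar_dTheta, neg_neg])
      (fun x => by simp only [LinearMap.comp_apply, ← SusyQM.dTheta_dTime,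
        SusyQM.superPar_dTheta, neg_neg]) j x
  q_q i j hij := by
    refine LinearMap.ext fun x => funext fun v => ?_
    have := A.edgeOp_edgeOp (SusyQM.superPar 𝕜 N) (SusyQM.superPar 𝕜 N ∘ₗ SusyQM.dTime 𝕜 N)
      (fun x => by simp [SusyQM.superPar_dTime]) i j x v
    rw [if_neg hij] at this
    exact eq_neg_of_add_eq_zero_left this
  q_sq i := by
    refine LinearMap.ext fun x => funext fun v => ?_
    have := A.edgeOp_edgeOp (SusyQM.superPar 𝕜 N) (SusyQM.superPar 𝕜 N ∘ₗ SusyQM.dTime 𝕜 N)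
      (fun x => by simp [SusyQM.superPar_dTime]) i i x v
    rw [if_pos rfl, ← two_smul 𝕜] at this
    refine (smul_right_injective _ (two_ne_zero (α := 𝕜)) this).trans ?_
    exact SusyQM.superPar_superPar 𝕜 _
  H_θ i := LinearMap.ext fun x => funext fun v => (SusyQM.mulTheta_dTime 𝕜 i (x v)).symm
  H_q i := by
    refine LinearMap.ext fun x => funext fun v => ?_
    simp only [Module.End.mul_apply, LinearMap.compLeft_apply, Function.comp_apply, spinQ,
      edgeOp_apply, map_zsmul]
    split_ifs <;> simp [SusyQM.superPar_dTime]

/-- The product of the `1 + θ_i q_i`. -/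
def spinExp : Module.End 𝕜 (V → SusyQM.Superfield 𝕜 N) :=
  SusyQM.susyExp (fun i => (SusyQM.mulTheta 𝕜 i).compLeft V) (A.spinQ 𝕜) (List.finRange N)

/-- The multiplication by `(-1)^{|v|}`. -/
def spinSign : Module.End 𝕜 (V → SusyQM.Superfield 𝕜 N) :=
  LinearMap.pi fun v => A.parSign v • LinearMap.proj v

theorem spinSign_apply (x : V → SusyQM.Superfield 𝕜 N) (v : V) :
    A.spinSign 𝕜 x v = A.parSign v • x v := rfl

theorem spinSign_spinQ (i : Fin N) (x : V → SusyQM.Superfield 𝕜 N) :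
    A.spinSign 𝕜 (A.spinQ 𝕜 i x) = -A.spinQ 𝕜 i (A.spinSign 𝕜 x) := by
  funext v
  simp only [spinSign_apply, spinQ, edgeOp_apply, Pi.neg_apply, A.parSign_nbr, neg_smul, map_neg,
    map_zsmul, smul_neg, neg_neg]
  rw [smul_comm]

theorem spinSign_compLeft (f : SusyQM.Superfield 𝕜 N →ₗ[𝕜] SusyQM.Superfield 𝕜 N)
    (x : V → SusyQM.Superfield 𝕜 N) :
    A.spinSign 𝕜 (f.compLeft V x) = f.compLeft V (A.spinSign 𝕜 x) := by
  funext v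
  exact (map_zsmul f _ _).symm

/-- The total parity is the product of `superPar`, which anticommutes with `θ_i` and commutes with
`q_i`, and of `(-1)^{|v|}`, which does the opposite. It therefore anticommutes with both. -/
theorem spinPar_spinExp (x : V → SusyQM.Superfield 𝕜 N) :
    A.spinSign 𝕜 ((SusyQM.superPar 𝕜 N).compLeft V (A.spinExp 𝕜 x)) =
      A.spinExp 𝕜 (A.spinSign 𝕜 ((SusyQM.superPar 𝕜 N).compLeft V x)) := by
  refine LinearMap.congr_fun (SusyQM.mul_susyExp_comm
    (T := A.spinSign 𝕜 * (SusyQM.superPar 𝕜 N).compLeft V) (fun i => ?_) (fun i => ?_) _) x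
  · refine LinearMap.ext fun x => ?_
    have (y : V → SusyQM.Superfield 𝕜 N) :
        (SusyQM.superPar 𝕜 N).compLeft V ((SusyQM.mulTheta 𝕜 i).compLeft V y) =
          -(SusyQM.mulTheta 𝕜 i).compLeft V ((SusyQM.superPar 𝕜 N).compLeft V y) :=
      funext fun v => SusyQM.superPar_mulTheta 𝕜 i (y v)
    simp only [Module.End.mul_apply, LinearMap.neg_apply, this, map_neg, spinSign_compLeft]
  · refine LinearMap.ext fun x => ?_
    have (y : V → SusyQM.Superfield 𝕜 N) :
        (SusyQM.superPar 𝕜 N).compLeft V (A.spinQ 𝕜 i y) =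
          A.spinQ 𝕜 i ((SusyQM.superPar 𝕜 N).compLeft V y) := by
      funext v
      simp only [LinearMap.compLeft_apply, Function.comp_apply, spinQ, edgeOp_apply, map_zsmul]
      split_ifs <;> simp [SusyQM.superPar_dTime]
    simp only [Module.End.mul_apply, LinearMap.neg_apply, this, spinSign_spinQ]

theorem leftQ_spinExp (i : Fin N) {x : V → SusyQM.Superfield 𝕜 N}
    (hx : (SusyQM.dTheta 𝕜 i).compLeft V x = 0) :
    (SusyQM.leftQ 𝕜 i).compLeft V (A.spinExp 𝕜 x) = A.spinExp 𝕜 (A.spinQ 𝕜 i x) := by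
  have h := LinearMap.congr_fun ((A.superRelations 𝕜).left_mul_susyExp (List.nodup_finRange N)
    (List.mem_finRange i)) x
  refine Eq.trans ?_ (h.trans ?_)
  · rfl
  · simp only [Module.End.mul_apply, LinearMap.add_apply, hx, zero_add]
    rfl

theorem covD_spinExp (i : Fin N) {x : V → SusyQM.Superfield 𝕜 N}
    (hx : (SusyQM.dTheta 𝕜 i).compLeft V x = 0) :
    (SusyQM.covD 𝕜 i).compLeft V (A.spinExp 𝕜 x) = A.spinQ 𝕜 i (A.spinExp 𝕜 x) := by
  have h := LinearMap.congr_fun ((A.superRelations 𝕜).right_mul_susyExp (List.nodup_finRange N)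
    (List.mem_finRange i)) x
  refine Eq.trans ?_ (h.trans ?_)
  · rfl
  · simp only [Module.End.mul_apply, LinearMap.add_apply, hx, map_zero, add_zero]
    rfl

theorem dTime_spinExp (x : V → SusyQM.Superfield 𝕜 N) :
    (SusyQM.dTime 𝕜 N).compLeft V (A.spinExp 𝕜 x) =
      A.spinExp 𝕜 ((SusyQM.dTime 𝕜 N).compLeft V x) :=
  LinearMap.congr_fun ((A.superRelations 𝕜).H_mul_susyExp (List.finRange N)) x

/-- With the component at `v` shifted by `h(v)`, the operator `q_i` raises the degree by one and
`θ_i` lowers it by one, so each factor `1 + θ_i q_i` has degree `0`. -/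
theorem spinExp_mem {n : ℤ} {x : V → SusyQM.Superfield 𝕜 N}
    (hx : ∀ v, x v ∈ SusyQM.superGrade 𝕜 N (n + A.height v)) (v : V) :
    A.spinExp 𝕜 x v ∈ SusyQM.superGrade 𝕜 N (n + A.height v) := by
  rw [spinExp]
  generalize List.finRange N = l
  induction l generalizing v with
  | nil => exact hx v
  | cons i l ih =>
    rw [SusyQM.susyExp, List.map_cons, List.prod_cons]
    refine add_mem (ih v) ?_
    have h1 := ih (A.nbr v i)
    have h2 : A.spinQ 𝕜 i (SusyQM.susyExp (fun i => (SusyQM.mulTheta 𝕜 i).compLeft V)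
        (A.spinQ 𝕜) l x) v ∈ SusyQM.superGrade 𝕜 N (n + A.height v + 1) := by
      rw [spinQ, edgeOp_apply]
      refine (SusyQM.superGrade 𝕜 N _).toAddSubgroup.zsmul_mem ?_ _
      rcases A.height_nbr v i with h | h
      · rw [if_pos h, show n + A.height v + 1 = n + A.height (A.nbr v i) by rw [h]; ring]
        exact SusyQM.superPar_mem 𝕜 N _ _ h1
      · rw [if_neg (by omega), show n + A.height v + 1 = n + A.height (A.nbr v i) + 2 by
          rw [h]; ring]
        exact SusyQM.superPar_mem 𝕜 N _ _ (SusyQM.dTime_mem 𝕜 N _ _ h1)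
    have h3 := SusyQM.mulTheta_mem 𝕜 i _ _ h2
    rwa [add_sub_cancel_right] at h3

/-! ### The morphism from the multiplet -/

section

variable [Finite V]

/-- The fields as superfields that do not depend on the `θ_i`. -/
def spinConst : (A.multiplet 𝕜).carrier →ₗ[𝕜] (V → SusyQM.Superfield 𝕜 N) :=
  LinearMap.pi fun v => (TensorProduct.mk 𝕜 _ _).flip 1 ∘ₗ A.component 𝕜 v

theorem spinConst_apply (φ : (A.multiplet 𝕜).carrier) (v : V) :
    A.spinConst 𝕜 φ v = A.component 𝕜 v φ ⊗ₜ 1 := rfl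

theorem dTheta_spinConst (i : Fin N) (φ : (A.multiplet 𝕜).carrier) :
    (SusyQM.dTheta 𝕜 i).compLeft V (A.spinConst 𝕜 φ) = 0 := by
  funext v
  rw [LinearMap.compLeft_apply, Function.comp_apply, spinConst_apply, SusyQM.dTheta,
    LinearMap.lTensor_tmul]
  refine (congrArg (fun z => A.component 𝕜 v φ ⊗ₜ[𝕜] z) (CliffordAlgebra.contractLeft_one
    (Q := (0 : QuadraticForm 𝕜 (Fin N → 𝕜))) _)).trans ?_
  exact TensorProduct.tmul_zero _ _

theorem dTime_spinConst (φ : (A.multiplet 𝕜).carrier) :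
    (SusyQM.dTime 𝕜 N).compLeft V (A.spinConst 𝕜 φ) =
      A.spinConst 𝕜 ((A.multiplet 𝕜).H φ) := by
  funext v
  simp [spinConst_apply, SusyQM.dTime, component_H]

theorem superPar_tmul_one (f : Polynomial 𝕜) :
    SusyQM.superPar 𝕜 N (f ⊗ₜ 1) = f ⊗ₜ 1 := by
  simp [SusyQM.superPar]

theorem spinQ_spinConst (i : Fin N) (φ : (A.multiplet 𝕜).carrier) :
    A.spinQ 𝕜 i (A.spinConst 𝕜 φ) = A.spinConst 𝕜 ((A.multiplet 𝕜).Q i φ) := by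
  funext v
  have h (f : Polynomial 𝕜) : SusyQM.dTime 𝕜 N (f ⊗ₜ 1) = f.derivative ⊗ₜ 1 := by
    simp [SusyQM.dTime]
  rw [spinQ, edgeOp_apply, spinConst_apply, spinConst_apply, component_Q]
  rw [← Int.cast_smul_eq_zsmul 𝕜, ← Int.cast_smul_eq_zsmul 𝕜, ← TensorProduct.smul_tmul']
  split_ifs
  · rw [superPar_tmul_one]
  · rw [LinearMap.comp_apply, h, superPar_tmul_one]

theorem spinPar_spinConst (φ : (A.multiplet 𝕜).carrier) :
    A.spinSign 𝕜 ((SusyQM.superPar 𝕜 N).compLeft V (A.spinConst 𝕜 φ)) =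
      A.spinConst 𝕜 ((A.multiplet 𝕜).par φ) := by
  funext v
  rw [spinSign_apply, LinearMap.compLeft_apply, Function.comp_apply, spinConst_apply,
    superPar_tmul_one, spinConst_apply, component_par, ← Int.cast_smul_eq_zsmul 𝕜,
    ← Int.cast_smul_eq_zsmul 𝕜, TensorProduct.smul_tmul']

theorem spinConst_mem {n : ℤ} {φ : (A.multiplet 𝕜).carrier} (hφ : φ ∈ (A.multiplet 𝕜).grade n)
    (v : V) : A.spinConst 𝕜 φ v ∈ SusyQM.superGrade 𝕜 N (n + A.height v) :=
  Submodule.subset_span ⟨_, 0, add_zero _, _, (A.mem_multiplet_grade 𝕜).1 hφ v, 1,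
    Submodule.subset_span ⟨0, by simp, by simp⟩, rfl⟩

end

/-- `lambdaEdge` is defined on coefficient functions. On a basis vector it becomes a sum over the
edges at `u`, with the roles of the two ends exchanged, as in the usual formulas for `d(u)` and
`d†(u)`. -/
theorem lambdaEdge_single [DecidableEq V]
    (a b : MvPolynomial (Fin N) 𝕜 →ₗ[MvPolynomial (Fin N) 𝕜] MvPolynomial (Fin N) 𝕜) (u : V) :
    A.lambdaEdge 𝕜 a b (Pi.single u 1) = ∑ i, A.sign u i •
      Pi.single (A.nbr u i) (MvPolynomial.X i *
        (if A.height u = A.height (A.nbr u i) + 1 then a else b) 1) := by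
  funext v
  rw [lambdaEdge_apply, Finset.sum_apply]
  refine Finset.sum_congr rfl fun i _ => ?_
  by_cases h : v = A.nbr u i
  · subst h
    rw [A.nbr_nbr, A.sign_nbr, Pi.single_eq_same, Pi.smul_apply, Pi.single_eq_same, mul_smul_comm]
  · have h' : A.nbr v i ≠ u := by
      rintro rfl
      exact h (A.nbr_nbr v i).symm
    rw [Pi.single_eq_of_ne h', map_zero, smul_zero, mul_zero, Pi.smul_apply,
      Pi.single_eq_of_ne h, smul_zero]

theorem vertexPar_single [DecidableEq V] (v : V) : A.vertexPar 𝕜 (Pi.single v 1) = A.parSign v •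
    (Pi.single v 1 : V → MvPolynomial (Fin N) 𝕜) := by
  funext u
  rw [vertexPar_apply, Pi.smul_apply]
  by_cases h : u = v
  · subst h
    rw [Pi.single_eq_same, map_one]
  · rw [Pi.single_eq_of_ne h, map_zero, smul_zero, smul_zero]

theorem single_mem_vertexGrade [DecidableEq V] (v : V) (r : MvPolynomial (Fin N) 𝕜) :
    Pi.single v r ∈ A.vertexGrade 𝕜 (-A.height v) := by
  intro u hu
  refine Pi.single_eq_of_ne (M := fun _ => MvPolynomial (Fin N) 𝕜) ?_ r
  rintro rfl
  simp at hu

/-! ### Superfields with values in the free module on the vertices -/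

section

variable [Fintype V] [DecidableEq V]

/-- Superfields indexed by the vertices, with coefficients in the free module on the vertices. -/
def spinTotal : (V → SusyQM.Superfield 𝕜 N) →ₗ[𝕜]
    SusyQM.Superfield 𝕜 N ⊗[𝕜] (V → MvPolynomial (Fin N) 𝕜) :=
  ∑ v, (TensorProduct.mk 𝕜 _ _).flip (Pi.single v 1) ∘ₗ LinearMap.proj v

theorem spinTotal_apply (x : V → SusyQM.Superfield 𝕜 N) :
    spinTotal 𝕜 x = ∑ v, x v ⊗ₜ[𝕜] Pi.single v (1 : MvPolynomial (Fin N) 𝕜) := by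
  simp [spinTotal, LinearMap.sum_apply]

/-- The Koszul signs, and the `∂_t` that accompanies `d†`, are the ones built into `q_i`. The
actions of `d` and `d†` on basis vectors thus transfer to the action of the `q_i` on coefficients.
-/
theorem spinD_spinTotal (x : V → SusyQM.Superfield 𝕜 N) :
    A.spinorD 𝕜 (spinTotal 𝕜 x) = ∑ i, ∑ v, (SusyQM.covD 𝕜 i (x v) + A.spinQ 𝕜 i x v) ⊗ₜ
      Pi.single v (MvPolynomial.X i) := by
  -- Passing to the neighbor of color `i` is an involution of the vertices; reindexing by it
  -- exchanges the two ends of each edge.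
  have h1 (i : Fin N) : ∑ v, A.spinQ 𝕜 i x v ⊗ₜ[𝕜] Pi.single (M := fun _ => MvPolynomial (Fin N) 𝕜)
      v (MvPolynomial.X i) = ∑ u, (A.sign u i : 𝕜) • ((if A.height u = A.height (A.nbr u i) + 1 then
        SusyQM.superPar 𝕜 N else SusyQM.superPar 𝕜 N ∘ₗ SusyQM.dTime 𝕜 N) (x u) ⊗ₜ[𝕜]
          Pi.single (M := fun _ => MvPolynomial (Fin N) 𝕜) (A.nbr u i) (MvPolynomial.X i)) := by
    refine Finset.sum_bij' (fun v _ => A.nbr v i) (fun v _ => A.nbr v i) (by simp) (by simp)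
      (fun v _ => A.nbr_nbr v i) (fun v _ => A.nbr_nbr v i) fun v _ => ?_
    rw [spinQ, edgeOp_apply, A.nbr_nbr, A.sign_nbr]
    exact SusyQM.zsmul_tmul' _ _ _
  simp only [TensorProduct.add_tmul, Finset.sum_add_distrib, h1]
  simp only [← Finset.sum_add_distrib]
  rw [Finset.sum_comm, spinTotal_apply, map_sum]
  refine Finset.sum_congr rfl fun v _ => ?_
  rw [spinorD, LinearMap.add_apply, LinearMap.add_apply, LinearMap.sum_apply, add_assoc]
  simp only [TensorProduct.map_tmul, LinearMap.restrictScalars_apply, lambdaEdge_single,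
    TensorProduct.tmul_sum, ← Finset.sum_add_distrib]
  refine Finset.sum_congr rfl fun i _ => ?_
  congr 1
  · congr 1
    refine (Pi.single_smul (f := fun _ => MvPolynomial (Fin N) 𝕜) v (MvPolynomial.X i : MvPolynomial (Fin N) 𝕜)
      (1 : MvPolynomial (Fin N) 𝕜)).symm.trans ?_
    rw [smul_eq_mul, mul_one]
  · simp only [SusyQM.tmul_zsmul']
    split_ifs <;> simp

/-- The underlying map of the morphism `𝒱(A) → 𝒜(C(A))`. -/
def multipletMap : (A.multiplet 𝕜).carrier →ₗ[𝕜]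
    SusyQM.Superfield 𝕜 N ⊗[𝕜] (V → MvPolynomial (Fin N) 𝕜) :=
  spinTotal 𝕜 ∘ₗ A.spinSign 𝕜 ∘ₗ A.spinExp 𝕜 ∘ₗ A.spinConst 𝕜

theorem multipletMap_apply (φ : (A.multiplet 𝕜).carrier) : A.multipletMap 𝕜 φ =
    spinTotal 𝕜 (A.spinSign 𝕜 (A.spinExp 𝕜 (A.spinConst 𝕜 φ))) := rfl

/-- On the exponential of a `θ`-independent family, `D_i` acts as `q_i`. The sign `(-1)^{|v|}`
commutes with `D_i` and anticommutes with `q_i`, so `D_i + q_i` vanishes after it. -/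
theorem spinorD_multipletMap (φ : (A.multiplet 𝕜).carrier) :
    A.spinorD 𝕜 (A.multipletMap 𝕜 φ) = 0 := by
  rw [multipletMap_apply, spinD_spinTotal]
  refine Finset.sum_eq_zero fun i _ => Finset.sum_eq_zero fun v _ => ?_
  have h := congrArg (A.spinSign 𝕜) (A.covD_spinExp 𝕜 i (A.dTheta_spinConst 𝕜 i φ))
  rw [spinSign_compLeft, spinSign_spinQ] at h
  have h' := congrFun h v
  rw [LinearMap.compLeft_apply, Function.comp_apply, Pi.neg_apply] at h'
  rw [h', neg_add_cancel, TensorProduct.zero_tmul]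

theorem rTensor_spinTotal (f : SusyQM.Superfield 𝕜 N →ₗ[𝕜] SusyQM.Superfield 𝕜 N)
    (x : V → SusyQM.Superfield 𝕜 N) :
    f.rTensor (V → MvPolynomial (Fin N) 𝕜) (spinTotal 𝕜 x) = spinTotal 𝕜 (f.compLeft V x) := by
  simp [spinTotal_apply]

theorem spinTotal_mem {n : ℤ} {x : V → SusyQM.Superfield 𝕜 N}
    (hx : ∀ v, x v ∈ SusyQM.superGrade 𝕜 N (n + A.height v)) :
    spinTotal 𝕜 x ∈ SusyQM.tensorGrade (SusyQM.superGrade 𝕜 N)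
      (fun n => (A.vertexGrade 𝕜 n).restrictScalars 𝕜) n := by
  rw [spinTotal_apply]
  exact Submodule.sum_mem _ fun v _ => Submodule.subset_span
    ⟨_, -A.height v, by ring, _, hx v, _, A.single_mem_vertexGrade 𝕜 v 1, rfl⟩

theorem multipletMap_par (φ : (A.multiplet 𝕜).carrier) :
    A.multipletMap 𝕜 ((A.multiplet 𝕜).par φ) =
      TensorProduct.map (SusyQM.superPar 𝕜 N) (A.vertexPar 𝕜) (A.multipletMap 𝕜 φ) := by
  rw [multipletMap_apply, multipletMap_apply, ← spinPar_spinConst, ← spinPar_spinExp,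
    spinSign_compLeft, spinTotal_apply, spinTotal_apply, map_sum]
  refine Finset.sum_congr rfl fun v _ => ?_
  rw [TensorProduct.map_tmul, vertexPar_single, SusyQM.tmul_zsmul', ← SusyQM.zsmul_tmul']
  rfl

theorem multipletMap_Q (i : Fin N) (φ : (A.multiplet 𝕜).carrier) :
    A.multipletMap 𝕜 ((A.multiplet 𝕜).Q i φ) =
      (SusyQM.leftQ 𝕜 i).rTensor _ (A.multipletMap 𝕜 φ) := by
  rw [multipletMap_apply, multipletMap_apply, rTensor_spinTotal, ← spinSign_compLeft,
    leftQ_spinExp _ _ _ (A.dTheta_spinConst 𝕜 i φ), spinQ_spinConst]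

theorem multipletMap_H (φ : (A.multiplet 𝕜).carrier) :
    A.multipletMap 𝕜 ((A.multiplet 𝕜).H φ) =
      (SusyQM.dTime 𝕜 N).rTensor _ (A.multipletMap 𝕜 φ) := by
  rw [multipletMap_apply, multipletMap_apply, rTensor_spinTotal, ← spinSign_compLeft,
    dTime_spinExp, dTime_spinConst]

/-- The morphism `𝒱(A) → 𝒜(C(A))` that sends a field `φ` to the superfield with components
`± exp(∑ θ_i q_i) φ`. -/
def multipletHom : (A.multiplet 𝕜).toDG.Hom (SusyQM.pureSpinor (A.complexC 𝕜)) where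
  toFun := A.multipletMap 𝕜
  map_grade _ _ hφ := A.spinTotal_mem 𝕜 fun v =>
    (SusyQM.superGrade 𝕜 N _).toAddSubgroup.zsmul_mem
      (A.spinExp_mem 𝕜 (A.spinConst_mem 𝕜 hφ) v) _
  map_par := A.multipletMap_par 𝕜
  map_d φ := (map_zero (A.multipletMap 𝕜)).trans (A.spinorD_multipletMap 𝕜 φ).symm
  map_Q := A.multipletMap_Q 𝕜
  map_H := A.multipletMap_H 𝕜

end

end

end Adinkra

/-! ### Perturbation along a filtration, and degrees of `t` and `θ` -/

namespace SusyQM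

noncomputable section

variable {𝕜 : Type u} [RCLike 𝕜] {N : ℕ}

/-- `T K` is a contracting homotopy of `D₀` on `Z`, so on a closed element it is also one for `D` up
to terms containing `P`, which lower the filtration. Iterating the correction ends after `k` steps,
since `F (-C)` is zero. -/
theorem exists_eq_of_filtration {E : Type*} [AddCommGroup E] [Module 𝕜 E]
    {D D₀ P K T : Module.End 𝕜 E} {F : ℤ → Submodule 𝕜 E} {Z : Submodule 𝕜 E}
    (hD : ∀ y, D y = D₀ y + P y) (hDD : ∀ y, D (D y) = 0) (hT : ∀ y, D₀ (T y) = T (D₀ y))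
    (hTZ : ∀ z ∈ Z, T (D₀ (K z) + K (D₀ z)) = z) (hDZ : ∀ y, D y ∈ Z)
    (hTF : ∀ n, ∀ z ∈ F n, T z ∈ F n) (hKF : ∀ n, ∀ z ∈ F n, K z ∈ F n)
    (hPF : ∀ n, ∀ z ∈ F n, P z ∈ F (n - 1)) {C : ℤ} (hC : ∀ z ∈ F (-C), z = 0) (k : ℕ) {z : E}
    (hz : z ∈ F (-C + k)) (hDz : D z = 0) (hzZ : z ∈ Z) : ∃ y, z = D y := by
  induction k generalizing z with
  | zero => exact ⟨0, by rw [hC z (by simpa using hz), map_zero]⟩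
  | succ k ih =>
    -- Closedness means `D₀ z = -P z`. Together with `T D₀ = D₀ T` this turns `T (D₀ K + K D₀) z =
    -- z` into `z = D₀ (T (K z)) - T (K (P z))`.
    have e : z - D (T (K z)) = -(P (T (K z)) + T (K (P z))) := by
      have h1 : D₀ z = -P z := eq_neg_of_add_eq_zero_left ((hD z).symm.trans hDz)
      have h2 := hTZ z hzZ
      rw [h1, map_add, map_neg, map_neg, ← hT] at h2
      rw [hD]
      nth_rw 1 [← h2]
      abel
    obtain ⟨y, hy⟩ := ih (z := z - D (T (K z))) (by
      rw [e]
      have h3 := hPF _ _ (hTF _ _ (hKF _ _ hz))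
      have h4 := hTF _ _ (hKF _ _ (hPF _ _ hz))
      rw [show -C + ((k + 1 : ℕ) : ℤ) - 1 = -C + k by push_cast; ring] at h3 h4
      exact neg_mem (add_mem h3 h4)) (by rw [map_sub, hDz, hDD, sub_zero])
      (sub_mem hzZ (hDZ _))
    exact ⟨y + T (K z), by rw [map_add, ← hy, sub_add_cancel]⟩

theorem eq_zero_of_mem_timeGrade {n : ℤ} (hn : 0 < n) {f : Polynomial 𝕜}
    (hf : f ∈ timeGrade 𝕜 n) : f = 0 := by
  induction hf using Submodule.span_induction with
  | mem f hf =>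
    obtain ⟨k, rfl, rfl⟩ := hf
    omega
  | zero => rfl
  | add f g _ _ hf hg => rw [hf, hg, add_zero]
  | smul c f _ hf => rw [hf, smul_zero]

theorem eq_zero_of_mem_thetaGrade {n : ℤ} (hn : 0 < n) {x : ExteriorAlgebra 𝕜 (Fin N → 𝕜)}
    (hx : x ∈ thetaGrade 𝕜 N n) : x = 0 := by
  induction hx using Submodule.span_induction with
  | mem x hx =>
    obtain ⟨k, rfl, hx⟩ := hx
    omega
  | zero => rfl
  | add f g _ _ hf hg => rw [hf, hg, add_zero]
  | smul c f _ hf => rw [hf, smul_zero]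

theorem exists_algebraMap_of_mem_thetaGrade {x : ExteriorAlgebra 𝕜 (Fin N → 𝕜)}
    (hx : x ∈ thetaGrade 𝕜 N 0) : ∃ c : 𝕜, x = algebraMap 𝕜 _ c := by
  induction hx using Submodule.span_induction with
  | mem x hx =>
    obtain ⟨k, hk, hx⟩ := hx
    obtain rfl : k = 0 := by omega
    rw [ExteriorAlgebra.exteriorPower, pow_zero, Submodule.mem_one] at hx
    obtain ⟨c, hc⟩ := hx
    exact ⟨c, hc.symm⟩
  | zero => exact ⟨0, by simp⟩
  | add f g _ _ hf hg =>
    obtain ⟨a, rfl⟩ := hf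
    obtain ⟨b, rfl⟩ := hg
    exact ⟨a + b, by simp⟩
  | smul c f _ hf =>
    obtain ⟨a, rfl⟩ := hf
    exact ⟨c * a, by rw [map_mul, Algebra.smul_def]⟩

theorem algebraMapInv_of_mem_thetaGrade {n : ℤ} (hn : n ≠ 0) {x : ExteriorAlgebra 𝕜 (Fin N → 𝕜)}
    (hx : x ∈ thetaGrade 𝕜 N n) : ExteriorAlgebra.algebraMapInv x = 0 := by
  induction hx using Submodule.span_induction with
  | mem x hx =>
    obtain ⟨k, rfl, hx⟩ := hx
    cases k with
    | zero => simp at hn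
    | succ k =>
      rw [ExteriorAlgebra.exteriorPower, pow_succ'] at hx
      induction hx using Submodule.mul_induction_on' with
      | mem_mul_mem a ha b hb =>
        obtain ⟨a, rfl⟩ := ha
        rw [map_mul, ExteriorAlgebra.algebraMapInv, ExteriorAlgebra.lift_ι_apply]
        simp
      | add a _ b _ ha hb => rw [map_add, ha, hb, add_zero]
  | zero => simp
  | add f g _ _ hf hg => rw [map_add, hf, hg, add_zero]
  | smul c f _ hf => rw [map_smul, hf, smul_zero]

/-- Euler's formula for exterior powers. -/
theorem sum_iota_mul_contractLeft {n : ℤ} {x : ExteriorAlgebra 𝕜 (Fin N → 𝕜)}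
    (hx : x ∈ thetaGrade 𝕜 N n) :
    ∑ i, ExteriorAlgebra.ι 𝕜 (Pi.single i (1 : 𝕜)) * CliffordAlgebra.contractLeft
      (Q := (0 : QuadraticForm 𝕜 (Fin N → 𝕜))) (LinearMap.proj i) x = (-n : 𝕜) • x := by
  induction hx using Submodule.span_induction with
  | mem x hx =>
    obtain ⟨k, rfl, hx⟩ := hx
    rw [Int.cast_neg, neg_neg, Int.cast_natCast]
    induction hx using Submodule.pow_induction_on_left' with
    | algebraMap r =>
      rw [Nat.cast_zero, zero_smul]
      refine Finset.sum_eq_zero fun i _ => ?_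
      rw [CliffordAlgebra.contractLeft_algebraMap, mul_zero]
    | add x y i _ _ hx hy =>
      simp only [map_add, mul_add, Finset.sum_add_distrib, hx, hy, smul_add]
    | mem_mul m hm i x hx hx' =>
      obtain ⟨a, rfl⟩ := hm
      have e (j : Fin N) : CliffordAlgebra.contractLeft
          (Q := (0 : QuadraticForm 𝕜 (Fin N → 𝕜))) (LinearMap.proj j)
            (ExteriorAlgebra.ι 𝕜 a * x) = a j • x - ExteriorAlgebra.ι 𝕜 a *
              CliffordAlgebra.contractLeft (Q := (0 : QuadraticForm 𝕜 (Fin N → 𝕜)))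
                (LinearMap.proj j) x :=
        CliffordAlgebra.contractLeft_ι_mul (Q := (0 : QuadraticForm 𝕜 (Fin N → 𝕜)))
          (d := LinearMap.proj j) a x
      have e' (j : Fin N) : ExteriorAlgebra.ι 𝕜 (Pi.single j (1 : 𝕜)) *
          ExteriorAlgebra.ι 𝕜 a = -(ExteriorAlgebra.ι 𝕜 a *
            ExteriorAlgebra.ι 𝕜 (Pi.single j (1 : 𝕜))) :=
        eq_neg_of_add_eq_zero_left (ExteriorAlgebra.ι_add_mul_swap (R := 𝕜) _ _)
      have e2 : ExteriorAlgebra.ι 𝕜 a =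
          ∑ j, a j • ExteriorAlgebra.ι 𝕜 (Pi.single j (1 : 𝕜) : Fin N → 𝕜) := by
        simp only [← map_smul, ← map_sum]
        congr 1
        exact pi_eq_sum_univ' a
      -- Contraction is an antiderivation. The terms `a j • x` add up to `ι a * x`, by the expansion
      -- of `a` in the standard basis; the others are `ι a` times the sum for `x`.
      simp only [e, mul_sub, ← mul_assoc, e', neg_mul, sub_neg_eq_add, mul_smul_comm,
        Finset.sum_add_distrib]
      simp only [mul_assoc, ← Finset.mul_sum, hx']
      simp only [← smul_mul_assoc, ← Finset.sum_mul, ← e2]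
      rw [Nat.cast_succ, add_smul, one_smul, add_mul, smul_mul_assoc,
        add_comm, mul_smul_comm]
  | zero => simp
  | add x y _ _ hx hy => simp only [map_add, mul_add, Finset.sum_add_distrib, hx, hy, smul_add]
  | smul r x _ hx => simp only [map_smul, mul_smul_comm, ← Finset.smul_sum, hx, smul_comm r]

end

end SusyQM

namespace Adinkra

noncomputable section

variable {N : ℕ} {V : Type v} (A : Adinkra N V) (𝕜 : Type u) [RCLike 𝕜]

/-! ### The Koszul contraction -/

/-- The Koszul differential `∑ ∂/∂θ_i ⊗ λ_i`. -/
def koszulD : Module.End 𝕜 (SusyQM.Superfield 𝕜 N ⊗[𝕜] (V → MvPolynomial (Fin N) 𝕜)) :=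
  ∑ i, TensorProduct.map (SusyQM.dTheta 𝕜 i) (Algebra.lsmul 𝕜 𝕜 (V → MvPolynomial (Fin N) 𝕜)
    (MvPolynomial.X i : MvPolynomial (Fin N) 𝕜))

/-- The operator `∑ θ_i ⊗ ∂/∂λ_i`. -/
def koszulK : Module.End 𝕜 (SusyQM.Superfield 𝕜 N ⊗[𝕜] (V → MvPolynomial (Fin N) 𝕜)) :=
  ∑ i, TensorProduct.map (SusyQM.mulTheta 𝕜 i)
    ((MvPolynomial.pderiv (R := 𝕜) i).toLinearMap.compLeft V)

/-- The operator that counts the `θ_i` and the `λ_i`. -/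
def koszulW : Module.End 𝕜 (SusyQM.Superfield 𝕜 N ⊗[𝕜] (V → MvPolynomial (Fin N) 𝕜)) :=
  koszulD 𝕜 * koszulK 𝕜 + koszulK 𝕜 * koszulD 𝕜

theorem koszulD_tmul (F : SusyQM.Superfield 𝕜 N) (x : V → MvPolynomial (Fin N) 𝕜) :
    koszulD 𝕜 (F ⊗ₜ x) = ∑ i, SusyQM.dTheta 𝕜 i F ⊗ₜ
      ((MvPolynomial.X i : MvPolynomial (Fin N) 𝕜) • x) := by
  simp [koszulD, LinearMap.sum_apply]

theorem koszulK_tmul (F : SusyQM.Superfield 𝕜 N) (x : V → MvPolynomial (Fin N) 𝕜) :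
    koszulK 𝕜 (F ⊗ₜ x) = ∑ i, SusyQM.mulTheta 𝕜 i F ⊗ₜ fun v => MvPolynomial.pderiv i (x v) := by
  simp only [koszulK, LinearMap.sum_apply, TensorProduct.map_tmul]
  rfl

theorem koszulD_koszulD (z : SusyQM.Superfield 𝕜 N ⊗[𝕜] (V → MvPolynomial (Fin N) 𝕜)) :
    koszulD 𝕜 (koszulD 𝕜 z) = 0 := by
  induction z using TensorProduct.induction_on with
  | zero => simp
  | add a b ha hb => rw [map_add, map_add, ha, hb, add_zero]
  | tmul F x =>
    have e : koszulD 𝕜 (koszulD 𝕜 (F ⊗ₜ x)) = ∑ i, ∑ j,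
        SusyQM.dTheta 𝕜 j (SusyQM.dTheta 𝕜 i F) ⊗ₜ[𝕜] ((MvPolynomial.X j :
          MvPolynomial (Fin N) 𝕜) • (MvPolynomial.X i : MvPolynomial (Fin N) 𝕜) • x) := by
      simp only [koszulD_tmul, map_sum]
    have h2 : (2 : 𝕜) • koszulD 𝕜 (koszulD 𝕜 (F ⊗ₜ x)) = 0 := by
      rw [two_smul]
      nth_rw 1 [e]
      rw [Finset.sum_comm, e, ← Finset.sum_add_distrib]
      refine Finset.sum_eq_zero fun i _ => ?_
      rw [← Finset.sum_add_distrib]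
      refine Finset.sum_eq_zero fun j _ => ?_
      rw [SusyQM.dTheta_dTheta, smul_comm, ← TensorProduct.add_tmul, neg_add_cancel,
        TensorProduct.zero_tmul]
    exact (smul_eq_zero.1 h2).resolve_left two_ne_zero

/-- Both products reduce to `D₀ K D₀`, because `D₀² = 0`. -/
theorem commute_koszulD_koszulW : Commute (koszulD 𝕜 : Module.End 𝕜
    (SusyQM.Superfield 𝕜 N ⊗[𝕜] (V → MvPolynomial (Fin N) 𝕜))) (koszulW 𝕜) := by
  have h : (koszulD 𝕜 : Module.End 𝕜
    (SusyQM.Superfield 𝕜 N ⊗[𝕜] (V → MvPolynomial (Fin N) 𝕜))) * koszulD 𝕜 = 0 :=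
      LinearMap.ext (koszulD_koszulD 𝕜)
  rw [commute_iff_eq, koszulW, mul_add, add_mul, ← mul_assoc, h, zero_mul, zero_add,
    mul_assoc (koszulK 𝕜), h, mul_zero, add_zero, mul_assoc]

/-- Terms with two different indices cancel, since `∂_{θ_j}` and `θ_i` anticommute while `∂_{λ_i}`
and `λ_j` commute. For equal indices, `∂_θ θ = 1 - θ ∂_θ` and `∂_λ λ = 1 + λ ∂_λ` leave `θ ∂_θ + λ
∂_λ`. -/
theorem koszulW_tmul (F : SusyQM.Superfield 𝕜 N) (x : V → MvPolynomial (Fin N) 𝕜) :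
    koszulW 𝕜 (F ⊗ₜ x) = (∑ i, SusyQM.mulTheta 𝕜 i (SusyQM.dTheta 𝕜 i F)) ⊗ₜ x +
      F ⊗ₜ fun v => ∑ i, MvPolynomial.X i * MvPolynomial.pderiv i (x v) := by
  have e : (fun v => ∑ i, MvPolynomial.X i * MvPolynomial.pderiv i (x v)) =
      ∑ i, (MvPolynomial.X i : MvPolynomial (Fin N) 𝕜) • fun v => MvPolynomial.pderiv i (x v) := by
    funext v
    simp
  rw [koszulW, LinearMap.add_apply, Module.End.mul_apply, Module.End.mul_apply, koszulD_tmul,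
    koszulK_tmul, map_sum, map_sum, e, TensorProduct.sum_tmul, TensorProduct.tmul_sum]
  simp only [koszulD_tmul, koszulK_tmul]
  rw [Finset.sum_comm, ← Finset.sum_add_distrib, ← Finset.sum_add_distrib]
  refine Finset.sum_congr rfl fun i _ => ?_
  rw [← Finset.sum_add_distrib, Finset.sum_eq_single i]
  · have e2 : (fun v => MvPolynomial.pderiv i
        (((MvPolynomial.X i : MvPolynomial (Fin N) 𝕜) • x) v)) = x +
          (MvPolynomial.X i : MvPolynomial (Fin N) 𝕜) • fun v => MvPolynomial.pderiv i (x v) := by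
      funext v
      simp [Derivation.leibniz, add_comm]
    rw [SusyQM.dTheta_mulTheta, if_pos rfl, e2, TensorProduct.tmul_add, TensorProduct.sub_tmul]
    abel
  · intro j _ hj
    have e2 : (fun v => MvPolynomial.pderiv j
        (((MvPolynomial.X i : MvPolynomial (Fin N) 𝕜) • x) v)) =
          (MvPolynomial.X i : MvPolynomial (Fin N) 𝕜) • fun v => MvPolynomial.pderiv j (x v) := by
      funext v
      simp [Derivation.leibniz, MvPolynomial.pderiv_X_of_ne hj.symm]
    rw [SusyQM.dTheta_mulTheta, if_neg hj.symm, e2, zero_sub, ← TensorProduct.add_tmul,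
      neg_add_cancel, TensorProduct.zero_tmul]
  · simp

/-! ### A filtration of the pure spinor complex -/

/-- The products of `f ∈ 𝕜[t]` of degree `s`, `ω ∈ Λ(θ)` of degree `j` and `x ∈ C(A)` of degree `m`
with components homogeneous of degree `q`, where `-s - m < n`. -/
structure IsSimple (n j : ℤ) (q : ℕ)
    (z : SusyQM.Superfield 𝕜 N ⊗[𝕜] (V → MvPolynomial (Fin N) 𝕜)) : Prop where
  exists_eq : ∃ (s m : ℤ) (f : Polynomial 𝕜) (ω : ExteriorAlgebra 𝕜 (Fin N → 𝕜))
    (x : V → MvPolynomial (Fin N) 𝕜), f ∈ SusyQM.timeGrade 𝕜 s ∧ ω ∈ SusyQM.thetaGrade 𝕜 N j ∧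
      x ∈ A.vertexGrade 𝕜 m ∧ (∀ v, (x v).IsHomogeneous q) ∧ -s - m < n ∧ z = (f ⊗ₜ ω) ⊗ₜ x

/-- The filtration of the pure spinor complex by twice the degree in `t` plus the height. -/
def filtration (n : ℤ) :
    Submodule 𝕜 (SusyQM.Superfield 𝕜 N ⊗[𝕜] (V → MvPolynomial (Fin N) 𝕜)) :=
  Submodule.span 𝕜 {z | ∃ j q, A.IsSimple 𝕜 n j q z}

variable {𝕜} in
theorem tmul_mem_filtration {s m j n : ℤ} {q : ℕ} {f : Polynomial 𝕜}
    {ω : ExteriorAlgebra 𝕜 (Fin N → 𝕜)} {x : V → MvPolynomial (Fin N) 𝕜}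
    (hf : f ∈ SusyQM.timeGrade 𝕜 s) (hω : ω ∈ SusyQM.thetaGrade 𝕜 N j)
    (hx : x ∈ A.vertexGrade 𝕜 m) (hq : ∀ v, (x v).IsHomogeneous q) (hn : -s - m < n) :
    (f ⊗ₜ ω) ⊗ₜ x ∈ A.filtration 𝕜 n :=
  Submodule.subset_span ⟨j, q, ⟨s, m, f, ω, x, hf, hω, hx, hq, hn, rfl⟩⟩

theorem filtration_mono : Monotone (A.filtration 𝕜) := by
  intro n n' h
  refine Submodule.span_mono ?_
  rintro z ⟨j, q, ⟨s, m, f, ω, x, hf, hω, hx, hq, hn, rfl⟩⟩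
  exact ⟨j, q, ⟨s, m, f, ω, x, hf, hω, hx, hq, by omega, rfl⟩⟩

theorem map_filtration_le {T : Module.End 𝕜 (SusyQM.Superfield 𝕜 N ⊗[𝕜] (V → MvPolynomial (Fin N) 𝕜))}
    {n n' : ℤ} (h : ∀ j q z, A.IsSimple 𝕜 n j q z → T z ∈ A.filtration 𝕜 n')
    {z} (hz : z ∈ A.filtration 𝕜 n) : T z ∈ A.filtration 𝕜 n' := by
  have : A.filtration 𝕜 n ≤ (A.filtration 𝕜 n').comap T := by
    refine Submodule.span_le.2 ?_
    rintro z ⟨j, q, hz⟩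
    exact h j q z hz
  exact this hz

theorem exists_mem_filtration [Finite V]
    (z : SusyQM.Superfield 𝕜 N ⊗[𝕜] (V → MvPolynomial (Fin N) 𝕜)) :
    ∃ n, z ∈ A.filtration 𝕜 n := by
  classical
  have := Fintype.ofFinite V
  -- The filtration increases, so its supremum is a union; it is enough to decompose `z` into
  -- homogeneous products.
  suffices h : z ∈ ⨆ n, A.filtration 𝕜 n from
    (Submodule.mem_iSup_of_directed _ (A.filtration_mono 𝕜).directed_le).1 h
  have key (f : Polynomial 𝕜) (ω : ExteriorAlgebra 𝕜 (Fin N → 𝕜))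
      (x : V → MvPolynomial (Fin N) 𝕜) : (f ⊗ₜ[𝕜] ω) ⊗ₜ[𝕜] x ∈ ⨆ n, A.filtration 𝕜 n := by
    have h1 : f ∈ ⨆ n, SusyQM.timeGrade 𝕜 n := by
      rw [(SusyQM.timeGrade_internal 𝕜).submodule_iSup_eq_top]; trivial
    have h2 : ω ∈ ⨆ n, SusyQM.thetaGrade 𝕜 N n := by
      rw [(SusyQM.thetaGrade_internal 𝕜 N).submodule_iSup_eq_top]; trivial
    rw [← Finset.univ_sum_single x, TensorProduct.tmul_sum]
    refine Submodule.sum_mem _ fun v _ => ?_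
    have h3 : (Pi.single v (x v) : V → MvPolynomial (Fin N) 𝕜) =
        ∑ q ∈ Finset.range ((x v).totalDegree + 1),
          Pi.single v (MvPolynomial.homogeneousComponent q (x v)) := by
      conv_lhs => rw [← MvPolynomial.sum_homogeneousComponent (x v)]
      exact map_sum (LinearMap.single 𝕜 (fun _ : V => MvPolynomial (Fin N) 𝕜) v) _ _
    rw [h3, TensorProduct.tmul_sum]
    refine Submodule.sum_mem _ fun q _ => ?_
    induction h1 using Submodule.iSup_induction' with
    | zero => simp
    | add f g _ _ hf hg => rw [TensorProduct.add_tmul, TensorProduct.add_tmul]; exact add_mem hf hg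
    | mem s f hf =>
      induction h2 using Submodule.iSup_induction' with
      | zero => simp
      | add f g _ _ hf hg =>
        rw [TensorProduct.tmul_add, TensorProduct.add_tmul]; exact add_mem hf hg
      | mem j ω hω =>
        -- The bound in `IsSimple` is strict, hence the `+ 1`.
        refine Submodule.mem_iSup_of_mem (-s - -A.height v + 1) (A.tmul_mem_filtration hf hω
          (A.single_mem_vertexGrade 𝕜 v _) (q := q) (fun u => ?_) (by omega))
        by_cases hu : u = v
        · subst hu
          rw [Pi.single_eq_same]
          exact MvPolynomial.homogeneousComponent_isHomogeneous _ _
        · rw [Pi.single_eq_of_ne hu]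
          exact MvPolynomial.isHomogeneous_zero _ _ _
  induction z using TensorProduct.induction_on with
  | zero => simp
  | add a b ha hb => exact add_mem ha hb
  | tmul F x =>
    induction F using TensorProduct.induction_on with
    | zero => simp
    | add a b ha hb => rw [TensorProduct.add_tmul]; exact add_mem ha hb
    | tmul f ω => exact key f ω x

/-- In a non-zero product, `-s` is twice a power of `t`, hence non-negative, and `-m` is the height
of some vertex, hence at least `-C`. This contradicts `-s - m < n ≤ -C`. -/
theorem filtration_eq_bot {C n : ℤ} (hC : ∀ v, |A.height v| ≤ C) (hn : n ≤ -C)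
    {z} (hz : z ∈ A.filtration 𝕜 n) : z = 0 := by
  have : A.filtration 𝕜 n ≤ ⊥ := by
    refine Submodule.span_le.2 ?_
    rintro z ⟨j, q, ⟨s, m, f, ω, x, hf, hω, hx, hq, hn, rfl⟩⟩
    rw [SetLike.mem_coe, Submodule.mem_bot]
    by_cases hs : 0 < s
    · rw [SusyQM.eq_zero_of_mem_timeGrade hs hf, TensorProduct.zero_tmul, TensorProduct.zero_tmul]
    · have : x = 0 := by
        funext v
        refine hx v fun h => ?_
        have := (abs_le.1 (hC v)).1
        omega
      rw [this, TensorProduct.tmul_zero]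
  exact (Submodule.mem_bot 𝕜).1 (this hz)

variable {𝕜} in
-- Euler's formula holds both for the exterior algebra and for polynomials. The number of `θ`s is
-- `-j`, as each has degree `-1`.
theorem IsSimple.koszulW_eq {n j : ℤ} {q : ℕ} {z} (hz : A.IsSimple 𝕜 n j q z) :
    koszulW 𝕜 z = ((q - j : ℤ) : 𝕜) • z := by
  obtain ⟨s, m, f, ω, x, hf, hω, hx, hq, hn, rfl⟩ := hz
  have e1 : ∑ i, SusyQM.mulTheta 𝕜 i (SusyQM.dTheta 𝕜 i (f ⊗ₜ[𝕜] ω)) =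
      (-j : 𝕜) • (f ⊗ₜ[𝕜] ω) := by
    rw [← TensorProduct.tmul_smul, ← SusyQM.sum_iota_mul_contractLeft hω, TensorProduct.tmul_sum]
    rfl
  have e2 : (fun v => ∑ i, MvPolynomial.X i * MvPolynomial.pderiv i (x v)) = (q : 𝕜) • x := by
    funext v
    rw [(hq v).sum_X_mul_pderiv, Pi.smul_apply, Nat.cast_smul_eq_nsmul]
  rw [koszulW_tmul, e1, e2, ← TensorProduct.smul_tmul', TensorProduct.tmul_smul, ← add_smul]
  congr 1
  push_cast
  ring

theorem koszulK_mem_filtration {n : ℤ} {z} (hz : z ∈ A.filtration 𝕜 n) :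
    koszulK 𝕜 z ∈ A.filtration 𝕜 n := by
  refine A.map_filtration_le 𝕜 ?_ hz
  rintro j q z ⟨s, m, f, ω, x, hf, hω, hx, hq, hn, rfl⟩
  rw [koszulK_tmul]
  refine Submodule.sum_mem _ fun i _ => ?_
  exact A.tmul_mem_filtration hf (SusyQM.iota_mul_mem 𝕜 N _ _ _ hω)
    (fun u hu => by simp [hx u hu]) (fun v => (hq v).pderiv) hn

theorem lambdaEdge_isHomogeneous
    (a b : MvPolynomial (Fin N) 𝕜 →ₗ[MvPolynomial (Fin N) 𝕜] MvPolynomial (Fin N) 𝕜)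
    (ha : ∀ r q, r.IsHomogeneous q → (a r).IsHomogeneous q)
    (hb : ∀ r q, r.IsHomogeneous q → (b r).IsHomogeneous q) {x : V → MvPolynomial (Fin N) 𝕜}
    {q : ℕ} (hx : ∀ v, (x v).IsHomogeneous q) (v : V) :
    (A.lambdaEdge 𝕜 a b x v).IsHomogeneous (1 + q) := by
  rw [lambdaEdge_apply]
  refine MvPolynomial.IsHomogeneous.sum _ _ _ fun i _ =>
    (MvPolynomial.isHomogeneous_X _ _).mul ?_
  refine (MvPolynomial.homogeneousSubmodule (Fin N) 𝕜 q).toAddSubgroup.zsmul_mem ?_ _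
  change MvPolynomial.IsHomogeneous _ q
  split_ifs
  · exact ha _ _ (hx _)
  · exact hb _ _ (hx _)

/-- The part of the differential that does not preserve the filtration degree. -/
def perturbation : Module.End 𝕜 (SusyQM.Superfield 𝕜 N ⊗[𝕜] (V → MvPolynomial (Fin N) 𝕜)) :=
  TensorProduct.map (SusyQM.superPar 𝕜 N) ((A.lambdaEdge 𝕜 LinearMap.id 0).restrictScalars 𝕜) +
    TensorProduct.map (SusyQM.superPar 𝕜 N ∘ₗ SusyQM.dTime 𝕜 N)
      ((A.lambdaEdge 𝕜 0 LinearMap.id).restrictScalars 𝕜) +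
    ∑ i, TensorProduct.map (-(SusyQM.mulTheta 𝕜 i ∘ₗ SusyQM.dTime 𝕜 N))
      (Algebra.lsmul 𝕜 𝕜 (V → MvPolynomial (Fin N) 𝕜) (MvPolynomial.X i : MvPolynomial (Fin N) 𝕜))

theorem perturbation_tmul (F : SusyQM.Superfield 𝕜 N) (x : V → MvPolynomial (Fin N) 𝕜) :
    A.perturbation 𝕜 (F ⊗ₜ x) =
      SusyQM.superPar 𝕜 N F ⊗ₜ A.lambdaEdge 𝕜 LinearMap.id 0 x +
        SusyQM.superPar 𝕜 N (SusyQM.dTime 𝕜 N F) ⊗ₜ A.lambdaEdge 𝕜 0 LinearMap.id x +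
          ∑ i, (-SusyQM.mulTheta 𝕜 i (SusyQM.dTime 𝕜 N F)) ⊗ₜ
            ((MvPolynomial.X i : MvPolynomial (Fin N) 𝕜) • x) := by
  rw [perturbation]
  simp only [LinearMap.add_apply, LinearMap.sum_apply, TensorProduct.map_tmul,
    LinearMap.comp_apply, LinearMap.neg_apply, LinearMap.restrictScalars_apply, Algebra.lsmul_coe]

theorem spinorD_eq_koszulD_add_perturbation
    (z : SusyQM.Superfield 𝕜 N ⊗[𝕜] (V → MvPolynomial (Fin N) 𝕜)) :
    A.spinorD 𝕜 z = koszulD 𝕜 z + A.perturbation 𝕜 z := by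
  induction z using TensorProduct.induction_on with
  | zero => simp only [map_zero, add_zero]
  | add a b ha hb => rw [map_add, map_add, map_add, ha, hb, add_add_add_comm]
  | tmul F x =>
    have h (i : Fin N) : SusyQM.covD 𝕜 i F =
        SusyQM.dTheta 𝕜 i F + -SusyQM.mulTheta 𝕜 i (SusyQM.dTime 𝕜 N F) := sub_eq_add_neg _ _
    rw [koszulD_tmul, perturbation_tmul, spinorD]
    simp only [LinearMap.add_apply, LinearMap.sum_apply, TensorProduct.map_tmul, h,
      LinearMap.comp_apply, TensorProduct.add_tmul, Finset.sum_add_distrib,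
      LinearMap.restrictScalars_apply, Algebra.lsmul_coe]
    rw [add_assoc, add_assoc]
    congr 1
    rw [add_comm, add_assoc]

/-- `d` lowers the height by one. In `∂_t ⊗ d†` the height rises by one but the power of `t` drops
by one, which counts twice. The term with `θ_i ∂_t` lowers the filtration by two. -/
theorem perturbation_mem_filtration {n : ℤ} {z} (hz : z ∈ A.filtration 𝕜 n) :
    A.perturbation 𝕜 z ∈ A.filtration 𝕜 (n - 1) := by
  refine A.map_filtration_le 𝕜 ?_ hz
  rintro j q z ⟨s, m, f, ω, x, hf, hω, hx, hq, hn, rfl⟩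
  rw [perturbation_tmul]
  have hf' := SusyQM.derivative_mem 𝕜 _ _ hf
  have hω' := SusyQM.involute_mem 𝕜 N _ _ hω
  refine Submodule.add_mem _ (Submodule.add_mem _ ?_ ?_)
    (Submodule.sum_mem _ fun i _ => ?_)
  · exact A.tmul_mem_filtration hf hω' (A.lambdaEdge_id_zero_mem 𝕜 _ _ hx)
      (A.lambdaEdge_isHomogeneous 𝕜 _ _ (fun _ _ h => h)
        (fun _ _ _ => MvPolynomial.isHomogeneous_zero _ _ _) hq) (by omega)
  · exact A.tmul_mem_filtration hf' hω' (A.lambdaEdge_zero_id_mem 𝕜 _ _ hx)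
      (A.lambdaEdge_isHomogeneous 𝕜 _ _ (fun _ _ _ => MvPolynomial.isHomogeneous_zero _ _ _)
        (fun _ _ h => h) hq) (by omega)
  · have e : -SusyQM.mulTheta 𝕜 i (SusyQM.dTime 𝕜 N (f ⊗ₜ ω)) =
        Polynomial.derivative f ⊗ₜ (-(ExteriorAlgebra.ι 𝕜 (Pi.single i 1) * ω)) :=
      (TensorProduct.tmul_neg _ _).symm
    rw [e]
    exact A.tmul_mem_filtration hf' (neg_mem (SusyQM.iota_mul_mem 𝕜 N _ _ _ hω))
      (Submodule.smul_mem _ _ hx) (fun v => (MvPolynomial.isHomogeneous_X _ _).mul (hq v))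
      (by omega)

/-! ### The projection onto the multiplet -/

/-- The coefficient of a superfield at `θ = 0`. -/
def thetaZero : SusyQM.Superfield 𝕜 N →ₗ[𝕜] Polynomial 𝕜 :=
  (TensorProduct.rid 𝕜 (Polynomial 𝕜)).toLinearMap ∘ₗ
    (ExteriorAlgebra.algebraMapInv (R := 𝕜) (M := Fin N → 𝕜)).toLinearMap.lTensor (Polynomial 𝕜)

theorem thetaZero_tmul (f : Polynomial 𝕜) (ω : ExteriorAlgebra 𝕜 (Fin N → 𝕜)) :
    thetaZero 𝕜 (f ⊗ₜ ω) = ExteriorAlgebra.algebraMapInv ω • f := by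
  simp [thetaZero]

theorem thetaZero_mulTheta (i : Fin N) (F : SusyQM.Superfield 𝕜 N) :
    thetaZero 𝕜 (SusyQM.mulTheta 𝕜 i F) = 0 := by
  induction F using TensorProduct.induction_on with
  | zero => simp
  | add a b ha hb => rw [map_add, map_add, ha, hb, add_zero]
  | tmul f ω =>
    rw [SusyQM.mulTheta, LinearMap.lTensor_tmul, LinearMap.mulLeft_apply, thetaZero_tmul, map_mul,
      ExteriorAlgebra.algebraMapInv, ExteriorAlgebra.lift_ι_apply]
    simp

/-- The component at a vertex of the part with `θ = 0` and `λ = 0`. -/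
def bodyAt (v : V) : SusyQM.Superfield 𝕜 N ⊗[𝕜] (V → MvPolynomial (Fin N) 𝕜) →ₗ[𝕜]
    Polynomial 𝕜 :=
  (TensorProduct.rid 𝕜 (Polynomial 𝕜)).toLinearMap ∘ₗ
    TensorProduct.map (thetaZero 𝕜) (MvPolynomial.lcoeff 𝕜 0 ∘ₗ LinearMap.proj v)

theorem bodyAt_tmul (v : V) (F : SusyQM.Superfield 𝕜 N) (x : V → MvPolynomial (Fin N) 𝕜) :
    bodyAt 𝕜 v (F ⊗ₜ x) = MvPolynomial.constantCoeff (x v) • thetaZero 𝕜 F := by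
  simp [bodyAt, MvPolynomial.constantCoeff_eq]

/-- Every term of the differential contains a factor `λ_i`, which vanishes at `λ = 0`. -/
theorem bodyAt_spinorD (v : V) (z : SusyQM.Superfield 𝕜 N ⊗[𝕜] (V → MvPolynomial (Fin N) 𝕜)) :
    bodyAt 𝕜 v (A.spinorD 𝕜 z) = 0 := by
  induction z using TensorProduct.induction_on with
  | zero => simp
  | add a b ha hb => rw [map_add, map_add, ha, hb, add_zero]
  | tmul F x =>
    have h (a b) : MvPolynomial.constantCoeff (A.lambdaEdge 𝕜 a b x v) = 0 := by
      rw [lambdaEdge_apply, map_sum]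
      exact Finset.sum_eq_zero fun i _ => by simp
    rw [spinorD, LinearMap.add_apply, LinearMap.add_apply, LinearMap.sum_apply]
    simp only [map_add, map_sum, TensorProduct.map_tmul, LinearMap.restrictScalars_apply,
      bodyAt_tmul, h, zero_smul, add_zero]
    exact Finset.sum_eq_zero fun i _ => by simp

theorem thetaZero_spinExp (x : V → SusyQM.Superfield 𝕜 N) (v : V) :
    thetaZero 𝕜 (A.spinExp 𝕜 x v) = thetaZero 𝕜 (x v) := by
  rw [spinExp]
  generalize List.finRange N = l
  induction l with
  | nil => rfl
  | cons i l ih =>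
    rw [SusyQM.susyExp, List.map_cons, List.prod_cons]
    refine (map_add (thetaZero 𝕜) _ _).trans ?_
    refine (congrArg₂ (· + ·) ih (thetaZero_mulTheta 𝕜 i _)).trans ?_
    exact add_zero _

/-! ### Inverting the Koszul weight, and the second quasi-isomorphism -/

section

variable [Fintype V] [DecidableEq V]

theorem bodyAt_spinTotal (x : V → SusyQM.Superfield 𝕜 N) (v : V) :
    bodyAt 𝕜 v (spinTotal 𝕜 x) = thetaZero 𝕜 (x v) := by
  rw [spinTotal_apply, map_sum, Finset.sum_eq_single v]
  · rw [bodyAt_tmul, Pi.single_eq_same, map_one, one_smul]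
  · intro u _ hu
    rw [bodyAt_tmul, Pi.single_eq_of_ne hu.symm, map_zero, zero_smul]
  · simp

theorem bodyAt_multipletMap (φ : (A.multiplet 𝕜).carrier) (v : V) :
    bodyAt 𝕜 v (A.multipletMap 𝕜 φ) = A.parSign v • A.component 𝕜 v φ := by
  rw [multipletMap_apply, bodyAt_spinTotal, spinSign_apply, map_zsmul, thetaZero_spinExp,
    spinConst_apply, thetaZero_tmul, map_one, one_smul]

/-- An inverse of the weight operator away from its kernel. -/
theorem exists_koszulInverse : ∃ T : Module.End 𝕜
    (SusyQM.Superfield 𝕜 N ⊗[𝕜] (V → MvPolynomial (Fin N) 𝕜)),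
    Commute (koszulD 𝕜) T ∧
    (∀ n, ∀ z ∈ A.filtration 𝕜 n, T z ∈ A.filtration 𝕜 n) ∧
    ∀ z, (∀ v, bodyAt 𝕜 v z = 0) → T (koszulW 𝕜 z) = z := by
  let : AddCommGroup (SusyQM.Superfield 𝕜 N ⊗[𝕜] (V → MvPolynomial (Fin N) 𝕜)) :=
    Module.addCommMonoidToAddCommGroup 𝕜
  let 𝒢 : ℤ → Submodule 𝕜 (SusyQM.Superfield 𝕜 N ⊗[𝕜] (V → MvPolynomial (Fin N) 𝕜)) :=
    fun n => Module.End.eigenspace (koszulW 𝕜) (n : 𝕜)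
  have h𝒢 (n : ℤ) (z) : z ∈ 𝒢 n ↔ koszulW 𝕜 z = (n : 𝕜) • z := Module.End.mem_eigenspace_iff
  have top (z) : z ∈ ⨆ n, 𝒢 n := by
    obtain ⟨n, hz⟩ := A.exists_mem_filtration 𝕜 z
    have : A.filtration 𝕜 n ≤ ⨆ n, 𝒢 n := by
      refine Submodule.span_le.2 ?_
      rintro z ⟨j, q, hz⟩
      exact Submodule.mem_iSup_of_mem (q - j) ((h𝒢 _ _).2 hz.koszulW_eq)
    exact this hz
  -- `T` divides each eigenvector by its weight. In weight `0` it is zero by the convention for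
  -- inverses, which is harmless since `koszulW` already vanishes there.
  obtain ⟨T, hT⟩ := SusyQM.exists_degreeOperator 𝒢
    (SusyQM.isInternal_of_degreeOperator 𝒢 (koszulW 𝕜) (fun n z hz => (h𝒢 n z).1 hz) top)
    (fun n => (n : 𝕜)⁻¹)
  refine ⟨T, LinearMap.ext fun z => ?_, fun n z hz => ?_, fun z hz => ?_⟩
  · rw [Module.End.mul_apply, Module.End.mul_apply]
    induction top z using Submodule.iSup_induction' with
    | mem n z hz =>
      have h1 : koszulD 𝕜 z ∈ 𝒢 n := by
        rw [h𝒢, ← Module.End.mul_apply, ← (commute_koszulD_koszulW 𝕜).eq, Module.End.mul_apply,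
          (h𝒢 n z).1 hz, map_smul]
      rw [hT n z hz, hT n _ h1, map_smul]
    | zero => simp
    | add x y _ _ hx hy => simp only [map_add, hx, hy]
  · refine A.map_filtration_le 𝕜 (fun j q z hz => ?_) hz
    rw [hT (q - j) z ((h𝒢 _ _).2 hz.koszulW_eq)]
    exact Submodule.smul_mem _ _ (Submodule.subset_span ⟨j, q, hz⟩)
  -- Every element splits into its part of non-zero weight, fixed by `T` after `koszulW`, and its
  -- part of weight `0`, which is read off by `bodyAt`.
  · have key (z : SusyQM.Superfield 𝕜 N ⊗[𝕜] (V → MvPolynomial (Fin N) 𝕜)) :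
        z = T (koszulW 𝕜 z) + spinTotal (N := N) 𝕜 fun v => bodyAt 𝕜 v z ⊗ₜ 1 := by
      have add (a b : SusyQM.Superfield 𝕜 N ⊗[𝕜] (V → MvPolynomial (Fin N) 𝕜)) :
          (spinTotal (N := N) 𝕜 fun v => bodyAt 𝕜 v (a + b) ⊗ₜ 1) =
            (spinTotal (N := N) 𝕜 fun v => bodyAt 𝕜 v a ⊗ₜ 1) +
              spinTotal (N := N) 𝕜 fun v => bodyAt 𝕜 v b ⊗ₜ 1 := by
        simp only [spinTotal_apply, map_add, TensorProduct.add_tmul, Finset.sum_add_distrib]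
      have smul (c : 𝕜) (a : SusyQM.Superfield 𝕜 N ⊗[𝕜] (V → MvPolynomial (Fin N) 𝕜)) :
          (spinTotal (N := N) 𝕜 fun v => bodyAt 𝕜 v (c • a) ⊗ₜ 1) =
            c • spinTotal (N := N) 𝕜 fun v => bodyAt 𝕜 v a ⊗ₜ 1 := by
        simp only [spinTotal_apply, map_smul, ← TensorProduct.smul_tmul', Finset.smul_sum]
      obtain ⟨n, hz⟩ := A.exists_mem_filtration 𝕜 z
      induction hz using Submodule.span_induction with
      | zero => simp [spinTotal_apply]
      | add a b _ _ ha hb =>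
        rw [add, map_add, map_add, add_add_add_comm, ← ha, ← hb]
      | smul c a _ ha =>
        rw [smul, map_smul, map_smul, ← smul_add, ← ha]
      | mem z hz =>
        obtain ⟨j, q, hz⟩ := hz
        have e := hz.koszulW_eq
        have e' := hT (q - j) z ((h𝒢 _ _).2 e)
        obtain ⟨s, m, f, ω, x, hf, hω, hx, hq, hn, rfl⟩ := hz
        by_cases hw : (q - j : ℤ) = 0
        -- Since `j ≤ 0 ≤ q` unless `ω = 0`, weight `0` forces `q = j = 0`: the product involves
        -- neither `θ` nor `λ` and equals its own body.
        · have hj : ¬ 0 < j ∨ ω = 0 := by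
            by_cases h : 0 < j
            · exact Or.inr (SusyQM.eq_zero_of_mem_thetaGrade h hω)
            · exact Or.inl h
          rcases hj with hj | rfl
          · obtain rfl : q = 0 := by omega
            obtain rfl : j = 0 := by omega
            obtain ⟨c, rfl⟩ := SusyQM.exists_algebraMap_of_mem_thetaGrade hω
            have hx' (v : V) : x v = MvPolynomial.C (MvPolynomial.constantCoeff (x v)) := by
              rw [MvPolynomial.constantCoeff_eq]
              exact MvPolynomial.totalDegree_eq_zero_iff_eq_C.1
                (Nat.le_zero.1 (hq v).totalDegree_le)
            have hx'' : x = ∑ v, MvPolynomial.constantCoeff (x v) •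
                (Pi.single v 1 : V → MvPolynomial (Fin N) 𝕜) := by
              conv_lhs => rw [← Finset.univ_sum_single x]
              refine Finset.sum_congr rfl fun v _ => ?_
              rw [← Pi.single_smul, MvPolynomial.smul_eq_C_mul, mul_one, ← hx']
            rw [e, hw, Int.cast_zero, zero_smul, map_zero, zero_add, spinTotal_apply]
            conv_lhs => rw [hx'', TensorProduct.tmul_sum]
            refine Finset.sum_congr rfl fun v _ => ?_
            rw [bodyAt_tmul, thetaZero_tmul, ExteriorAlgebra.algebraMap_leftInverse,
              TensorProduct.tmul_smul, ← TensorProduct.smul_tmul', ← TensorProduct.smul_tmul',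
              ← TensorProduct.smul_tmul', Algebra.algebraMap_eq_smul_one, TensorProduct.tmul_smul,
              TensorProduct.smul_tmul']
          · simp [spinTotal_apply]
        -- In non-zero weight either a `θ` is present (`j ≠ 0`) or the coefficients have positive
        -- degree in `λ`; in both cases the body vanishes.
        · have h1 (v : V) : bodyAt 𝕜 v ((f ⊗ₜ[𝕜] ω) ⊗ₜ[𝕜] x) = 0 := by
            rw [bodyAt_tmul, thetaZero_tmul]
            by_cases hj : j = 0
            · have : MvPolynomial.constantCoeff (x v) = 0 := by
                rw [MvPolynomial.constantCoeff_eq]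
                refine (hq v).coeff_eq_zero ?_
                simp
                omega
              rw [this, zero_smul]
            · rw [SusyQM.algebraMapInv_of_mem_thetaGrade hj hω, zero_smul, smul_zero]
          have hw' : ((q - j : ℤ) : 𝕜) ≠ 0 := by exact_mod_cast hw
          rw [e, map_smul, e', smul_smul, mul_inv_cancel₀ hw', one_smul]
          simp [h1, spinTotal_apply]
    conv_rhs => rw [key z]
    simp [hz, spinTotal_apply]

/-- The kernel of the projection onto the multiplet is acyclic. -/
theorem exists_spinorD_eq {z : SusyQM.Superfield 𝕜 N ⊗[𝕜] (V → MvPolynomial (Fin N) 𝕜)}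
    (hz : A.spinorD 𝕜 z = 0) (hz' : ∀ v, bodyAt 𝕜 v z = 0) : ∃ y, z = A.spinorD 𝕜 y := by
  let : AddCommGroup (SusyQM.Superfield 𝕜 N ⊗[𝕜] (V → MvPolynomial (Fin N) 𝕜)) :=
    Module.addCommMonoidToAddCommGroup 𝕜
  obtain ⟨T, hT, hT', hT''⟩ := A.exists_koszulInverse 𝕜
  obtain ⟨C, hC⟩ := A.exists_abs_height_le
  obtain ⟨n, hn⟩ := A.exists_mem_filtration 𝕜 z
  -- `Z` is the common kernel of the `bodyAt`. The number `(n + C).toNat` bounds the steps needed to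
  -- descend from `n` to `-C`, where the filtration is zero.
  refine SusyQM.exists_eq_of_filtration (D := A.spinorD 𝕜) (D₀ := koszulD 𝕜)
    (P := A.perturbation 𝕜) (K := koszulK 𝕜) (T := T) (F := A.filtration 𝕜)
    (Z := ⨅ v, LinearMap.ker (bodyAt 𝕜 v)) (A.spinorD_eq_koszulD_add_perturbation 𝕜)
    (A.spinorD_spinorD 𝕜) (LinearMap.congr_fun hT.eq)
    (fun z hz => hT'' z (by simpa using hz)) (fun z => by simp [bodyAt_spinorD]) hT'
    (fun n z hz => A.koszulK_mem_filtration 𝕜 hz)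
    (fun n z hz => A.perturbation_mem_filtration 𝕜 hz) (C := C)
    (fun z hz => A.filtration_eq_bot 𝕜 hC (by simp) hz) (n + C).toNat
    (A.filtration_mono 𝕜 (by omega) hn) hz (by simpa using hz')

/-- Taking the body is, up to sign, a left inverse of the map and kills boundaries. A closed element
minus the image of its body is closed with zero body, hence exact. -/
theorem quasiIso_multipletHom : QuasiIso (A.multipletHom 𝕜).complexMap := by
  refine (A.multipletHom 𝕜).quasiIso_complexMap ?_ ?_
  · intro (z : SusyQM.Superfield 𝕜 N ⊗[𝕜] (V → MvPolynomial (Fin N) 𝕜))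
      (hz : A.spinorD 𝕜 z = 0)
    -- The sign `(-1)^{|v|}` undoes the one in `bodyAt_multipletMap`.
    let φ : (A.multiplet 𝕜).carrier :=
      A.ofComponents 𝕜 (fun v => A.parSign v • bodyAt 𝕜 v) z
    obtain ⟨y, hy⟩ := A.exists_spinorD_eq 𝕜 (z := z + (-1 : 𝕜) • A.multipletMap 𝕜 φ)
      (by rw [map_add, map_smul, hz, spinorD_multipletMap, smul_zero, add_zero]) (fun v => by
        rw [map_add, map_smul, bodyAt_multipletMap, component_ofComponents, LinearMap.smul_apply, smul_smul,
          A.parSign_mul_self, one_smul, neg_one_smul, add_neg_cancel])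
    refine ⟨φ, y, rfl, ?_⟩
    change z = A.multipletMap 𝕜 φ + A.spinorD 𝕜 y
    rw [← hy, add_left_comm]
    nth_rw 1 [← one_smul 𝕜 (A.multipletMap 𝕜 φ)]
    rw [← add_smul, add_neg_cancel, zero_smul, add_zero]
  · intro (φ : (A.multiplet 𝕜).carrier)
      (y : SusyQM.Superfield 𝕜 N ⊗[𝕜] (V → MvPolynomial (Fin N) 𝕜)) _
      (h : A.multipletMap 𝕜 φ = A.spinorD 𝕜 y)
    -- The multiplet has zero differential, so being a boundary means `φ = 0`.
    refine ⟨0, A.field_ext fun v => ?_⟩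
    have h1 := congrArg (bodyAt 𝕜 v) h
    rw [bodyAt_multipletMap, bodyAt_spinorD] at h1
    have h2 := congrArg (fun f => A.parSign v • f) h1
    simp only [smul_smul, A.parSign_mul_self, one_smul, smul_zero] at h2
    exact h2.trans (map_zero _).symm

end

end

end Adinkra

theorem mainTheorem8 (𝕜 : Type u) [RCLike 𝕜] (N : ℕ) (V : Type v) [Finite V] (A : Adinkra N V)
    [HasDerivedCategory.{w} (ModuleCat.{max u v} (MvPolynomial (Fin N) 𝕜))] :
    (∃ (h₁ : DerivedCategory.TStructure.t.bounded
          (DerivedCategory.Q.obj (A.complexC 𝕜).complex))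
        (h₂ : DerivedCategory.TStructure.t.bounded
          (DerivedCategory.Q.obj (SusyQM.CE (A.multiplet 𝕜)).complex)),
        Nonempty ((⟨_, h₁⟩ : DerivedCategory.TStructure.t.bounded.FullSubcategory) ≅ ⟨_, h₂⟩)) ∧
      (∃ f : SusyQM.CEModule.Hom (SusyQM.CE (A.multiplet 𝕜)) (A.complexC 𝕜),
        QuasiIso f.complexMap) ∧
      ∃ f : SusyQM.DGTModule.Hom (A.multiplet 𝕜).toDG (SusyQM.pureSpinor (A.complexC 𝕜)),
        QuasiIso f.complexMap := by
  classical
  have := Fintype.ofFinite V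
  exact ⟨A.bounded_iso_CE 𝕜, ⟨A.ceToComplexC 𝕜, A.quasiIso_ceToComplexC 𝕜⟩,
    ⟨A.multipletHom 𝕜, A.quasiIso_multipletHom 𝕜⟩⟩
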